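/- Let $d\ge 2$, $0\le p\le d$, and let $E^{p,d-p}$ be $\mathbb{R}^d$ with the quadratic form $q(x)=x_1^2+\cdots+x_p^2-x_{p+1}^2-\cdots-x_d^2$. A \emph{similarity} is a map $x\mapsto r\,Ax+c$ with $r>0$, $c\in\mathbb{R}^d$ and $A$ linear with $q\circ A=q$. A \emph{similarity pseudo-Euclidean manifold} of signature $(p,d-p)$ is a Hausdorff space $M$ with an atlas taking values in $E^{p,d-p}$ whose changes of charts are locally similarities. A smooth affine connection $\nabla$ on $M$ is \emph{stiff} if (i) it is symmetric (torsion free); (ii) in every chart of the atlas, each geodesic of $\nabla$ is contained in a straight line; (iii) in every chart and at every point, the first-order infinitesimal holonomies are infinitesimal isometries: for all $i,j$, the holonomy around the rectangle based at the point with sides $s e_i$, $t e_j$ is $\mathrm{Id}+st\,\mathcal M+o(st)$ as $s,t\to 0^+$, where $\mathcal M$ is skew for the symmetric bilinear form of $q$. The connection is \emph{flat} if every point has a neighbourhood in which the holonomy of every closed path is the identity, and \emph{geodesically complete} if every geodesic extends to a geodesic defined on $\mathbb{R}$. An \emph{isomorphism} of such pairs $(M,\nabla)$ is a homeomorphism that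 is locally a similarity in the charts (hence a diffeomorphism) and that pulls the second connection back to the first. The \emph{connection of potential $\psi$} (a nowhere vanishing smooth function on an open subset of $\mathbb{R}^d$) is $\nabla_XY=\partial_XY+a(X)Y+a(Y)X$ with $a=-d\psi/\psi$. Let $\mathcal S^-_{-1}(d,0)$ be the set $\{q<1\}\subset E^{d,0}$ with the connection of potential $q-1$, and $\mathcal S^+_{1}(0,d)$ the set $\{q>-1\}\subset E^{0,d}$ with the connection of potential $q+1$; both sets are the open Euclidean unit ball of $\mathbb{R}^d$. \textbf{Theorem.} Let $M$ be a connected similarity pseudo-Euclidean manifold of dimension $d\ge2$ and signature $(p,d-p)$, and let $\nabla$ be a stiff connection on $M$ that is not flat. Then $(M,\nabla)$ is geodesically complete if and only if either the signature is $(d,0)$ and $(M,\nabla)$ is isomorphic to $\mathcal S^-_{-1}(d,0)$, or the signature is $(0,d)$ and $(M,\nabla)$ is isomorphic to $\mathcal S^+_{1}(0,d)$. -/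

import Mathlib

open Set Filter Topology
open scoped ContDiff Manifold

noncomputable section

namespace StiffConnections

/-! ### Pseudo-Euclidean spaces and similarities -/

/-- The vector space `ℝ^d` underlying the pseudo-Euclidean space `E^{p,d-p}`. The norm only serves
to provide the usual topology and smooth structure, so that its choice is irrelevant. -/
abbrev E (d : ℕ) : Type := Fin d → ℝ

/-- The signs `ε_i`: the first `p` of them are `1`, the other ones are `-1`. -/
def eps (p : ℕ) {d : ℕ} (i : Fin d) : ℝ := if (i : ℕ) < p then 1 else -1

/-- The bilinear form `∑ ε_i u_i v_i` of signature `(p, d-p)`. -/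
def form (p d : ℕ) : E d →L[ℝ] E d →L[ℝ] ℝ :=
  ∑ i : Fin d, eps p i •
    (ContinuousLinearMap.proj i : E d →L[ℝ] ℝ).smulRight
      (ContinuousLinearMap.proj i : E d →L[ℝ] ℝ)

/-- The quadratic form `q(x) = x_1² + ⋯ + x_p² - x_{p+1}² - ⋯ - x_d²`. -/
def quad (p d : ℕ) (x : E d) : ℝ := form p d x x

/-- Affine similarities of `E^{p,d-p}`: a linear isometry of `q`, followed by a homothety of
ratio `r > 0` and a translation. -/
def IsSimilarity (p d : ℕ) (A : E d → E d) : Prop :=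
  ∃ (r : ℝ) (L : E d →L[ℝ] E d) (c : E d), 0 < r ∧ (∀ x, quad p d (L x) = quad p d x) ∧
    ∀ x, A x = r • L x + c

theorem IsSimilarity.refl (p d : ℕ) : IsSimilarity p d id :=
  ⟨1, ContinuousLinearMap.id ℝ _, 0, one_pos, fun _ => rfl, fun x => by simp⟩

theorem IsSimilarity.comp {p d : ℕ} {A B : E d → E d} (hB : IsSimilarity p d B)
    (hA : IsSimilarity p d A) : IsSimilarity p d (B ∘ A) := by
  obtain ⟨r, L, c, hr, hL, hA⟩ := hA
  obtain ⟨r', L', c', hr', hL', hB⟩ := hB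
  refine ⟨r' * r, L'.comp L, r' • L' c + c', mul_pos hr' hr, fun x => ?_, fun x => ?_⟩
  · simp [hL, hL']
  · simp [hA, hB, mul_smul, add_assoc]

theorem IsSimilarity.continuous {p d : ℕ} {A : E d → E d} (hA : IsSimilarity p d A) :
    Continuous A := by
  obtain ⟨r, L, c, -, -, hA⟩ := hA
  rw [funext hA]
  fun_prop

/-- `f` coincides near every point of `s` with a similarity of `E^{p,d-p}`. -/
def IsLocalSimilarityOn (p d : ℕ) (f : E d → E d) (s : Set (E d)) : Prop :=
  ∀ x ∈ s, ∃ A, IsSimilarity p d A ∧ f =ᶠ[𝓝 x] A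

/-- Local similarities of `E^{p,d-p}`, as a pregroupoid. -/
def similarityPregroupoid (p d : ℕ) : Pregroupoid (E d) where
  property := IsLocalSimilarityOn p d
  comp := by
    intro f g u v hf hg _ _ _ x hx
    obtain ⟨A, hA, hfA⟩ := hf x hx.1
    obtain ⟨B, hB, hgB⟩ := hg (f x) hx.2
    refine ⟨B ∘ A, hB.comp hA, ?_⟩
    have h1 : Tendsto f (𝓝 x) (𝓝 (f x)) := by
      rw [hfA.eq_of_nhds]
      exact (hA.continuous.tendsto x).congr' hfA.symm
    filter_upwards [hfA, h1.eventually hgB] with y hy1 hy2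
    rw [Function.comp_apply, Function.comp_apply, hy2, hy1]
  id_mem := fun _ _ => ⟨id, IsSimilarity.refl p d, EventuallyEq.rfl⟩
  locality := by
    intro f u _ h x hx
    obtain ⟨v, _, hxv, hv⟩ := h x hx
    exact hv x ⟨hx, hxv⟩
  congr := by
    intro f g u hu hfg hf x hx
    obtain ⟨A, hA, hfA⟩ := hf x hx
    refine ⟨A, hA, EventuallyEq.trans ?_ hfA⟩
    filter_upwards [hu.mem_nhds hx] with y hy using hfg y hy

/-- The structure groupoid of local similarities of `E^{p,d-p}`. A similarity pseudo-Euclidean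
manifold of signature `(p, d-p)` is a space with an atlas whose changes of charts belong to it. -/
def similarityGroupoid (p d : ℕ) : StructureGroupoid (E d) :=
  (similarityPregroupoid p d).groupoid

/-! ### Curves, geodesics and parallel transport in a chart

A connection on an open subset of `ℝ^d` is `∇_X Y = ∂_X Y + Γ(X, Y)`, where `Γ` is a field of
bilinear maps (its components are the Christoffel symbols). -/

/-- A field of bilinear maps `ℝ^d × ℝ^d → ℝ^d`. -/
abbrev Symbol (d : ℕ) : Type := E d → E d →L[ℝ] E d →L[ℝ] E d

/-- The geodesic equation `c'' = - Γ_c (c', c')` at all times in the open set `J`. -/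
def SolvesGeodesicEq {d : ℕ} (Γ : Symbol d) (c : ℝ → E d) (J : Set ℝ) : Prop :=
  ∀ t ∈ J, DifferentiableAt ℝ c t ∧
    HasDerivAt (deriv c) (-(Γ (c t) (deriv c t) (deriv c t))) t

/-- `w'` is the parallel transport of `w` along the curve `c : [0,1] → ℝ^d`: there is a solution of
`W' = - Γ_c (c', W)` on `[0,1]` with `W 0 = w` and `W 1 = w'`. -/
def ParallelTransport {d : ℕ} (Γ : Symbol d) (c : ℝ → E d) (w w' : E d) : Prop :=
  ∃ W : ℝ → E d, W 0 = w ∧ W 1 = w' ∧ ∀ t ∈ Icc (0 : ℝ) 1,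
    HasDerivWithinAt W (-(Γ (c t) (derivWithin c (Icc 0 1) t) (W t))) (Icc 0 1) t

/-- `w'` is the parallel transport of `w` around the boundary of the rectangular flag
`x → x + u → x + u + v → x + v → x`. -/
def RectangleHolonomy {d : ℕ} (Γ : Symbol d) (x u v w w' : E d) : Prop :=
  ∃ w₁ w₂ w₃ : E d,
    ParallelTransport Γ (fun t => x + t • u) w w₁ ∧
    ParallelTransport Γ (fun t => x + u + t • v) w₁ w₂ ∧
    ParallelTransport Γ (fun t => x + u + v - t • u) w₂ w₃ ∧
    ParallelTransport Γ (fun t => x + v - t • v) w₃ w'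

/-- `A` is the first-order infinitesimal holonomy at `x` in the directions `e_i`, `e_j`: the
holonomy `H` of the rectangle with sides `s e_i`, `t e_j` is `Id + (s t) A + o(s t)` as the
rectangle shrinks to `x`. -/
def IsInfinitesimalHolonomy {d : ℕ} (Γ : Symbol d) (x : E d) (i j : Fin d)
    (A : E d →L[ℝ] E d) : Prop :=
  ∀ ε > 0, ∃ δ > 0, ∀ s ∈ Ioo (0 : ℝ) δ, ∀ t ∈ Ioo (0 : ℝ) δ,
    ∃ H : E d →L[ℝ] E d,
      (∀ w w', RectangleHolonomy Γ x (s • Pi.single i 1) (t • Pi.single j 1) w w' ↔ w' = H w) ∧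
      ‖H - ContinuousLinearMap.id ℝ (E d) - (s * t) • A‖ ≤ ε * (s * t)

/-- Infinitesimal isometries of `E^{p,d-p}`: endomorphisms that are skew for the bilinear form. -/
def IsInfinitesimalIsometry (p d : ℕ) (A : E d →L[ℝ] E d) : Prop :=
  ∀ u v, form p d (A u) v + form p d u (A v) = 0

/-- The effect on Christoffel symbols of a change of variable `φ` near `x`: with `L = Dφ(x)` and
`H = D²φ(x)`, one has `Γ'_{φ(x)}(L u, L v) = L (Γ_x(u, v)) - H(u, v)`. -/
def TransformsAt {d : ℕ} (φ : E d → E d) (Γ Γ' : Symbol d) (x : E d) : Prop :=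
  ∀ u v, Γ' (φ x) (fderiv ℝ φ x u) (fderiv ℝ φ x v) =
    fderiv ℝ φ x (Γ x u v) - fderiv ℝ (fderiv ℝ φ) x u v

/-! ### Connections on manifolds -/

/-- A smooth affine connection on a manifold modelled on `ℝ^d`, given by its Christoffel symbols
in the charts of the atlas. -/
structure AffineConnection (d : ℕ) (M : Type*) [TopologicalSpace M] [ChartedSpace (E d) M] where
  /-- The Christoffel symbols in a chart; only the values on the target of a chart of the atlas
  are meaningful. -/
  symbol : OpenPartialHomeomorph M (E d) → Symbol d
  contDiffOn : ∀ e ∈ atlas (E d) M, ContDiffOn ℝ ∞ (symbol e) e.target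
  compatible : ∀ e ∈ atlas (E d) M, ∀ e' ∈ atlas (E d) M, ∀ x ∈ (e.symm.trans e').source,
    TransformsAt (e' ∘ e.symm) (symbol e) (symbol e') x

namespace AffineConnection

variable {d : ℕ} {M : Type*} [TopologicalSpace M] [ChartedSpace (E d) M]

/-- `γ`, restricted to the open set of times `I`, is a (parameterized) geodesic. -/
def IsGeodesicOn (conn : AffineConnection d M) (γ : ℝ → M) (I : Set ℝ) : Prop :=
  ContinuousOn γ I ∧
    ∀ e ∈ atlas (E d) M, SolvesGeodesicEq (conn.symbol e) (e ∘ γ) (I ∩ γ ⁻¹' e.source)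

/-- Every geodesic, defined on an open interval, extends to a geodesic defined on `ℝ`. -/
def GeodesicallyComplete (conn : AffineConnection d M) : Prop :=
  ∀ (I : Set ℝ) (γ : ℝ → M), IsOpen I → I.OrdConnected → conn.IsGeodesicOn γ I →
    ∃ γ' : ℝ → M, conn.IsGeodesicOn γ' univ ∧ EqOn γ' γ I

/-- Every point has a neighbourhood in which the holonomy of every closed curve is the identity. -/
def IsFlat (conn : AffineConnection d M) : Prop :=
  ∀ e ∈ atlas (E d) M, ∀ x ∈ e.target, ∃ U ∈ 𝓝 x, U ⊆ e.target ∧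
    ∀ c : ℝ → E d, ContDiffOn ℝ 1 c (Icc 0 1) → MapsTo c (Icc 0 1) U → c 0 = c 1 →
      ∀ w w', ParallelTransport (conn.symbol e) c w w' → w' = w

/-- Stiff connections for a (similarity) pseudo-Euclidean structure of signature `(p, d-p)`. -/
structure IsStiff (conn : AffineConnection d M) (p : ℕ) : Prop where
  symmetric : ∀ e ∈ atlas (E d) M, ∀ x ∈ e.target, ∀ u v,
    conn.symbol e x u v = conn.symbol e x v u
  straight : ∀ e ∈ atlas (E d) M, ∀ (I : Set ℝ) (c : ℝ → E d), IsOpen I → I.OrdConnected →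
    MapsTo c I e.target → SolvesGeodesicEq (conn.symbol e) c I → Collinear ℝ (c '' I)
  holonomy : ∀ e ∈ atlas (E d) M, ∀ x ∈ e.target, ∀ i j : Fin d, ∃ A : E d →L[ℝ] E d,
    IsInfinitesimalHolonomy (conn.symbol e) x i j A ∧ IsInfinitesimalIsometry p d A

/-- Isomorphism of pairs formed by a similarity pseudo-Euclidean manifold of signature `(p, d-p)`
and a connection: a bijection which is a local similarity in the charts and under which the
connection of `M` is the pullback of that of `M'`. -/
def Isomorphic (p : ℕ) (conn : AffineConnection d M)
    {M' : Type*} [TopologicalSpace M'] [ChartedSpace (E d) M'] (conn' : AffineConnection d M') :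
    Prop :=
  ∃ f : M ≃ₜ M', ∀ e ∈ atlas (E d) M, ∀ e' ∈ atlas (E d) M',
    IsLocalSimilarityOn p d (e' ∘ f ∘ e.symm) (e.target ∩ (f ∘ e.symm) ⁻¹' e'.source) ∧
    ∀ x ∈ e.target ∩ (f ∘ e.symm) ⁻¹' e'.source,
      TransformsAt (e' ∘ f ∘ e.symm) (conn.symbol e) (conn'.symbol e') x

end AffineConnection

/-! ### Canonical models -/

/-- The Christoffel symbol `Γ(u, v) = a(u) v + a(v) u` with associated form `a`. -/
def projectiveSymbol {d : ℕ} (a : E d →L[ℝ] ℝ) : E d →L[ℝ] E d →L[ℝ] E d :=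
  a.smulRight (ContinuousLinearMap.id ℝ (E d)) +
    (a.smulRight (ContinuousLinearMap.id ℝ (E d))).flip

theorem projectiveSymbol_apply {d : ℕ} (a : E d →L[ℝ] ℝ) (u v : E d) :
    projectiveSymbol a u v = a u • v + a v • u := by
  simp [projectiveSymbol]

/-- The connection of potential `ψ`: its associated form is `a = - dψ / ψ`. -/
def potentialSymbol {d : ℕ} (ψ : E d → ℝ) : Symbol d :=
  fun x => projectiveSymbol (-((ψ x)⁻¹ • fderiv ℝ ψ x))

/-- The potential `ψ = q + lam`. -/
def modelPotential (lam : ℝ) (p d : ℕ) (x : E d) : ℝ := quad p d x + lam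

theorem contDiff_modelPotential (lam : ℝ) (p d : ℕ) : ContDiff ℝ ∞ (modelPotential lam p d) := by
  unfold modelPotential quad
  fun_prop

/-- The domain of the canonical model of sign `ν` and constant `lam` in `E^{p,d-p}`: the points
where `ψ = q + lam` has the sign `ν`, with moreover `x_1 > 0` if `ν = +`, `p = 1`, `lam ≤ 0`, and
`x_d > 0` if `ν = -`, `d - p = 1`, `lam ≥ 0`. -/
def modelDomain (ν : ℤˣ) (lam : ℝ) (p d : ℕ) : TopologicalSpace.Opens (E d) where
  carrier := {x | 0 < ((ν : ℤ) : ℝ) * modelPotential lam p d x} ∩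
    {x | ∀ i : Fin d, ((ν = 1 ∧ p = 1 ∧ lam ≤ 0 ∧ (i : ℕ) = 0) ∨
      (ν = -1 ∧ d = p + 1 ∧ 0 ≤ lam ∧ (i : ℕ) + 1 = d)) → 0 < x i}
  is_open' := by
    have hψ := (contDiff_modelPotential lam p d).continuous
    refine IsOpen.inter (isOpen_lt continuous_const (continuous_const.mul hψ)) ?_
    have h := (toFinite {i : Fin d | (ν = 1 ∧ p = 1 ∧ lam ≤ 0 ∧ (i : ℕ) = 0) ∨
      (ν = -1 ∧ d = p + 1 ∧ 0 ≤ lam ∧ (i : ℕ) + 1 = d)}).isOpen_biInter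
      (f := fun i => {x : E d | 0 < x i})
      fun i _ => isOpen_lt continuous_const (by fun_prop)
    convert h using 1
    ext x
    simp only [mem_iInter]
    rfl

theorem Opens.atlas_apply {d : ℕ} {U : TopologicalSpace.Opens (E d)}
    {e : OpenPartialHomeomorph U (E d)} (he : e ∈ atlas (E d) U) (z : U) : e z = z := by
  obtain ⟨x, hx⟩ := mem_iUnion.1 he
  rw [mem_singleton_iff.1 hx]
  rfl

theorem Opens.atlas_target {d : ℕ} {U : TopologicalSpace.Opens (E d)}
    {e : OpenPartialHomeomorph U (E d)} (he : e ∈ atlas (E d) U) {x : E d} (hx : x ∈ e.target) :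
    x ∈ U := by
  rw [← e.right_inv hx, Opens.atlas_apply he]
  exact (e.symm x).2

theorem Opens.atlas_trans {d : ℕ} {U : TopologicalSpace.Opens (E d)}
    {e e' : OpenPartialHomeomorph U (E d)} (he : e ∈ atlas (E d) U) (he' : e' ∈ atlas (E d) U)
    {x : E d} (hx : x ∈ e.target) : e' ∘ e.symm =ᶠ[𝓝 x] id := by
  filter_upwards [e.open_target.mem_nhds hx] with y hy
  rw [Function.comp_apply, Opens.atlas_apply he', ← Opens.atlas_apply he, e.right_inv hy, id]

/-- An open subset of `E^{p,d-p}` is a similarity pseudo-Euclidean manifold. -/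
instance Opens.hasGroupoid {d : ℕ} (p : ℕ) (U : TopologicalSpace.Opens (E d)) :
    HasGroupoid U (similarityGroupoid p d) where
  compatible := by
    intro e e' he he'
    refine ⟨fun x hx => ⟨id, .refl p d, Opens.atlas_trans he he' ?_⟩,
      fun x hx => ⟨id, .refl p d, Opens.atlas_trans he' he ?_⟩⟩
    · exact hx.1
    · exact hx.1

theorem modelPotential_ne_zero {ν : ℤˣ} {lam : ℝ} {p d : ℕ} {x : E d}
    (hx : x ∈ modelDomain ν lam p d) : modelPotential lam p d x ≠ 0 := by
  intro h
  have := hx.1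
  simp [h] at this

/-- The canonical model `S^ν_lam(p, d-p)`: the connection of potential `ψ = q + lam`, on the open
subset `modelDomain ν lam p d` of `E^{p,d-p}`. -/
def canonicalModel (ν : ℤˣ) (lam : ℝ) (p d : ℕ) :
    AffineConnection d (modelDomain ν lam p d) where
  symbol _ := potentialSymbol (modelPotential lam p d)
  contDiffOn := by
    intro e he
    refine contDiffOn_clm_apply.2 fun u => contDiffOn_clm_apply.2 fun v => ?_
    simp only [potentialSymbol, projectiveSymbol_apply]
    intro x hx
    refine ContDiffAt.contDiffWithinAt ?_
    have hψ := contDiff_modelPotential lam p d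
    have h0 := modelPotential_ne_zero (Opens.atlas_target he hx)
    have ha : ContDiffAt ℝ ∞ (fun x => -((modelPotential lam p d x)⁻¹ •
        fderiv ℝ (modelPotential lam p d) x)) x :=
      ((hψ.contDiffAt.inv h0).smul (hψ.fderiv_right (m := ∞) (by simp)).contDiffAt).neg
    exact ((ha.clm_apply contDiffAt_const).smul contDiffAt_const).add
      ((ha.clm_apply contDiffAt_const).smul contDiffAt_const)
  compatible := by
    intro e he e' he' x hx u v
    have h := Opens.atlas_trans he he' hx.1
    rw [h.fderiv.fderiv_eq, h.fderiv_eq, h.eq_of_nhds]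
    have h2 : fderiv ℝ (id : E d → E d) = fun _ => ContinuousLinearMap.id ℝ (E d) := by
      funext y
      exact fderiv_id
    simp [h2]

end StiffConnections

end

open StiffConnections

noncomputable section

namespace StiffConnections

set_option maxSynthPendingDepth 3

/-! ### Geodesics with prescribed initial data -/

/-! Local form. Straight geodesics force `Γ(u, u)` to be a multiple of `u`, and symmetry then gives
`Γ(u, v) = a(u) v + a(v) u` for a one-form `a` (`eq_projectiveSymbol`). The infinitesimal holonomy
is the curvature (`IsInfinitesimalHolonomy.apply_eq`), which depends only on `B = Da - a ⊗ a`; its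
skewness for `q` means `B = k q` for a function `k` (`eq_smul_form_of_skew`). Symmetry of `D²a`
gives `dk = k a`, and this closed system integrates to `a = -dψ/ψ` with `ψ = c q + affine`
(`IsStiff.exists_potential`). When `c = 0`, parallel transport has explicit first integrals and no
holonomy, so a connection that is not flat has a point `x` with `c ≠ 0`.

Completeness implies the ball. On a line `x + s v` the affine parameter is `∫ ds/ψ²`, finite as long
as `ψ ≠ 0`. Completeness therefore extends the inverse of a chart at `x` to a map `F` into `M`, a
similarity in the charts, over all points seen from `x` along segments where `ψ ≠ 0`
(`GeodesicallyComplete.exists_development`). If `ψ` had no zero on a ray with `q(v) ≠ 0`, its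
quadratic growth would make the ray of finite affine length; its image would converge in `M`,
although it is an unbounded affine ray in a chart at the limit. So `ψ` vanishes in both directions
`v` and `-v`, whence `ψ(x) c q(v) < 0` (`GeodesicallyComplete.mul_quad_neg`). The basis vectors show
that `q` is definite, and a similarity normalizes `ψ` to a multiple of `|x|² - 1` with `x` inside
the ball.

The development of the ball is injective because two points with the same image differ by a
similarity `C` with `F ∘ C = F` that fixes the centre, where `F` is locally injective
(`IsDevelopmentOn.injOn_ball`). It is surjective because its image is open and closed
(`IsDevelopmentOn.image_ball`).

Converse. On a chord of the ball, `ψ` is a quadratic with simple roots at both ends, so `∫ ds/ψ²`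
diverges there and every geodesic is defined for all times (`exists_geodesic_ball`). -/

/-- Picard–Lindelöf for the first-order system `(x, u)' = (u, -Γ_x(u, u))` in phase space; the time
interval is shrunk to stay in `U`. -/
theorem exists_geodesic {d : ℕ} {Γ : Symbol d} {U : Set (E d)} (hU : IsOpen U)
    (hΓ : ContDiffOn ℝ ∞ Γ U) {x : E d} (hx : x ∈ U) (u : E d) :
    ∃ c : ℝ → E d, ∃ δ > 0, c 0 = x ∧ deriv c 0 = u ∧ MapsTo c (Ioo (-δ) δ) U ∧
      SolvesGeodesicEq Γ c (Ioo (-δ) δ) := by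
  let f : E d × E d → E d × E d := fun z => (z.2, -(Γ z.1 z.2 z.2))
  have hf : ContDiffAt ℝ 1 f (x, u) := by
    have h1 : ContDiffAt ℝ 1 (fun z : E d × E d => Γ z.1) (x, u) :=
      ContDiffAt.comp (x, u) (g := Γ)
        (((hΓ x hx).contDiffAt (hU.mem_nhds hx)).of_le (by simp)) contDiffAt_fst
    exact contDiffAt_snd.prodMk ((h1.clm_apply contDiffAt_snd).clm_apply contDiffAt_snd).neg
  obtain ⟨α, hα0, ε, hε, hα⟩ :=
    hf.exists_forall_mem_closedBall_exists_eq_forall_mem_Ioo_hasDerivAt₀ 0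
  have hd1 : ∀ t ∈ Ioo (-ε) ε, HasDerivAt (fun t => (α t).1) (α t).2 t := fun t ht => by
    have h := hα t (by simpa using ht)
    exact (ContinuousLinearMap.fst ℝ (E d) (E d)).hasFDerivAt.comp_hasDerivAt t h
  have hd2 : ∀ t ∈ Ioo (-ε) ε,
      HasDerivAt (fun t => (α t).2) (-(Γ (α t).1 (α t).2 (α t).2)) t := fun t ht => by
    have h := hα t (by simpa using ht)
    exact (ContinuousLinearMap.snd ℝ (E d) (E d)).hasFDerivAt.comp_hasDerivAt t h
  have h0 : (0 : ℝ) ∈ Ioo (-ε) ε := ⟨by linarith, hε⟩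
  have hcont : ContinuousAt (fun t => (α t).1) 0 := (hd1 0 h0).continuousAt
  have hev : ∀ᶠ t in 𝓝 (0 : ℝ), (α t).1 ∈ U :=
    hcont.eventually_mem (hU.mem_nhds (by simpa [hα0] using hx))
  obtain ⟨δ', hδ', hδU⟩ := Metric.eventually_nhds_iff.1 hev
  refine ⟨fun t => (α t).1, min ε δ', lt_min hε hδ', by simp [hα0], ?_, ?_, ?_⟩
  · rw [(hd1 0 h0).deriv, hα0]
  · intro t ht
    refine hδU ?_
    rw [Real.dist_eq, sub_zero, abs_lt]
    exact ⟨by linarith [ht.1, min_le_right ε δ'], ht.2.trans_le (min_le_right _ _)⟩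
  · have hsub : Ioo (-(min ε δ')) (min ε δ') ⊆ Ioo (-ε) ε :=
      Ioo_subset_Ioo (neg_le_neg (min_le_left _ _)) (min_le_left _ _)
    intro t ht
    have hev : deriv (fun t => (α t).1) =ᶠ[𝓝 t] fun t => (α t).2 := by
      filter_upwards [isOpen_Ioo.mem_nhds (hsub ht)] with s hs using (hd1 s hs).deriv
    refine ⟨(hd1 t (hsub ht)).differentiableAt, ?_⟩
    rw [hev.eq_of_nhds]
    exact (hd2 t (hsub ht)).congr_of_eventuallyEq hev

/-- The derivative is a limit of slopes, which lie in the span, and a finite-dimensional subspace is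
closed. -/
theorem HasDerivAt.mem_span_singleton {F : Type*} [NormedAddCommGroup F] [NormedSpace ℝ F]
    [FiniteDimensional ℝ F] {c : ℝ → F} {c' v p : F} {t : ℝ} (h : HasDerivAt c c' t)
    (hc : ∀ᶠ s in 𝓝 t, c s - p ∈ Submodule.span ℝ {v}) : c' ∈ Submodule.span ℝ {v} := by
  have hcl : IsClosed ((Submodule.span ℝ {v} : Submodule ℝ F) : Set F) :=
    Submodule.closed_of_finiteDimensional _
  have h1 := hasDerivAt_iff_tendsto_slope.1 h
  refine hcl.mem_of_tendsto h1 ?_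
  filter_upwards [nhdsWithin_le_nhds hc] with s hs
  rw [SetLike.mem_coe, slope_def_module]
  refine Submodule.smul_mem _ _ ?_
  have := Submodule.sub_mem _ hs hc.self_of_nhds
  simpa using this

/-- If all the geodesics are contained in lines, then `Γ(u, u)` is proportional to `u`. -/
theorem exists_smul_eq_of_straight {d : ℕ} {Γ : Symbol d} {U : Set (E d)} (hU : IsOpen U)
    (hΓ : ContDiffOn ℝ ∞ Γ U)
    (hs : ∀ (I : Set ℝ) (c : ℝ → E d), IsOpen I → I.OrdConnected → MapsTo c I U →
      SolvesGeodesicEq Γ c I → Collinear ℝ (c '' I))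
    {x : E d} (hx : x ∈ U) (u : E d) : ∃ μ : ℝ, Γ x u u = μ • u := by
  rcases eq_or_ne u 0 with rfl | hu
  · exact ⟨0, by simp⟩
  obtain ⟨c, δ, hδ, hc0, hc1, hcU, hc⟩ := exists_geodesic hU hΓ hx u
  have h0 : (0 : ℝ) ∈ Ioo (-δ) δ := ⟨by linarith, hδ⟩
  obtain ⟨v, hv⟩ := (collinear_iff_of_mem (mem_image_of_mem c h0)).1
    (hs _ c isOpen_Ioo ordConnected_Ioo hcU hc)
  have h1 : ∀ t ∈ Ioo (-δ) δ, deriv c t ∈ Submodule.span ℝ {v} := fun t ht => by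
    refine HasDerivAt.mem_span_singleton (p := c 0) (hc t ht).1.hasDerivAt ?_
    filter_upwards [isOpen_Ioo.mem_nhds ht] with s hs
    obtain ⟨r, hr⟩ := hv _ (mem_image_of_mem c hs)
    exact Submodule.mem_span_singleton.2 ⟨r, by rw [hr]; simp⟩
  -- The velocity stays in the direction of the line, hence so does the acceleration, which the
  -- geodesic equation identifies with `-Γ(u, u)`.
  have h2 : -(Γ (c 0) (deriv c 0) (deriv c 0)) ∈ Submodule.span ℝ {v} := by
    refine HasDerivAt.mem_span_singleton (p := 0) (hc 0 h0).2 ?_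
    filter_upwards [isOpen_Ioo.mem_nhds h0] with s hs
    simpa using h1 s hs
  obtain ⟨a, ha⟩ := Submodule.mem_span_singleton.1 (h1 0 h0)
  obtain ⟨b, hb⟩ := Submodule.mem_span_singleton.1 h2
  rw [hc1] at ha
  rw [hc0, hc1] at hb
  have ha0 : a ≠ 0 := by
    rintro rfl
    exact hu (by simpa using ha.symm)
  refine ⟨-(b * a⁻¹), ?_⟩
  rw [← neg_eq_iff_eq_neg.2 hb, ← ha, smul_smul]
  simp [ha0]

/-! ### Symmetric bilinear maps with `Γ(u, u)` proportional to `u` -/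

/-- The form `a` such that `Γ(u, v) = a(u) v + a(v) u`, if there is one. -/
def associatedForm {d : ℕ} (B : E d →L[ℝ] E d →L[ℝ] E d) : E d →L[ℝ] ℝ :=
  ∑ i : Fin d, ((1 / 2 : ℝ) * B (Pi.single i 1) (Pi.single i 1) i) •
    (ContinuousLinearMap.proj i : E d →L[ℝ] ℝ)

theorem clm_ext_single {d : ℕ} {F : Type*} [NormedAddCommGroup F] [NormedSpace ℝ F]
    {A B : E d →L[ℝ] F} (h : ∀ i, A (Pi.single i 1) = B (Pi.single i 1)) : A = B := by
  refine ContinuousLinearMap.coe_injective ((Pi.basisFun ℝ (Fin d)).ext fun i => ?_)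
  simpa using h i

/-- The diagonal values fix `a` on the basis. Off the diagonal, the eigenvector condition at `e_i +
e_j` and at `e_i - e_j` determines all the components of `B(e_i, e_j)`. -/
theorem eq_projectiveSymbol {d : ℕ} {B : E d →L[ℝ] E d →L[ℝ] E d}
    (hsymm : ∀ u v, B u v = B v u) (hB : ∀ u, ∃ μ : ℝ, B u u = μ • u) :
    B = projectiveSymbol (associatedForm B) := by
  have ha : ∀ i, associatedForm B (Pi.single i 1) =
      1 / 2 * B (Pi.single i 1) (Pi.single i 1) i := fun i => by
    simp [associatedForm, Pi.single_apply]
  generalize associatedForm B = a at ha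
  have hdiag : ∀ i, B (Pi.single i 1) (Pi.single i 1) =
      (2 * a (Pi.single i 1)) • Pi.single i (1 : ℝ) := fun i => by
    obtain ⟨μ, hμ⟩ := hB (Pi.single i 1)
    have := ha i
    rw [hμ] at this
    simp only [Pi.smul_apply, Pi.single_eq_same, smul_eq_mul, mul_one] at this
    rw [hμ, this]
    congr 1
    ring
  refine clm_ext_single fun i => clm_ext_single fun j => ?_
  rw [projectiveSymbol_apply]
  rcases eq_or_ne i j with rfl | hij
  · rw [hdiag, ← add_smul, two_mul]
  set α := a (Pi.single i 1)
  set β := a (Pi.single j 1)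
  obtain ⟨μ, hμ⟩ := hB (Pi.single i 1 + Pi.single j 1)
  obtain ⟨ν, hν⟩ := hB (Pi.single i 1 - Pi.single j 1)
  simp only [map_add, map_sub, add_apply, sub_apply,
    hsymm (Pi.single j 1) (Pi.single i 1), hdiag] at hμ hν
  set w := B (Pi.single i 1) (Pi.single j 1)
  have e1 := congrFun hμ i
  have e2 := congrFun hμ j
  have e3 := congrFun hν i
  have e4 := congrFun hν j
  simp [hij, hij.symm] at e1 e2 e3 e4
  ext k
  have e5 := congrFun hμ k
  rcases eq_or_ne k i with rfl | hki
  · simp [hij]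
    linarith
  rcases eq_or_ne k j with rfl | hkj
  · simp [hki]
    linarith
  simp [hki, hkj] at e5 ⊢
  linarith

theorem contDiffOn_associatedForm {d : ℕ} {Γ : Symbol d} {U : Set (E d)}
    (hΓ : ContDiffOn ℝ ∞ Γ U) : ContDiffOn ℝ ∞ (fun x => associatedForm (Γ x)) U := by
  unfold associatedForm
  refine ContDiffOn.sum fun i _ => ?_
  have h := contDiffOn_pi.1 ((hΓ.clm_apply (contDiffOn_const (c := Pi.single i (1 : ℝ)))).clm_apply
    (contDiffOn_const (c := Pi.single i (1 : ℝ)))) i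
  exact (contDiffOn_const.mul h).smul contDiffOn_const

/-! ### The infinitesimal holonomy is the curvature -/

/-- The second-order term of parallel transport: `(D_h Γ)(k, w) + Γ(h, Γ(k, w))`. -/
def transportTerm {d : ℕ} (Γ : Symbol d) (x h k w : E d) : E d :=
  fderiv ℝ Γ x h k w + Γ x h (Γ x k w)

/-- A priori bound without Grönwall: the mean value inequality is applied at a time where `‖W‖` is
maximal, and `K‖u‖ ≤ 1/2` allows half of the maximum to be absorbed. -/
theorem ParallelTransport.norm_sub_le {d : ℕ} {Γ : Symbol d} {y u w w₀ : E d} {K b : ℝ}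
    {W : ℝ → E d} (hW0 : W 0 = w₀)
    (hW : ∀ t ∈ Icc (0 : ℝ) 1, HasDerivWithinAt W (-(Γ (y + t • u) u (W t))) (Icc 0 1) t)
    (hK : ∀ t ∈ Icc (0 : ℝ) 1, ‖Γ (y + t • u)‖ ≤ K) (hKu : K * ‖u‖ ≤ 1 / 2)
    (hb : ‖w₀ - w‖ ≤ b) :
    ∀ t ∈ Icc (0 : ℝ) 1, ‖W t‖ ≤ 2 * (‖w‖ + b) ∧ ‖W t - w‖ ≤ b + 2 * (K * ‖u‖) * (‖w‖ + b) := by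
  have hcont : ContinuousOn W (Icc 0 1) := fun t ht => (hW t ht).continuousWithinAt
  obtain ⟨t₀, ht₀, hmax⟩ := isCompact_Icc.exists_isMaxOn (nonempty_Icc.2 zero_le_one) hcont.norm
  have hmax : ∀ t ∈ Icc (0 : ℝ) 1, ‖W t‖ ≤ ‖W t₀‖ := fun t ht => hmax ht
  have h00 : (0 : ℝ) ∈ Icc (0 : ℝ) 1 := ⟨le_rfl, zero_le_one⟩
  have hK0 : 0 ≤ K := (norm_nonneg _).trans (hK 0 h00)
  have hmv : ∀ t ∈ Icc (0 : ℝ) 1, ‖W t - w₀‖ ≤ K * ‖u‖ * ‖W t₀‖ := fun t ht => by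
    have h := (convex_Icc (0 : ℝ) 1).norm_image_sub_le_of_norm_hasDerivWithin_le
      (C := K * ‖u‖ * ‖W t₀‖) hW (fun s hs => ?_) h00 ht
    · rw [hW0] at h
      refine h.trans (mul_le_of_le_one_right (by positivity) ?_)
      rw [sub_zero, Real.norm_of_nonneg ht.1]
      exact ht.2
    · rw [norm_neg]
      refine (ContinuousLinearMap.le_opNorm₂ _ _ _).trans ?_
      gcongr
      · exact hK s hs
      · exact hmax s hs
  have hw₀ : ‖w₀‖ ≤ ‖w‖ + b := by
    have := norm_le_norm_add_norm_sub w w₀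
    rw [norm_sub_rev] at this
    linarith
  have h2 : ‖W t₀‖ ≤ 2 * (‖w‖ + b) := by
    have h3 := norm_le_norm_add_norm_sub w₀ (W t₀)
    rw [norm_sub_rev] at h3
    have h4 : K * ‖u‖ * ‖W t₀‖ ≤ 1 / 2 * ‖W t₀‖ := by gcongr
    linarith [hmv t₀ ht₀]
  refine fun t ht => ⟨(hmax t ht).trans h2, ?_⟩
  calc ‖W t - w‖ ≤ ‖W t - w₀‖ + ‖w₀ - w‖ := norm_sub_le_norm_sub_add_norm_sub _ _ _
    _ ≤ K * ‖u‖ * (2 * (‖w‖ + b)) + b := by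
      refine add_le_add ((hmv t ht).trans ?_) hb
      gcongr
    _ = _ := by ring

/-- Substituting `Γ(x + h) = Γ(x) + D h + ρ` cancels everything of order at most two. What is left
contains `ρ`, or `W - w`, or a product of three small vectors. -/
theorem norm_transport_residual_le {d : ℕ} {Γ : Symbol d} {x h u w W : E d} {K η r a b : ℝ}
    (hΓ : ‖Γ (x + h) - Γ x - fderiv ℝ Γ x h‖ ≤ η * (3 * r)) (hr : 0 ≤ r) (hη : 0 ≤ η)
    (hK : ‖Γ x‖ ≤ K) (hK' : ‖fderiv ℝ Γ x‖ ≤ K) (hη1 : η ≤ K)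
    (hh : ‖h‖ ≤ 3 * r) (hu : ‖u‖ ≤ r) (hW : ‖W‖ ≤ a) (hWw : ‖W - w‖ ≤ b) :
    ‖-(Γ (x + h) u W) + Γ x u W + Γ x h (-(Γ (x + h) u W)) + transportTerm Γ x h u w‖ ≤
      r ^ 2 * (3 * η * a + (3 * K + 3 * K ^ 2) * b + 18 * K ^ 2 * r * a) := by
  have hK0 : 0 ≤ K := (norm_nonneg _).trans hK
  have ha0 : 0 ≤ a := (norm_nonneg _).trans hW
  set D := fderiv ℝ Γ x
  set ρ := Γ (x + h) - Γ x - D h with hρ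
  have hΓh : Γ (x + h) = Γ x + D h + ρ := by rw [hρ]; abel
  have hdec : -(Γ (x + h) u W) + Γ x u W + Γ x h (-(Γ (x + h) u W)) + transportTerm Γ x h u w =
      -(ρ u W) - D h u (W - w) - Γ x h (Γ x u (W - w)) - Γ x h ((D h + ρ) u W) := by
    rw [transportTerm, hΓh]
    simp only [add_apply, map_sub, map_add, map_neg]
    abel
  have hDh : ‖D h‖ ≤ K * (3 * r) := (D.le_opNorm h).trans (by gcongr)
  have h1 : ‖ρ u W‖ ≤ η * (3 * r) * r * a :=
    (ContinuousLinearMap.le_opNorm₂ _ _ _).trans (by gcongr)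
  have h2 : ‖D h u (W - w)‖ ≤ K * (3 * r) * r * b :=
    (ContinuousLinearMap.le_opNorm₂ _ _ _).trans (by gcongr)
  have h3 : ‖Γ x h (Γ x u (W - w))‖ ≤ K * (3 * r) * (K * r * b) := by
    refine (ContinuousLinearMap.le_opNorm₂ _ _ _).trans ?_
    gcongr
    exact (ContinuousLinearMap.le_opNorm₂ _ _ _).trans (by gcongr)
  have h4 : ‖Γ x h ((D h + ρ) u W)‖ ≤ K * (3 * r) * ((K * (3 * r) + K * (3 * r)) * r * a) := by
    refine (ContinuousLinearMap.le_opNorm₂ _ _ _).trans ?_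
    gcongr
    refine (ContinuousLinearMap.le_opNorm₂ _ _ _).trans ?_
    gcongr
    refine (norm_add_le _ _).trans (add_le_add hDh (hΓ.trans ?_))
    gcongr
  rw [hdec]
  refine (norm_sub_le _ _).trans ?_
  refine (add_le_add ((norm_sub_le _ _).trans (add_le_add ((norm_sub_le _ _).trans
    (add_le_add (norm_neg _).le le_rfl)) le_rfl)) le_rfl).trans ?_
  refine (add_le_add (add_le_add (add_le_add h1 h2) h3) h4).trans (le_of_eq ?_)
  ring

/-- Second-order expansion of parallel transport along a short segment near `x`. -/
theorem exists_transport_expansion {d : ℕ} {Γ : Symbol d} {x : E d}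
    (hΓ : DifferentiableAt ℝ Γ x) {m : ℝ} (hm : 0 ≤ m) : ∃ m' ≥ (0 : ℝ), ∀ η > 0, ∃ ρ > 0,
      ∀ r ∈ Ioo 0 ρ, ∀ h u w w₀ w₁ : E d, ‖h‖ ≤ 2 * r → ‖u‖ ≤ r → ‖w₀ - w‖ ≤ m * r * ‖w‖ →
        ParallelTransport Γ (fun t => x + h + t • u) w₀ w₁ →
        ‖w₁ - w‖ ≤ m' * r * ‖w‖ ∧
        ‖(w₁ + Γ x (h + u) w₁) - (w₀ + Γ x h w₀) + (transportTerm Γ x h u w +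
          (1 / 2 : ℝ) • transportTerm Γ x u u w)‖ ≤ η * r ^ 2 * ‖w‖ := by
  set D := fderiv ℝ Γ x
  set K : ℝ := ‖Γ x‖ + ‖D‖ + 1 with hK
  have hK1 : 1 ≤ K := by simp only [hK]; linarith [norm_nonneg (Γ x), norm_nonneg D]
  set m' : ℝ := m + 4 * K * (1 + m) with hm'
  have hm'0 : 0 ≤ m' := by positivity
  refine ⟨m', hm'0, fun η hη => ?_⟩
  set Q : ℝ := (3 * K + 3 * K ^ 2) * m' + 36 * K ^ 2 * (1 + m) with hQ
  have hQ0 : 0 ≤ Q := by positivity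
  set η' : ℝ := min 1 (η / (12 * (1 + m))) with hη'
  have hη'0 : 0 < η' := lt_min one_pos (by positivity)
  have hd := hΓ.hasFDerivAt.isLittleO.def hη'0
  obtain ⟨ρ₁, hρ₁, hd⟩ := Metric.eventually_nhds_iff.1 hd
  -- `ρ₁ / 3` keeps `h + t u`, of norm at most `3r`, where `Γ` is linearized; `1 / (4K)` gives the
  -- smallness required by the a priori bound; the last term makes `r Q ≤ η / 2`. The other half of
  -- `η` comes from the choice of `η'`.
  refine ⟨min (min 1 (ρ₁ / 3)) (min (1 / (4 * K)) (η / (2 * Q + 1))), by positivity, ?_⟩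
  rintro r ⟨hr0, hr⟩ h u w w₀ w₁ hh hu hw ⟨W, hW0, hW1, hW⟩
  simp only [lt_min_iff] at hr
  obtain ⟨⟨hr1, hr2⟩, hr3, hr4⟩ := hr
  rw [lt_div_iff₀ (by positivity)] at hr2 hr3 hr4
  have hht : ∀ t ∈ Icc (0 : ℝ) 1, ‖h + t • u‖ ≤ 3 * r := fun t ht => by
    refine (norm_add_le _ _).trans ?_
    rw [norm_smul, Real.norm_of_nonneg ht.1]
    nlinarith [norm_nonneg u, ht.1, ht.2]
  have hd' : ∀ t ∈ Icc (0 : ℝ) 1, ‖Γ (x + (h + t • u)) - Γ x - D (h + t • u)‖ ≤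
      η' * (3 * r) := fun t ht => by
    have := @hd (x + (h + t • u)) (by
      rw [dist_eq_norm, add_sub_cancel_left]
      linarith [hht t ht])
    rw [add_sub_cancel_left] at this
    refine this.trans ?_
    gcongr
    exact hht t ht
  have hKt : ∀ t ∈ Icc (0 : ℝ) 1, ‖Γ (x + h + t • u)‖ ≤ 4 * K / 2 := fun t ht => by
    have h1 := hd' t ht
    have h2 : ‖D (h + t • u)‖ ≤ ‖D‖ * (3 * r) :=
      (D.le_opNorm _).trans (by gcongr; exact hht t ht)
    have h3 : Γ (x + h + t • u) = (Γ (x + (h + t • u)) - Γ x - D (h + t • u)) + Γ x +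
      D (h + t • u) := by rw [add_assoc]; abel
    rw [h3]
    refine (norm_add₃_le).trans ?_
    have h4 : η' ≤ 1 := min_le_left _ _
    have h5 : 3 * r ≤ 3 / 4 := by nlinarith
    have h6 : ‖D‖ * (3 * r) ≤ ‖D‖ * (3 / 4) := by gcongr
    have h7 : η' * (3 * r) ≤ 1 * (3 / 4) := by gcongr
    linarith [norm_nonneg D, norm_nonneg (Γ x)]
  have hcd : ∀ t ∈ Icc (0 : ℝ) 1, derivWithin (fun t : ℝ => x + h + t • u) (Icc 0 1) t = u :=
    fun t ht => by
    have h1 : HasDerivAt (fun t : ℝ => x + h + t • u) ((1 : ℝ) • u) t :=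
      ((hasDerivAt_id t).smul_const u).const_add _
    rw [one_smul] at h1
    exact h1.hasDerivWithinAt.derivWithin (uniqueDiffOn_Icc_zero_one t ht)
  have hW : ∀ t ∈ Icc (0 : ℝ) 1,
      HasDerivWithinAt W (-(Γ (x + h + t • u) u (W t))) (Icc 0 1) t := fun t ht => by
    have h1 := hW t ht
    rwa [hcd t ht] at h1
  have hKu : 4 * K / 2 * ‖u‖ ≤ 1 / 2 := by
    calc 4 * K / 2 * ‖u‖ ≤ 4 * K / 2 * r := by gcongr
      _ ≤ 1 / 2 := by linarith
  have hb := ParallelTransport.norm_sub_le hW0 hW hKt hKu hw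
  have hmr : ‖w‖ + m * r * ‖w‖ ≤ (1 + m) * ‖w‖ := by
    have : m * r * ‖w‖ ≤ m * 1 * ‖w‖ := by gcongr
    linarith
  have hWa : ∀ t ∈ Icc (0 : ℝ) 1, ‖W t‖ ≤ 2 * ((1 + m) * ‖w‖) := fun t ht =>
    (hb t ht).1.trans (by gcongr)
  have hWb : ∀ t ∈ Icc (0 : ℝ) 1, ‖W t - w‖ ≤ m' * r * ‖w‖ := fun t ht => by
    refine (hb t ht).2.trans ?_
    calc m * r * ‖w‖ + 2 * (4 * K / 2 * ‖u‖) * (‖w‖ + m * r * ‖w‖)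
        ≤ m * r * ‖w‖ + 2 * (4 * K / 2 * r) * ((1 + m) * ‖w‖) := by gcongr
      _ = m' * r * ‖w‖ := by rw [hm']; ring
  refine ⟨by simpa [hW1] using hWb 1 ⟨zero_le_one, le_rfl⟩, ?_⟩
  -- Adding to `W` its expected first- and second-order corrections leaves a function whose
  -- derivative is exactly the residual bounded above.
  set Z : ℝ → E d := fun t => W t + Γ x (h + t • u) (W t) +
    (t • transportTerm Γ x h u w + (t ^ 2 / 2) • transportTerm Γ x u u w) with hZ
  have hZ' : ∀ t ∈ Icc (0 : ℝ) 1, HasDerivWithinAt Z (-(Γ (x + (h + t • u)) u (W t)) +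
      Γ x u (W t) + Γ x (h + t • u) (-(Γ (x + (h + t • u)) u (W t))) +
      transportTerm Γ x (h + t • u) u w) (Icc 0 1) t := fun t ht => by
    have h1 := hW t ht
    rw [add_assoc] at h1
    have h2 : HasDerivAt (fun t : ℝ => Γ x (h + t • u)) (Γ x ((1 : ℝ) • u)) t :=
      (Γ x).hasFDerivAt.comp_hasDerivAt t (((hasDerivAt_id t).smul_const u).const_add _)
    rw [one_smul] at h2
    have h3 := h2.hasDerivWithinAt (s := Icc 0 1) |>.clm_apply h1
    have h4 : HasDerivAt (fun t : ℝ => t • transportTerm Γ x h u w +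
        (t ^ 2 / 2) • transportTerm Γ x u u w)
        ((1 : ℝ) • transportTerm Γ x h u w + t • transportTerm Γ x u u w) t := by
      refine ((hasDerivAt_id t).smul_const _).add (HasDerivAt.smul_const ?_ _)
      have := ((hasDerivAt_id t).pow 2).div_const 2
      simpa using this
    have h5 := (h1.add h3).add h4.hasDerivWithinAt
    refine h5.congr_deriv ?_
    simp only [transportTerm, map_add, add_apply, map_smul, smul_apply, smul_add, one_smul]
    abel
  have h00 : (0 : ℝ) ∈ Icc (0 : ℝ) 1 := ⟨le_rfl, zero_le_one⟩
  have h11 : (1 : ℝ) ∈ Icc (0 : ℝ) 1 := ⟨zero_le_one, le_rfl⟩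
  have hfin := (convex_Icc (0 : ℝ) 1).norm_image_sub_le_of_norm_hasDerivWithin_le
      (C := η * r ^ 2 * ‖w‖) hZ' (fun t ht => ?_) h00 h11
  · simp only [hZ, hW0, hW1, one_smul, zero_smul, add_zero] at hfin
    rw [sub_zero, norm_one, mul_one] at hfin
    refine le_trans (le_of_eq ?_) hfin
    congr 1
    norm_num
    abel
  · refine (norm_transport_residual_le (K := K) (hd' t ht) hr0.le hη'0.le ?_ ?_ ?_ (hht t ht) hu
      (hWa t ht) (hWb t ht)).trans ?_
    · rw [hK]; linarith [norm_nonneg D]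
    · rw [hK]; linarith [norm_nonneg (Γ x)]
    · exact (min_le_left _ _).trans hK1
    · have e1 : η' * (12 * (1 + m)) ≤ η := by
        rw [← le_div_iff₀ (by positivity)]
        exact min_le_right _ _
      have e2 : r * Q ≤ η / 2 := by nlinarith
      have e3 : 3 * η' * (2 * ((1 + m) * ‖w‖)) + (3 * K + 3 * K ^ 2) * (m' * r * ‖w‖) +
          18 * K ^ 2 * r * (2 * ((1 + m) * ‖w‖)) =
          (η' * (12 * (1 + m)) / 2 + r * Q) * ‖w‖ := by rw [hQ]; ring
      rw [e3]
      calc r ^ 2 * ((η' * (12 * (1 + m)) / 2 + r * Q) * ‖w‖)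
          ≤ r ^ 2 * ((η / 2 + η / 2) * ‖w‖) := by gcongr
        _ = η * r ^ 2 * ‖w‖ := by ring

/-- Summing the expansions along the four sides, the terms `W + Γ_x(h, W)` telescope to `H w - w`,
since the loop begins and ends at `h = 0`. Writing `N` for `transportTerm` at `x`, the quadratic
terms sum to `N(u, v) - N(v, u)`, those in `(u, u)` and `(v, v)` cancelling. -/
theorem IsInfinitesimalHolonomy.apply_eq {d : ℕ} {Γ : Symbol d} {x : E d}
    (hΓ : DifferentiableAt ℝ Γ x) {i j : Fin d} {A : E d →L[ℝ] E d}
    (hA : IsInfinitesimalHolonomy Γ x i j A) (w : E d) :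
    A w = transportTerm Γ x (Pi.single j 1) (Pi.single i 1) w -
      transportTerm Γ x (Pi.single i 1) (Pi.single j 1) w := by
  -- The first side starts exactly at `w`, so `m = 0`; the drift constant at the end of each side is
  -- the input of the next one.
  obtain ⟨m₁, hm₁, h₁⟩ := exists_transport_expansion hΓ le_rfl
  obtain ⟨m₂, hm₂, h₂⟩ := exists_transport_expansion hΓ hm₁
  obtain ⟨m₃, hm₃, h₃⟩ := exists_transport_expansion hΓ hm₂
  obtain ⟨m₄, hm₄, h₄⟩ := exists_transport_expansion hΓ hm₃
  rw [← sub_eq_zero, ← norm_le_zero_iff]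
  refine le_of_forall_pos_le_add fun ε hε => ?_
  -- The factor 5 counts four sides and the error in the definition of the infinitesimal holonomy.
  set η := ε / (5 * (‖w‖ + 1)) with hη
  have hη0 : 0 < η := by positivity
  obtain ⟨ρ₁, hρ₁, h₁⟩ := h₁ η hη0
  obtain ⟨ρ₂, hρ₂, h₂⟩ := h₂ η hη0
  obtain ⟨ρ₃, hρ₃, h₃⟩ := h₃ η hη0
  obtain ⟨ρ₄, hρ₄, h₄⟩ := h₄ η hη0
  obtain ⟨δ, hδ, hA⟩ := hA η hη0
  obtain ⟨r, hr0, hr⟩ := exists_between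
    (show 0 < min δ (min (min ρ₁ ρ₂) (min ρ₃ ρ₄)) by positivity)
  simp only [lt_min_iff] at hr
  obtain ⟨hrδ, ⟨hr1, hr2⟩, hr3, hr4⟩ := hr
  -- Squares suffice to identify `A`.
  obtain ⟨H, hH, hHA⟩ := hA r ⟨hr0, hrδ⟩ r ⟨hr0, hrδ⟩
  set u : E d := r • Pi.single i 1 with hu
  set v : E d := r • Pi.single j 1 with hv
  have hu' : ‖u‖ ≤ r := by
    rw [hu, norm_smul, Real.norm_of_nonneg hr0.le, Pi.norm_single]
    simp
  have hv' : ‖v‖ ≤ r := by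
    rw [hv, norm_smul, Real.norm_of_nonneg hr0.le, Pi.norm_single]
    simp
  obtain ⟨w₁, w₂, w₃, t₁, t₂, t₃, t₄⟩ := (hH w (H w)).2 rfl
  have s₃ : ParallelTransport Γ (fun t : ℝ => x + (u + v) + t • (-u)) w₂ w₃ := by
    convert t₃ using 2 with t
    rw [smul_neg]
    abel
  have s₄ : ParallelTransport Γ (fun t : ℝ => x + v + t • (-v)) w₃ (H w) := by
    convert t₄ using 2 with t
    rw [smul_neg, sub_eq_add_neg]
  obtain ⟨a₁, b₁⟩ := h₁ r ⟨hr0, hr1⟩ 0 u w w w₁ (by simp [hr0.le]) hu' (by simp)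
    (by simpa using t₁)
  obtain ⟨a₂, b₂⟩ := h₂ r ⟨hr0, hr2⟩ u v w w₁ w₂ (by linarith) hv' a₁ t₂
  obtain ⟨a₃, b₃⟩ := h₃ r ⟨hr0, hr3⟩ (u + v) (-u) w w₂ w₃
    ((norm_add_le _ _).trans (by linarith)) (by rwa [norm_neg]) a₂ s₃
  obtain ⟨-, b₄⟩ := h₄ r ⟨hr0, hr4⟩ v (-v) w w₃ (H w) (by linarith) (by rwa [norm_neg]) a₃ s₄
  have b₅ : ‖(H - ContinuousLinearMap.id ℝ (E d) - (r * r) • A) w‖ ≤ η * r ^ 2 * ‖w‖ := by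
    refine (ContinuousLinearMap.le_opNorm _ _).trans ?_
    gcongr
    exact hHA.trans (by rw [sq])
  set S := A w - (transportTerm Γ x (Pi.single j 1) (Pi.single i 1) w -
      transportTerm Γ x (Pi.single i 1) (Pi.single j 1) w) with hS
  have hN : ∀ h k : E d, ∀ s t : ℝ, transportTerm Γ x (s • h) (t • k) w =
      (s * t) • transportTerm Γ x h k w := fun h k s t => by
    simp only [transportTerm, map_smul, smul_apply, smul_add, smul_smul, mul_comm t s]
  have key : (r ^ 2) • S = ((w₁ + Γ x (0 + u) w₁ - (w + Γ x 0 w)) +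
        (transportTerm Γ x 0 u w + (1 / 2 : ℝ) • transportTerm Γ x u u w)) +
      ((w₂ + Γ x (u + v) w₂ - (w₁ + Γ x u w₁)) +
        (transportTerm Γ x u v w + (1 / 2 : ℝ) • transportTerm Γ x v v w)) +
      ((w₃ + Γ x (u + v + -u) w₃ - (w₂ + Γ x (u + v) w₂)) +
        (transportTerm Γ x (u + v) (-u) w + (1 / 2 : ℝ) • transportTerm Γ x (-u) (-u) w)) +
      ((H w + Γ x (v + -v) (H w) - (w₃ + Γ x v w₃)) +
        (transportTerm Γ x v (-v) w + (1 / 2 : ℝ) • transportTerm Γ x (-v) (-v) w)) -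
      (H - ContinuousLinearMap.id ℝ (E d) - (r * r) • A) w := by
    have e1 : (r ^ 2) • S = (r * r) • A w - transportTerm Γ x v u w + transportTerm Γ x u v w := by
      rw [hS, hu, hv, hN, hN, sq]
      module
    rw [e1]
    simp only [transportTerm, map_add, map_neg, map_zero, add_apply, neg_apply, sub_apply,
      smul_apply, zero_apply, ContinuousLinearMap.id_apply]
    module
  have hle : ‖(r ^ 2) • S‖ ≤ 5 * (η * r ^ 2 * ‖w‖) := by
    rw [key]
    refine (norm_sub_le _ _).trans ?_
    refine (add_le_add (norm_add_le _ _) b₅).trans ?_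
    refine (add_le_add (add_le_add (norm_add_le _ _) b₄) le_rfl).trans ?_
    refine (add_le_add (add_le_add (add_le_add (norm_add_le _ _) b₃) le_rfl) le_rfl).trans ?_
    linarith
  rw [norm_smul, Real.norm_of_nonneg (by positivity)] at hle
  have hS' : ‖S‖ ≤ 5 * η * ‖w‖ := by
    refine le_of_mul_le_mul_left ?_ (show 0 < r ^ 2 by positivity)
    linarith
  refine hS'.trans ?_
  rw [zero_add, hη]
  have : 5 * (ε / (5 * (‖w‖ + 1))) * ‖w‖ = ε * (‖w‖ / (‖w‖ + 1)) := by
    field_simp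
  rw [this]
  refine mul_le_of_le_one_right hε.le ?_
  rw [div_le_one (by positivity)]
  linarith

/-! ### The bilinear form -/

theorem form_apply (p d : ℕ) (u v : E d) : form p d u v = ∑ i, eps p i * (u i * v i) := by
  simp [form]

theorem form_comm (p d : ℕ) (u v : E d) : form p d u v = form p d v u := by
  simp only [form_apply]
  exact Finset.sum_congr rfl fun i _ => by ring

theorem form_single_left (p d : ℕ) (i : Fin d) (v : E d) :
    form p d (Pi.single i 1) v = eps p i * v i := by
  rw [form_apply, Finset.sum_eq_single i]
  · simp
  · intro j _ hj
    simp [hj]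
  · simp

theorem form_single_right (p d : ℕ) (i : Fin d) (v : E d) :
    form p d v (Pi.single i 1) = eps p i * v i := by
  rw [form_comm, form_single_left]

theorem eps_mul_self (p : ℕ) {d : ℕ} (i : Fin d) : eps p i * eps p i = 1 := by
  unfold eps
  split_ifs <;> norm_num

theorem eps_ne_zero (p : ℕ) {d : ℕ} (i : Fin d) : eps p i ≠ 0 := fun h => by
  simpa [h] using eps_mul_self p i

/-- The curvature operator `R(X, Y)` of a connection `∂ + a(X) Y + a(Y) X`, in terms of
`B = Da - a ⊗ a`. -/
def curvatureOperator {d : ℕ} (B : E d →L[ℝ] E d →L[ℝ] ℝ) (X Y w : E d) : E d :=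
  (B X Y - B Y X) • w + B X w • Y - B Y w • X

/-- Skewness tested on `(e_i, e_i)` and `(e_j, e_j)` gives `B_ij = 2 B_ji` and `2 B_ij = B_ji`, so
both vanish; tested on `(e_i, e_j)`, it gives `ε_i B_ii = ε_j B_jj`. Symmetry of `B`, that is
closedness of `a`, is a consequence. -/
theorem eq_smul_form_of_skew {p d : ℕ} {B : E d →L[ℝ] E d →L[ℝ] ℝ}
    (hB : ∀ i j : Fin d, ∀ u v,
      form p d (curvatureOperator B (Pi.single i 1) (Pi.single j 1) u) v +
        form p d u (curvatureOperator B (Pi.single i 1) (Pi.single j 1) v) = 0) (i₀ : Fin d) :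
    B = (eps p i₀ * B (Pi.single i₀ 1) (Pi.single i₀ 1)) • form p d := by
  have hoff : ∀ i j : Fin d, i ≠ j → B (Pi.single i 1) (Pi.single j 1) = 0 := fun i j hij => by
    have h1 := hB i j (Pi.single i 1) (Pi.single i 1)
    have h2 := hB i j (Pi.single j 1) (Pi.single j 1)
    simp only [form_single_left, form_single_right, curvatureOperator] at h1 h2
    simp [hij, hij.symm] at h1 h2
    have e1 := eps_ne_zero p i
    have e2 := eps_ne_zero p j
    have h1' := mul_left_cancel₀ e1 (a := eps p i) (b := B (Pi.single i 1) (Pi.single j 1) -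
      2 * B (Pi.single j 1) (Pi.single i 1)) (c := 0)
      (by linear_combination eps p i * h1.resolve_left e1)
    have h2' := mul_left_cancel₀ e2 (a := eps p j) (b := 2 * B (Pi.single i 1) (Pi.single j 1) -
      B (Pi.single j 1) (Pi.single i 1)) (c := 0)
      (by linear_combination eps p j * h2.resolve_left e2)
    linarith
  have hdiag : ∀ i : Fin d, eps p i * B (Pi.single i 1) (Pi.single i 1) =
      eps p i₀ * B (Pi.single i₀ 1) (Pi.single i₀ 1) := fun i => by
    rcases eq_or_ne i i₀ with rfl | hij
    · rfl
    have h1 := hB i i₀ (Pi.single i 1) (Pi.single i₀ 1)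
    simp only [form_single_left, form_single_right, curvatureOperator] at h1
    simp [hoff i i₀ hij, hoff i₀ i hij.symm] at h1
    have e1 := eps_mul_self p i
    have e2 := eps_mul_self p i₀
    have h2 : eps p i * eps p i₀ * (eps p i₀ * B (Pi.single i 1) (Pi.single i 1) -
      eps p i * B (Pi.single i₀ 1) (Pi.single i₀ 1)) = 0 := by
      rw [show eps p i₀ * B (Pi.single i 1) (Pi.single i 1) -
        eps p i * B (Pi.single i₀ 1) (Pi.single i₀ 1) = 0 by linarith, mul_zero]
    linear_combination h2 - eps p i * B (Pi.single i 1) (Pi.single i 1) * e2 +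
      eps p i₀ * B (Pi.single i₀ 1) (Pi.single i₀ 1) * e1
  refine clm_ext_single fun i => clm_ext_single fun j => ?_
  rw [← hdiag i, smul_apply, smul_apply, form_single_left, smul_eq_mul]
  rcases eq_or_ne i j with rfl | hij
  · simp only [Pi.single_eq_same, mul_one]
    linear_combination -B (Pi.single i 1) (Pi.single i 1) * eps_mul_self p i
  · simp [hij, hoff i j hij]

/-- The part of `Γ(X, Γ(Y, w))` that is symmetric in `X` and `Y` drops out, and the rest of the
quadratic terms is the contribution of `-a ⊗ a`. -/
theorem transportTerm_sub_transportTerm {d : ℕ} {Γ : Symbol d} {a : E d → E d →L[ℝ] ℝ} {x : E d}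
    (hΓ : DifferentiableAt ℝ Γ x) (ha : DifferentiableAt ℝ a x)
    (h : ∀ᶠ y in 𝓝 x, Γ y = projectiveSymbol (a y)) (X Y w : E d) :
    transportTerm Γ x X Y w - transportTerm Γ x Y X w =
      curvatureOperator (fderiv ℝ a x - (a x).smulRight (a x)) X Y w := by
  have hD : ∀ h k w, fderiv ℝ Γ x h k w = fderiv ℝ a x h k • w + fderiv ℝ a x h w • k := by
    intro h' k w
    have h1 := (hΓ.hasFDerivAt.clm_apply (hasFDerivAt_const k x)).clm_apply (hasFDerivAt_const w x)
    have h2 := ((ha.hasFDerivAt.clm_apply (hasFDerivAt_const k x)).smul_const w).add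
      ((ha.hasFDerivAt.clm_apply (hasFDerivAt_const w x)).smul_const k)
    have h3 : (fun y => Γ y k w) =ᶠ[𝓝 x] (fun y => a y k • w) + fun y => a y w • k := by
      filter_upwards [h] with y hy
      rw [hy, projectiveSymbol_apply]
      rfl
    have h4 := DFunLike.congr_fun (h1.unique (h2.congr_of_eventuallyEq h3)) h'
    simpa using h4
  simp only [transportTerm, hD, h.self_of_nhds, projectiveSymbol_apply, curvatureOperator,
    sub_apply, ContinuousLinearMap.smulRight_apply, smul_eq_mul, smul_apply, map_add, map_smul,
    smul_add, smul_smul, sub_smul]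
  module

/-! ### Quadratic potentials -/

/-- The functions `c q + ℓ + k`. -/
def quadraticFunction (p d : ℕ) (c : ℝ) (l : E d →L[ℝ] ℝ) (k : ℝ) (x : E d) : ℝ :=
  c * quad p d x + l x + k

theorem hasFDerivAt_quad (p d : ℕ) (x : E d) :
    HasFDerivAt (quad p d) ((2 : ℝ) • form p d x) x := by
  have h := (form p d).hasFDerivAt.clm_apply (hasFDerivAt_id x) (x := x)
  refine HasFDerivAt.congr_fderiv h ?_
  ext v
  simp [form_comm p d v x]
  ring

theorem hasFDerivAt_quadraticFunction (p d : ℕ) (c : ℝ) (l : E d →L[ℝ] ℝ) (k : ℝ) (x : E d) :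
    HasFDerivAt (quadraticFunction p d c l k) ((2 * c) • form p d x + l) x := by
  refine HasFDerivAt.congr_fderiv
    ((((hasFDerivAt_quad p d x).const_mul c).add l.hasFDerivAt).add_const k) ?_
  rw [smul_smul, mul_comm c 2]

theorem continuous_quadraticFunction (p d : ℕ) (c : ℝ) (l : E d →L[ℝ] ℝ) (k : ℝ) :
    Continuous (quadraticFunction p d c l k) :=
  continuous_iff_continuousAt.2 fun x => (hasFDerivAt_quadraticFunction p d c l k x).continuousAt

theorem quad_add (p d : ℕ) (x y : E d) :
    quad p d (x + y) = quad p d x + 2 * form p d x y + quad p d y := by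
  simp only [quad, map_add, add_apply, form_comm p d y x]
  ring

theorem quad_smul (p d : ℕ) (r : ℝ) (x : E d) : quad p d (r • x) = r ^ 2 * quad p d x := by
  simp only [quad, map_smul, smul_apply, smul_eq_mul]
  ring

theorem potentialSymbol_eq {d : ℕ} {ψ : E d → ℝ} {x : E d} {a : E d →L[ℝ] ℝ} (h0 : ψ x ≠ 0)
    {ψ' : E d →L[ℝ] ℝ} (h : HasFDerivAt ψ ψ' x) (ha : ψ x • a = -ψ') :
    potentialSymbol ψ x = projectiveSymbol a := by
  rw [potentialSymbol, h.fderiv, ← smul_neg, ← ha, smul_smul, inv_mul_cancel₀ h0, one_smul]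

/-- If `Da = a ⊗ a + k q`, then `dk = k a`. -/
theorem fderiv_eq_smul_of_fderiv_eq {p d : ℕ} (hd : 2 ≤ d) {a : E d → E d →L[ℝ] ℝ} {k : E d → ℝ}
    {x : E d} (ha : ∀ᶠ y in 𝓝 x, HasFDerivAt a ((a y).smulRight (a y) + k y • form p d) y)
    {k' : E d →L[ℝ] ℝ} (hk : HasFDerivAt k k' x) : k' = k x • a x := by
  have ha0 := ha.self_of_nhds
  -- After substitution of `Da`, symmetry of `D²a` reads `(k a - dk)(Y) q(X, Z) = (k a - dk)(X) q(Y,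
  -- Z)`.
  have hsymm := second_derivative_symmetric_of_eventually ha
    (((ContinuousLinearMap.smulRightL ℝ (E d) (E d →L[ℝ] ℝ)).hasFDerivAt_of_bilinear ha0 ha0).add
      (hk.smul_const (form p d)))
  refine clm_ext_single fun j => ?_
  have : Nontrivial (Fin d) := Fin.nontrivial_iff_two_le.2 hd
  obtain ⟨i, hij⟩ := exists_ne j
  -- With `X = Z = e_i` and `Y = e_j` orthogonal, only `(k a - dk)(e_j) = 0` survives; this is where
  -- dimension at least two enters.
  have h := DFunLike.congr_fun (hsymm (Pi.single i 1) (Pi.single j 1)) (Pi.single i 1)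
  simp [form_single_left, hij, hij.symm] at h
  have e := eps_ne_zero p i
  rw [smul_apply, smul_eq_mul]
  refine mul_right_cancel₀ e ?_
  linarith

/-- A candidate `ψ` is read off at `x`. On each segment from `x`, the defects `ψ a + dψ` and `ψ k -
k(x)` satisfy a linear homogeneous differential system with zero initial value, so they vanish. -/
theorem eq_potentialSymbol_of_fderiv_eq {p d : ℕ} {a : E d → E d →L[ℝ] ℝ} {k : E d → ℝ}
    {x : E d} {ε : ℝ}
    (ha : ∀ y ∈ Metric.ball x ε, HasFDerivAt a ((a y).smulRight (a y) + k y • form p d) y)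
    (hk : ∀ y ∈ Metric.ball x ε, HasFDerivAt k (k y • a y) y) :
    ∃ c l k₀, quadraticFunction p d c l k₀ x = 1 ∧ ∀ y ∈ Metric.ball x ε,
      quadraticFunction p d c l k₀ y • a y = -((2 * c) • form p d y + l) := by
  -- These constants are forced by `ψ(x) = 1`, `dψ(x) = -a(x)` and `ψ k = -2c` at `x`.
  set c : ℝ := -(k x) / 2 with hc
  set l : E d →L[ℝ] ℝ := k x • form p d x - a x with hl
  set k₀ : ℝ := 1 - c * quad p d x - l x with hk₀
  refine ⟨c, l, k₀, by rw [quadraticFunction, hk₀]; ring, fun y hy => ?_⟩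
  set ψ := quadraticFunction p d c l k₀
  have hψx : ψ x = 1 := by simp only [ψ, quadraticFunction, hk₀]; ring
  set h := y - x
  have hγ : ∀ t ∈ Icc (0 : ℝ) 1, x + t • h ∈ Metric.ball x ε := fun t ht => by
    rw [Metric.mem_ball, dist_eq_norm] at hy ⊢
    rw [add_sub_cancel_left, norm_smul, Real.norm_of_nonneg ht.1]
    exact (mul_le_of_le_one_left (norm_nonneg _) ht.2).trans_lt hy
  have hγ' : ∀ t : ℝ, HasDerivAt (fun t : ℝ => x + t • h) h t := fun t => by
    have := ((hasDerivAt_id t).smul_const h).const_add x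
    rwa [one_smul] at this
  set D : ℝ → E d →L[ℝ] ℝ := fun t => ψ (x + t • h) • a (x + t • h) +
    ((2 * c) • form p d (x + t • h) + l) with hD
  set m : ℝ → ℝ := fun t => ψ (x + t • h) * k (x + t • h) - k x with hm
  have hψ' : ∀ t : ℝ, HasDerivAt (fun t : ℝ => ψ (x + t • h))
      (((2 * c) • form p d (x + t • h) + l) h) t := fun t =>
    (hasFDerivAt_quadraticFunction p d c l k₀ _).comp_hasDerivAt t (hγ' t)
  have hD' : ∀ t ∈ Icc (0 : ℝ) 1, HasDerivAt D
      (D t h • a (x + t • h) + m t • form p d h) t := fun t ht => by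
    have h1 : HasDerivAt (fun t : ℝ => a (x + t • h)) _ t :=
      (ha _ (hγ t ht)).comp_hasDerivAt t (hγ' t)
    have h2 : HasDerivAt (fun t : ℝ => form p d (x + t • h)) (form p d h) t :=
      (form p d).hasFDerivAt.comp_hasDerivAt t (hγ' t)
    refine (((hψ' t).smul h1).add ((h2.const_smul (2 * c)).add_const l)).congr_deriv ?_
    ext v
    simp [hD, hm, hc]
    ring
  have hm' : ∀ t ∈ Icc (0 : ℝ) 1, HasDerivAt m (D t h * k (x + t • h)) t := fun t ht => by
    have h1 : HasDerivAt (fun t : ℝ => k (x + t • h)) _ t :=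
      (hk _ (hγ t ht)).comp_hasDerivAt t (hγ' t)
    refine (((hψ' t).mul h1).sub_const (k x)).congr_deriv ?_
    simp [hD]
    ring
  have hac : ContinuousOn (fun t : ℝ => a (x + t • h)) (Icc 0 1) := fun t ht =>
    ((ha _ (hγ t ht)).continuousAt.comp_of_eq (hγ' t).continuousAt rfl).continuousWithinAt
  have hkc : ContinuousOn (fun t : ℝ => k (x + t • h)) (Icc 0 1) := fun t ht =>
    ((hk _ (hγ t ht)).continuousAt.comp_of_eq (hγ' t).continuousAt rfl).continuousWithinAt
  obtain ⟨Ca, hCa⟩ := isCompact_Icc.exists_bound_of_continuousOn hac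
  obtain ⟨Ck, hCk⟩ := isCompact_Icc.exists_bound_of_continuousOn hkc
  set z : ℝ → (E d →L[ℝ] ℝ) × ℝ := fun t => (D t, m t)
  have hz : ∀ t ∈ Icc (0 : ℝ) 1, HasDerivAt z
      (D t h • a (x + t • h) + m t • form p d h, D t h * k (x + t • h)) t := fun t ht =>
    (hD' t ht).prodMk (hm' t ht)
  have h00 : (0 : ℝ) ∈ Icc (0 : ℝ) 1 := ⟨le_rfl, zero_le_one⟩
  have hCa0 := (norm_nonneg _).trans (hCa 0 h00)
  have hCk0 := (norm_nonneg _).trans (hCk 0 h00)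
  have hz0 : z 0 = 0 := by
    simp only [z, hD, hm, zero_smul, add_zero, hψx, one_smul, one_mul, sub_self, hc, hl]
    refine Prod.ext ?_ rfl
    simp only [Prod.fst_zero]
    module
  -- Grönwall; the constant is a crude sum that dominates both components of the system.
  have hfin := eq_zero_of_abs_deriv_le_mul_abs_self_of_eq_zero_right
    (f := z) (K := ‖h‖ * Ca + ‖form p d h‖ + ‖h‖ * Ck)
    (fun t ht => (hz t ht).continuousAt.continuousWithinAt)
    (fun t ht => (hz t (Ico_subset_Icc_self ht)).hasDerivWithinAt) hz0 (fun t ht => ?_) 1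
    ⟨zero_le_one, le_rfl⟩
  · have h1 : D 1 = 0 := congrArg Prod.fst hfin
    simp only [hD, one_smul] at h1
    rw [show x + h = y by simp [h]] at h1
    exact eq_neg_of_add_eq_zero_left h1
  · have ht' := Ico_subset_Icc_self ht
    have hDz : ‖D t‖ ≤ ‖z t‖ := norm_fst_le (z t)
    have hmz : ‖m t‖ ≤ ‖z t‖ := norm_snd_le (z t)
    have hDh : ‖D t h‖ ≤ ‖z t‖ * ‖h‖ := ((D t).le_opNorm h).trans (by gcongr)
    have hb := hCa t ht'
    have hb' := hCk t ht'
    rw [Prod.norm_def, max_le_iff]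
    constructor
    · refine (norm_add_le _ _).trans ?_
      rw [norm_smul, norm_smul]
      calc ‖D t h‖ * ‖a (x + t • h)‖ + ‖m t‖ * ‖form p d h‖
          ≤ ‖z t‖ * ‖h‖ * Ca + ‖z t‖ * ‖form p d h‖ := by gcongr
        _ ≤ _ := by
          have : 0 ≤ ‖h‖ * Ck * ‖z t‖ := by positivity
          linarith
    · rw [norm_mul]
      calc ‖D t h‖ * ‖k (x + t • h)‖ ≤ ‖z t‖ * ‖h‖ * Ck := by gcongr
        _ ≤ _ := by
          have : 0 ≤ (‖h‖ * Ca + ‖form p d h‖) * ‖z t‖ := by positivity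
          linarith

/-- Locally, a stiff connection has a quadratic potential. -/
theorem AffineConnection.IsStiff.exists_potential {p d : ℕ} (hd : 2 ≤ d) {M : Type*}
    [TopologicalSpace M] [ChartedSpace (E d) M] {conn : AffineConnection d M}
    (hstiff : conn.IsStiff p) {e : OpenPartialHomeomorph M (E d)} (he : e ∈ atlas (E d) M)
    {x : E d} (hx : x ∈ e.target) :
    ∃ c l k, quadraticFunction p d c l k x ≠ 0 ∧ ∀ᶠ y in 𝓝 x,
      conn.symbol e y = potentialSymbol (quadraticFunction p d c l k) y := by
  set Γ := conn.symbol e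
  have hU := e.open_target
  have hΓ : ContDiffOn ℝ ∞ Γ e.target := conn.contDiffOn e he
  set a : E d → E d →L[ℝ] ℝ := fun y => associatedForm (Γ y)
  have ha : ContDiffOn ℝ ∞ a e.target := contDiffOn_associatedForm hΓ
  have hΓa : ∀ y ∈ e.target, Γ y = projectiveSymbol (a y) := fun y hy =>
    eq_projectiveSymbol (hstiff.symmetric e he y hy)
      (exists_smul_eq_of_straight hU hΓ (hstiff.straight e he) hy)
  have haD : ∀ y ∈ e.target, DifferentiableAt ℝ a y := fun y hy =>
    (ha.contDiffAt (hU.mem_nhds hy)).differentiableAt (by simp)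
  set B : E d → E d →L[ℝ] E d →L[ℝ] ℝ := fun y => fderiv ℝ a y - (a y).smulRight (a y)
  let i₀ : Fin d := ⟨0, by omega⟩
  set k : E d → ℝ := fun y => eps p i₀ * B y (Pi.single i₀ 1) (Pi.single i₀ 1)
  have hB : ∀ y ∈ e.target, B y = k y • form p d := fun y hy => by
    refine eq_smul_form_of_skew (fun i j u v => ?_) i₀
    -- The directions are exchanged because the holonomy of the rectangle `(e_j, e_i)` is `R(e_i,
    -- e_j)` with the sign convention of `curvatureOperator`.
    obtain ⟨A, hA, hskew⟩ := hstiff.holonomy e he y hy j i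
    have hΓy : DifferentiableAt ℝ Γ y :=
      (hΓ.contDiffAt (hU.mem_nhds hy)).differentiableAt (by simp)
    have h1 : ∀ w, A w = curvatureOperator (B y) (Pi.single i 1) (Pi.single j 1) w := fun w => by
      rw [hA.apply_eq hΓy, transportTerm_sub_transportTerm hΓy (haD y hy)
        (by filter_upwards [hU.mem_nhds hy] with z hz using hΓa z hz)]
    rw [← h1, ← h1]
    exact hskew u v
  have hkd : ∀ y ∈ e.target, DifferentiableAt ℝ k y := fun y hy => by
    have h1 := ha.contDiffAt (hU.mem_nhds hy)
    have h2 : DifferentiableAt ℝ (fderiv ℝ a) y :=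
      (h1.fderiv_right (m := ∞) (by simp)).differentiableAt (by simp)
    have h3 := haD y hy
    have h4 : DifferentiableAt ℝ (fun y => B y (Pi.single i₀ 1) (Pi.single i₀ 1)) y :=
      ((h2.clm_apply (differentiableAt_const _)).clm_apply (differentiableAt_const _)).sub
        ((h3.clm_apply (differentiableAt_const _)).mul (h3.clm_apply (differentiableAt_const _)))
    exact h4.const_mul _
  have ha' : ∀ y ∈ e.target, HasFDerivAt a ((a y).smulRight (a y) + k y • form p d) y :=
    fun y hy => by
    rw [← hB y hy]
    simpa [B] using (haD y hy).hasFDerivAt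
  have hk' : ∀ y ∈ e.target, HasFDerivAt k (k y • a y) y := fun y hy => by
    rw [← fderiv_eq_smul_of_fderiv_eq hd
      (by filter_upwards [hU.mem_nhds hy] with z hz using ha' z hz) (hkd y hy).hasFDerivAt]
    exact (hkd y hy).hasFDerivAt
  obtain ⟨ε, hε, hball⟩ := Metric.isOpen_iff.1 hU x hx
  obtain ⟨c, l, k₀, h1, h2⟩ := eq_potentialSymbol_of_fderiv_eq
    (fun y hy => ha' y (hball hy)) (fun y hy => hk' y (hball hy))
  refine ⟨c, l, k₀, by simp [h1], ?_⟩
  have hne : ∀ᶠ y in 𝓝 x, quadraticFunction p d c l k₀ y ≠ 0 :=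
    (continuous_quadraticFunction p d c l k₀).continuousAt.eventually_ne (by simp [h1])
  filter_upwards [hne, Metric.ball_mem_nhds x hε] with y hy hyb
  rw [hΓa y (hball hyb),
    potentialSymbol_eq hy (hasFDerivAt_quadraticFunction p d c l k₀ y) (h2 y hyb)]

/-- The connection with an affine potential is flat. -/
theorem ParallelTransport.eq_of_closed {d : ℕ} {Γ : Symbol d} {U : Set (E d)}
    {l : E d →L[ℝ] ℝ} {k : ℝ} (h0 : ∀ y ∈ U, l y + k ≠ 0)
    (hΓ : ∀ y ∈ U, Γ y = potentialSymbol (fun y => l y + k) y) {c : ℝ → E d}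
    (hc : ContDiffOn ℝ 1 c (Icc 0 1)) (hcU : MapsTo c (Icc 0 1) U) (hclosed : c 0 = c 1)
    {w w' : E d} (h : ParallelTransport Γ c w w') : w' = w := by
  obtain ⟨W, rfl, rfl, hW⟩ := h
  set c' := derivWithin c (Icc 0 1)
  set ψ : ℝ → ℝ := fun t => l (c t) + k
  have hψ0 : ∀ t ∈ Icc (0 : ℝ) 1, ψ t ≠ 0 := fun t ht => h0 _ (hcU ht)
  have hc' : ∀ t ∈ Icc (0 : ℝ) 1, HasDerivWithinAt c (c' t) (Icc 0 1) t := fun t ht =>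
    (hc.differentiableOn (by simp) t ht).hasDerivWithinAt
  have hψ' : ∀ t ∈ Icc (0 : ℝ) 1, HasDerivWithinAt ψ (l (c' t)) (Icc 0 1) t := fun t ht =>
    (l.hasFDerivAt.comp_hasDerivWithinAt t (hc' t ht)).add_const k
  have hW' : ∀ t ∈ Icc (0 : ℝ) 1, HasDerivWithinAt W
      ((ψ t)⁻¹ • (l (c' t) • W t + l (W t) • c' t)) (Icc 0 1) t := fun t ht => by
    have h1 := hW t ht
    have h2 : HasFDerivAt (fun y => l y + k) l (c t) := l.hasFDerivAt.add_const k
    rw [hΓ _ (hcU ht), potentialSymbol, h2.fderiv, projectiveSymbol_apply] at h1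
    refine h1.congr_deriv ?_
    simp only [neg_apply, smul_apply, smul_eq_mul, ψ, c']
    module
  have hconst : ∀ {F : Type _} [NormedAddCommGroup F] [NormedSpace ℝ F] (f : ℝ → F),
      (∀ t ∈ Icc (0 : ℝ) 1, HasDerivWithinAt f 0 (Icc 0 1) t) →
      ∀ t ∈ Icc (0 : ℝ) 1, f t = f 0 := fun f hf =>
    constant_of_derivWithin_zero (fun t ht => (hf t ht).differentiableWithinAt) fun t ht =>
      (hf t (Ico_subset_Icc_self ht)).derivWithin
        (uniqueDiffOn_Icc_zero_one t (Ico_subset_Icc_self ht))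
  -- First integral of parallel transport: applying `l` to the equation gives `l(W)' = 2 (ψ'/ψ)
  -- l(W)`.
  have hK := hconst (fun t => ((ψ t) ^ 2)⁻¹ * l (W t)) fun t ht => by
    refine ((((hψ' t ht).pow 2).inv (pow_ne_zero 2 (hψ0 t ht))).mul
      (l.hasFDerivAt.comp_hasDerivWithinAt t (hW' t ht))).congr_deriv ?_
    have := hψ0 t ht
    simp only [map_smul, map_add, smul_eq_mul, Pi.pow_apply, Pi.inv_apply]
    field_simp
    simp
    right
    ring
  set K := ((ψ 0) ^ 2)⁻¹ * l (W 0)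
  -- With `l(W) = K ψ²`, the vector `W/ψ` has derivative `K c'`. Thus `W` is determined by the
  -- position `c`, and a closed curve brings it back.
  have hV := hconst (fun t => (ψ t)⁻¹ • W t - K • c t) fun t ht => by
    refine ((((hψ' t ht).inv (hψ0 t ht)).smul (hW' t ht)).sub
      ((hc' t ht).const_smul K)).congr_deriv ?_
    rw [← hK t ht]
    have := hψ0 t ht
    simp only [Pi.inv_apply]
    match_scalars <;> field_simp <;> ring
  have h1 := hV 1 ⟨zero_le_one, le_rfl⟩
  have h2 : ψ 1 = ψ 0 := by simp only [ψ, hclosed]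
  simp only [h2, hclosed, sub_left_inj] at h1
  exact smul_right_injective _ (inv_ne_zero (hψ0 0 ⟨le_rfl, zero_le_one⟩)) h1

/-- At some point, the potential of a stiff connection that is not flat is not affine. -/
theorem AffineConnection.IsStiff.exists_potential_of_not_isFlat {p d : ℕ} (hd : 2 ≤ d) {M : Type*}
    [TopologicalSpace M] [ChartedSpace (E d) M] {conn : AffineConnection d M}
    (hstiff : conn.IsStiff p) (hflat : ¬ conn.IsFlat) :
    ∃ e ∈ atlas (E d) M, ∃ x ∈ e.target, ∃ c l k, c ≠ 0 ∧ quadraticFunction p d c l k x ≠ 0 ∧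
      ∀ᶠ y in 𝓝 x, conn.symbol e y = potentialSymbol (quadraticFunction p d c l k) y := by
  by_contra hcon
  refine hflat fun e he x hx => ?_
  obtain ⟨c, l, k, h0, h⟩ := hstiff.exists_potential hd he hx
  obtain rfl : c = 0 := by
    by_contra hc
    exact hcon ⟨e, he, x, hx, c, l, k, hc, h0, h⟩
  have hq : quadraticFunction p d 0 l k = fun y => l y + k := by
    ext y
    simp [quadraticFunction]
  rw [hq] at h0 h
  have hne : ∀ᶠ y in 𝓝 x, l y + k ≠ 0 :=
    (show Continuous fun y => l y + k by fun_prop).continuousAt.eventually_ne h0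
  refine ⟨_, (hne.and (h.and (e.open_target.mem_nhds hx))), fun y hy => hy.2.2, ?_⟩
  intro c hc hcU hcl w w' hw
  exact ParallelTransport.eq_of_closed (fun y hy => hy.1) (fun y hy => hy.2.1) hc hcU hcl hw

/-! ### Similarities -/

theorem form_map_of_quad_map {p d : ℕ} {L : E d →L[ℝ] E d} {r : ℝ}
    (hL : ∀ x, quad p d (L x) = r * quad p d x) (x y : E d) :
    form p d (L x) (L y) = r * form p d x y := by
  have h1 := hL (x + y)
  rw [map_add, quad_add, quad_add, hL, hL] at h1
  linarith

/-- A kernel vector is orthogonal to every basis vector by polarization, and the form is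
nondegenerate. -/
theorem injective_of_quad_map {p d : ℕ} {L : E d →L[ℝ] E d} {r : ℝ} (hr : r ≠ 0)
    (hL : ∀ x, quad p d (L x) = r * quad p d x) : Function.Injective L := by
  refine (injective_iff_map_eq_zero L).2 fun x hx => ?_
  ext i
  have h := form_map_of_quad_map hL (Pi.single i 1) x
  rw [hx, map_zero, form_single_left] at h
  simpa [hr, eps_ne_zero] using h.symm

namespace IsSimilarity

variable {p d : ℕ} {A B : E d → E d}

/-- The linear part of a similarity. -/
theorem exists_linear (hA : IsSimilarity p d A) : ∃ (r : ℝ) (L : E d →L[ℝ] E d) (c : E d), 0 < r ∧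
    (∀ x, quad p d (L x) = r * quad p d x) ∧ Function.Injective L ∧ ∀ x, A x = L x + c := by
  obtain ⟨r, L, c, hr, hL, hA⟩ := hA
  have h : ∀ x, quad p d ((r • L) x) = r ^ 2 * quad p d x := fun x => by
    rw [smul_apply, quad_smul, hL]
  exact ⟨r ^ 2, r • L, c, by positivity, h, injective_of_quad_map (by positivity) h, hA⟩

theorem exists_inverse (hA : IsSimilarity p d A) :
    ∃ B, IsSimilarity p d B ∧ (∀ x, B (A x) = x) ∧ ∀ x, A (B x) = x := by
  obtain ⟨r, L, c, hr, hL, hA⟩ := hA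
  have hinj : Function.Injective (L : E d →ₗ[ℝ] E d) :=
    injective_of_quad_map one_ne_zero fun x => by rw [hL, one_mul]
  set f := (LinearEquiv.ofInjectiveEndo (L : E d →ₗ[ℝ] E d) hinj).toContinuousLinearEquiv
  have hf : ∀ x, f x = L x := fun x => rfl
  have hr0 := hr.ne'
  refine ⟨fun x => r⁻¹ • f.symm x + -(r⁻¹ • f.symm c), ⟨r⁻¹, f.symm, _, inv_pos.2 hr, ?_,
    fun x => rfl⟩, fun x => ?_, fun x => ?_⟩
  · intro x
    rw [← hL, ContinuousLinearEquiv.coe_coe, ← hf, f.apply_symm_apply]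
  · rw [hA, ← hf]
    simp [smul_smul, hr0]
  · rw [hA, ← hf]
    simp [smul_smul, hr0]

theorem injective (hA : IsSimilarity p d A) : Function.Injective A := by
  obtain ⟨B, -, h, -⟩ := hA.exists_inverse
  exact Function.LeftInverse.injective h

theorem eq_of_eventuallyEq (hA : IsSimilarity p d A) (hB : IsSimilarity p d B) {x : E d}
    (h : A =ᶠ[𝓝 x] B) : A = B := by
  obtain ⟨-, L, c, -, -, -, hA⟩ := hA.exists_linear
  obtain ⟨-, L', c', -, -, -, hB⟩ := hB.exists_linear
  have h1 : HasFDerivAt A L x := by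
    rw [funext hA]
    exact L.hasFDerivAt.add_const c
  have h2 : HasFDerivAt B L' x := by
    rw [funext hB]
    exact L'.hasFDerivAt.add_const c'
  have h3 : L = L' := h1.unique (h2.congr_of_eventuallyEq h)
  have h4 := h.self_of_nhds
  rw [hA, hB, h3, add_right_inj] at h4
  ext1 z
  rw [hA, hB, h3, h4]

theorem map_add_smul (hA : IsSimilarity p d A) (v : E d) (hv : v ≠ 0) :
    ∃ w ≠ 0, ∀ (x : E d) (s : ℝ), A (x + s • v) = A x + s • w := by
  obtain ⟨-, L, c, -, -, hL, hA⟩ := hA.exists_linear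
  refine ⟨L v, (map_ne_zero_iff L hL).2 hv, fun x s => ?_⟩
  rw [hA, hA, map_add, map_smul]
  abel

theorem convex_preimage (hA : IsSimilarity p d A) {s : Set (E d)} (hs : Convex ℝ s) :
    Convex ℝ (A ⁻¹' s) := by
  obtain ⟨-, L, c, -, -, hL, hA⟩ := hA.exists_linear
  have : A ⁻¹' s = (L : E d →ₗ[ℝ] E d) ⁻¹' ((fun z => z + c) ⁻¹' s) := by
    ext z
    simp [hA]
  rw [this]
  exact (hs.translate_preimage_left c).linear_preimage _

/-- The second derivative of an affine map vanishes, so Christoffel symbols transform as tensors. -/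
theorem transformsAt_iff {L : E d →L[ℝ] E d} {c : E d} (hA : ∀ x, A x = L x + c)
    {Γ Γ' : Symbol d} {x : E d} :
    TransformsAt A Γ Γ' x ↔ ∀ u v, Γ' (A x) (L u) (L v) = L (Γ x u v) := by
  have h1 : fderiv ℝ A = fun _ => L := by
    ext1 y
    rw [funext hA]
    exact (L.hasFDerivAt.add_const c).fderiv
  simp [TransformsAt, h1]

theorem transformsAt_comp (hA : IsSimilarity p d A) (hB : IsSimilarity p d B)
    {Γ Γ' Γ'' : Symbol d} {x : E d} (h : TransformsAt A Γ Γ' x)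
    (h' : TransformsAt B Γ' Γ'' (A x)) : TransformsAt (B ∘ A) Γ Γ'' x := by
  obtain ⟨-, L, c, -, -, -, hA⟩ := hA.exists_linear
  obtain ⟨-, L', c', -, -, -, hB⟩ := hB.exists_linear
  rw [transformsAt_iff hA] at h
  rw [transformsAt_iff hB] at h'
  rw [transformsAt_iff (L := L'.comp L) (c := L' c + c') fun x => by
    simp [hA, hB, add_assoc]]
  intro u v
  simp only [ContinuousLinearMap.comp_apply, Function.comp_apply, h', h]

theorem transformsAt_symm (hA : IsSimilarity p d A) (hB : IsSimilarity p d B)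
    (hBA : ∀ x, B (A x) = x) {Γ Γ' : Symbol d} {x : E d} (h : TransformsAt A Γ Γ' x) :
    TransformsAt B Γ' Γ (A x) := by
  obtain ⟨-, L, c, -, -, hL, hA⟩ := hA.exists_linear
  obtain ⟨-, L', c', -, -, -, hB⟩ := hB.exists_linear
  rw [transformsAt_iff hA] at h
  rw [transformsAt_iff hB, hBA]
  have h0 : L' c + c' = 0 := by
    have := hBA 0
    rwa [hA, hB, map_zero, zero_add] at this
  have h1 : ∀ z, L' (L z) = z := fun z => by
    have := hBA z
    rwa [hA, hB, map_add, add_assoc, h0, add_zero] at this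
  have hsurj : Function.Surjective L := (LinearMap.injective_iff_surjective (f := (L : E d →ₗ[ℝ] E d))).1 hL
  intro u v
  obtain ⟨u, rfl⟩ := hsurj u
  obtain ⟨v, rfl⟩ := hsurj v
  rw [h, h1, h1, h1]

theorem eq_of_transformsAt (hA : IsSimilarity p d A) {Γ₁ Γ₂ Γ' : Symbol d} {x : E d}
    (h₁ : TransformsAt A Γ₁ Γ' x) (h₂ : TransformsAt A Γ₂ Γ' x) : Γ₁ x = Γ₂ x := by
  obtain ⟨-, L, c, -, -, hL, hA⟩ := hA.exists_linear
  rw [transformsAt_iff hA] at h₁ h₂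
  ext1 u
  ext1 v
  exact hL (by rw [← h₁, ← h₂])

theorem transformsAt_potentialSymbol (hA : IsSimilarity p d A) {φ : E d → ℝ} {x : E d}
    (hφ : DifferentiableAt ℝ φ (A x)) :
    TransformsAt A (potentialSymbol (φ ∘ A)) (potentialSymbol φ) x := by
  obtain ⟨-, L, c, -, -, hL, hA⟩ := hA.exists_linear
  rw [transformsAt_iff hA]
  have h1 : HasFDerivAt A L x := by
    rw [funext hA]
    exact L.hasFDerivAt.add_const c
  intro u v
  rw [potentialSymbol, potentialSymbol, (hφ.hasFDerivAt.comp x h1).fderiv,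
    projectiveSymbol_apply, projectiveSymbol_apply]
  simp

end IsSimilarity

theorem TransformsAt.congr {d : ℕ} {f g : E d → E d} {Γ Γ' : Symbol d} {x : E d}
    (h : TransformsAt f Γ Γ' x) (hfg : f =ᶠ[𝓝 x] g) : TransformsAt g Γ Γ' x := by
  intro u v
  have := h u v
  rwa [hfg.fderiv.fderiv_eq, hfg.fderiv_eq, hfg.eq_of_nhds] at this

theorem TransformsAt.congr_left {d : ℕ} {f : E d → E d} {Γ₁ Γ₂ Γ' : Symbol d} {x : E d}
    (h : TransformsAt f Γ₁ Γ' x) (hΓ : Γ₁ x = Γ₂ x) : TransformsAt f Γ₂ Γ' x := fun u v => by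
  rw [h u v, hΓ]

theorem TransformsAt.congr_right {d : ℕ} {f : E d → E d} {Γ Γ₁ Γ₂ : Symbol d} {x : E d}
    (h : TransformsAt f Γ Γ₁ x) (hΓ : Γ₁ (f x) = Γ₂ (f x)) : TransformsAt f Γ Γ₂ x := fun u v => by
  rw [← h u v, hΓ]

/-! ### Uniqueness of quadratic potentials -/

/-- `ψ` is the sum of a multiple of `q` and of an affine function. -/
def IsQuadratic (p : ℕ) {d : ℕ} (ψ : E d → ℝ) : Prop :=
  ∃ c l k, ψ = quadraticFunction p d c l k

theorem quadraticFunction_add_smul (p d : ℕ) (c : ℝ) (l : E d →L[ℝ] ℝ) (k : ℝ) (x h : E d)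
    (s : ℝ) : quadraticFunction p d c l k (x + s • h) = quadraticFunction p d c l k x +
      (2 * c * form p d x h + l h) * s + c * quad p d h * s ^ 2 := by
  simp only [quadraticFunction, quad_add, quad_smul, map_add, map_smul, smul_eq_mul]
  ring

namespace IsQuadratic

variable {p d : ℕ} {φ ψ : E d → ℝ}

theorem differentiableAt (h : IsQuadratic p ψ) (x : E d) : DifferentiableAt ℝ ψ x := by
  obtain ⟨c, l, k, rfl⟩ := h
  exact (hasFDerivAt_quadraticFunction p d c l k x).differentiableAt

theorem continuous (h : IsQuadratic p ψ) : Continuous ψ :=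
  continuous_iff_continuousAt.2 fun x => (h.differentiableAt x).continuousAt

theorem comp (h : IsQuadratic p ψ) {A : E d → E d} (hA : IsSimilarity p d A) :
    IsQuadratic p (ψ ∘ A) := by
  obtain ⟨c, l, k, rfl⟩ := h
  obtain ⟨r, L, b, -, hL, -, hA⟩ := hA.exists_linear
  refine ⟨c * r, (2 * c) • (form p d b).comp L + l.comp L, c * quad p d b + l b + k, ?_⟩
  ext x
  simp only [quadraticFunction, Function.comp_apply, hA, quad_add, hL, map_add, add_apply,
    smul_apply, ContinuousLinearMap.comp_apply, smul_eq_mul, form_comm p d (L x) b]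
  ring

theorem sub_const_mul (hφ : IsQuadratic p φ) (hψ : IsQuadratic p ψ) (κ : ℝ) :
    IsQuadratic p fun x => φ x - κ * ψ x := by
  obtain ⟨c, l, k, rfl⟩ := hφ
  obtain ⟨c', l', k', rfl⟩ := hψ
  refine ⟨c - κ * c', l - κ • l', k - κ * k', ?_⟩
  ext x
  simp only [quadraticFunction, sub_apply, smul_apply, smul_eq_mul]
  ring

/-- On each line through `y`, `ψ` is a polynomial of degree at most two; its zeros at `0` and `± ε /
2` kill all its coefficients. -/
theorem eq_zero_of_eventually (hψ : IsQuadratic p ψ) {y : E d} (h : ∀ᶠ x in 𝓝 y, ψ x = 0)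
    (x : E d) : ψ x = 0 := by
  obtain ⟨c, l, k, rfl⟩ := hψ
  have hy := h.self_of_nhds
  have hev : ∀ᶠ s in 𝓝 (0 : ℝ), quadraticFunction p d c l k (y + s • (x - y)) = 0 := by
    have : Tendsto (fun s : ℝ => y + s • (x - y)) (𝓝 0) (𝓝 y) := by
      have hc : Continuous fun s : ℝ => y + s • (x - y) := by fun_prop
      simpa using hc.tendsto 0
    exact this.eventually h
  obtain ⟨ε, hε, hs⟩ := Metric.eventually_nhds_iff.1 hev
  have h1 := @hs (ε / 2) (by
    rw [Real.dist_eq, sub_zero, abs_of_pos (by positivity)]; linarith)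
  have h2 := @hs (-(ε / 2)) (by
    rw [Real.dist_eq, sub_zero, abs_neg, abs_of_pos (by positivity)]; linarith)
  have h3 := quadraticFunction_add_smul p d c l k y (x - y) 1
  rw [quadraticFunction_add_smul, hy] at h1 h2
  rw [one_smul, add_sub_cancel, hy] at h3
  have h4 : 2 * c * form p d y (x - y) + l (x - y) = 0 := by
    have : (2 * c * form p d y (x - y) + l (x - y)) * ε = 0 := by linarith
    exact (mul_eq_zero.1 this).resolve_right hε.ne'
  have h5 : c * quad p d (x - y) = 0 := by
    have : c * quad p d (x - y) * (ε / 2) ^ 2 = 0 := by linarith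
    exact (mul_eq_zero.1 this).resolve_right (by positivity)
  rw [h3, h4, h5]
  ring

/-- Equal symbols mean equal logarithmic derivatives, so `φ/ψ` is constant near `y`; a quadratic
function that vanishes near a point vanishes everywhere, which makes the proportionality global. -/
theorem exists_eq_mul (hφ : IsQuadratic p φ) (hψ : IsQuadratic p ψ) {y : E d} (hφy : φ y ≠ 0)
    (hψy : ψ y ≠ 0) (h : potentialSymbol φ =ᶠ[𝓝 y] potentialSymbol ψ) :
    ∃ κ ≠ 0, ∀ x, φ x = κ * ψ x := by
  have hev := h.and ((hφ.continuous.continuousAt.eventually_ne hφy).and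
    (hψ.continuous.continuousAt.eventually_ne hψy))
  obtain ⟨ε, hε, hball⟩ := Metric.eventually_nhds_iff_ball.1 hev
  have hd : ∀ x ∈ Metric.ball y ε, HasFDerivAt (fun x => φ x * (ψ x)⁻¹) (0 : E d →L[ℝ] ℝ) x := by
    intro x hx
    obtain ⟨h1, h2, h3⟩ := hball x hx
    refine ((hφ.differentiableAt x).hasFDerivAt.mul ((hasDerivAt_inv h3).comp_hasFDerivAt x
      (hψ.differentiableAt x).hasFDerivAt)).congr_fderiv ?_
    ext u
    rcases eq_or_ne u 0 with rfl | hu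
    · simp
    have h4 : potentialSymbol φ x u u = potentialSymbol ψ x u u := by rw [h1]
    rw [potentialSymbol, potentialSymbol, projectiveSymbol_apply, projectiveSymbol_apply,
      ← add_smul, ← add_smul] at h4
    have h5 := smul_left_injective ℝ hu h4
    simp only [neg_apply, smul_apply, smul_eq_mul] at h5
    have h6 : (φ x)⁻¹ * fderiv ℝ φ x u = (ψ x)⁻¹ * fderiv ℝ ψ x u := by linarith
    field_simp at h6
    simp only [smul_apply, add_apply, smul_eq_mul, zero_apply, Function.comp_apply]
    field_simp
    linarith
  have hconst := fun z hz => Metric.isOpen_ball.is_const_of_fderiv_eq_zero (𝕜 := ℝ)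
    (f := fun x => φ x * (ψ x)⁻¹) (Metric.isPreconnected_ball (x := y) (r := ε))
    (fun x hx => (hd x hx).differentiableAt.differentiableWithinAt) (fun x hx => (hd x hx).fderiv)
    (x := z) (y := y) hz (Metric.mem_ball_self hε)
  refine ⟨φ y * (ψ y)⁻¹, mul_ne_zero hφy (inv_ne_zero hψy), fun x => ?_⟩
  rw [← sub_eq_zero]
  refine (hφ.sub_const_mul hψ (φ y * (ψ y)⁻¹)).eq_zero_of_eventually (y := y) ?_ x
  filter_upwards [Metric.ball_mem_nhds y hε] with z hz
  have h1 := hconst z hz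
  have h2 := (hball z hz).2.2
  rw [← h1]
  field_simp
  ring

end IsQuadratic

theorem potentialSymbol_const_mul {d : ℕ} {φ ψ : E d → ℝ} {κ : ℝ} (hκ : κ ≠ 0)
    (h : ∀ x, φ x = κ * ψ x) (x : E d) : potentialSymbol φ x = potentialSymbol ψ x := by
  have hφ : φ = κ • ψ := funext h
  rw [potentialSymbol, potentialSymbol, hφ, fderiv_const_smul_field]
  congr 2
  rw [Pi.smul_apply, Pi.smul_apply, smul_smul, smul_eq_mul, mul_inv_rev, mul_assoc,
    inv_mul_cancel₀ hκ, mul_one]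

/-! ### Local developments -/

namespace AffineConnection

variable {p d : ℕ} {M : Type*} [TopologicalSpace M] [ChartedSpace (E d) M]

/-- Near `y`, the map `F : ℝ^d → M` is, in the chart `e`, the similarity `A`, and it pulls the
connection back to the connection of potential `ψ`. -/
structure IsDevelopmentAt (conn : AffineConnection d M) (p : ℕ) (ψ : E d → ℝ) (F : E d → M)
    (e : OpenPartialHomeomorph M (E d)) (A : E d → E d) (y : E d) : Prop where
  mem_atlas : e ∈ atlas (E d) M
  similarity : IsSimilarity p d A
  mem_target : A y ∈ e.target
  eventuallyEq : F =ᶠ[𝓝 y] e.symm ∘ A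
  transforms : ∀ᶠ z in 𝓝 y, TransformsAt A (potentialSymbol ψ) (conn.symbol e) z
  ne_zero : ψ y ≠ 0

/-- `F` is, near every point of `U`, a similarity in the charts, and it pulls the connection back
to the connection of potential `ψ`. -/
def IsDevelopmentOn (conn : AffineConnection d M) (p : ℕ) (ψ : E d → ℝ) (F : E d → M)
    (U : Set (E d)) : Prop :=
  ∀ y ∈ U, ∃ e A, conn.IsDevelopmentAt p ψ F e A y

variable {conn : AffineConnection d M} {ψ : E d → ℝ} {F G : E d → M}
  {e e' : OpenPartialHomeomorph M (E d)} {A A' : E d → E d} {y : E d} {U V : Set (E d)}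

namespace IsDevelopmentAt

theorem apply_eq (h : conn.IsDevelopmentAt p ψ F e A y) : F y = e.symm (A y) :=
  h.eventuallyEq.eq_of_nhds

theorem mem_source (h : conn.IsDevelopmentAt p ψ F e A y) : F y ∈ e.source := by
  rw [h.apply_eq]
  exact e.map_target h.mem_target

theorem chart_apply (h : conn.IsDevelopmentAt p ψ F e A y) : e (F y) = A y := by
  rw [h.apply_eq, e.right_inv h.mem_target]

theorem continuousAt (h : conn.IsDevelopmentAt p ψ F e A y) : ContinuousAt F y :=
  ContinuousAt.congr ((e.continuousAt_symm h.mem_target).comp h.similarity.continuous.continuousAt)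
    h.eventuallyEq.symm

theorem eventually (hψ : Continuous ψ) (h : conn.IsDevelopmentAt p ψ F e A y) :
    ∀ᶠ z in 𝓝 y, conn.IsDevelopmentAt p ψ F e A z := by
  filter_upwards [h.eventuallyEq.eventually_nhds, h.transforms.eventually_nhds,
    hψ.continuousAt.eventually_ne h.ne_zero,
    h.similarity.continuous.continuousAt.eventually_mem (e.open_target.mem_nhds h.mem_target)]
    with z h1 h2 h3 h4
  exact ⟨h.mem_atlas, h.similarity, h4, h1, h2, h3⟩

theorem congr (h : conn.IsDevelopmentAt p ψ F e A y) (hFG : G =ᶠ[𝓝 y] F) :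
    conn.IsDevelopmentAt p ψ G e A y :=
  ⟨h.mem_atlas, h.similarity, h.mem_target, hFG.trans h.eventuallyEq, h.transforms, h.ne_zero⟩

theorem chart_eventuallyEq (h : conn.IsDevelopmentAt p ψ F e A y) : e ∘ F =ᶠ[𝓝 y] A := by
  filter_upwards [h.eventuallyEq, h.similarity.continuous.continuousAt.eventually_mem
    (e.open_target.mem_nhds h.mem_target)] with z h1 h2
  rw [Function.comp_apply, h1, Function.comp_apply, e.right_inv h2]

theorem similarity_unique (h : conn.IsDevelopmentAt p ψ F e A y)
    (h' : conn.IsDevelopmentAt p ψ F e A' y) : A = A' :=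
  h.similarity.eq_of_eventuallyEq h'.similarity
    (h.chart_eventuallyEq.symm.trans h'.chart_eventuallyEq)

/-- The transition map is a similarity `C` near `A y`, so `C ∘ A` represents `F` in the other chart.
-/
theorem change_chart [HasGroupoid M (similarityGroupoid p d)]
    (h : conn.IsDevelopmentAt p ψ F e A y) (he' : e' ∈ atlas (E d) M) (hy : F y ∈ e'.source) :
    ∃ A', conn.IsDevelopmentAt p ψ F e' A' y := by
  have hg := HasGroupoid.compatible (G := similarityGroupoid p d) h.mem_atlas he'
  have hloc : IsLocalSimilarityOn p d (e.symm.trans e') (e.symm.trans e').source := hg.1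
  have hsrc : A y ∈ (e.symm.trans e').source := by
    rw [OpenPartialHomeomorph.trans_source]
    refine ⟨h.mem_target, ?_⟩
    rw [mem_preimage, ← h.apply_eq]
    exact hy
  obtain ⟨C, hC, hCe⟩ := hloc _ hsrc
  have hA := h.similarity
  have hAc := hA.continuous.continuousAt (x := y)
  have hev1 : ∀ᶠ z in 𝓝 y, e' (e.symm (A z)) = C (A z) := hAc.eventually hCe
  have hev2 : ∀ᶠ z in 𝓝 y, A z ∈ (e.symm.trans e').source :=
    hAc.eventually_mem ((e.symm.trans e').open_source.mem_nhds hsrc)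
  refine ⟨C ∘ A, he', hC.comp hA, ?_, ?_, ?_, h.ne_zero⟩
  · rw [Function.comp_apply, ← hev1.self_of_nhds, ← h.apply_eq]
    exact e'.map_source hy
  · filter_upwards [h.eventuallyEq, hev1, hev2] with z h1 h2 h3
    rw [h1, Function.comp_apply, Function.comp_apply, Function.comp_apply, ← h2, e'.left_inv]
    rw [OpenPartialHomeomorph.trans_source] at h3
    exact h3.2
  · filter_upwards [h.transforms, hAc.eventually hCe.eventually_nhds, hev2] with z h1 h2 h3
    exact hA.transformsAt_comp hC h1
      ((conn.compatible e h.mem_atlas e' he' _ h3).congr h2)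

/-- A development at a point extends to the preimage of a domain of the chart where the connection
has a quadratic potential. -/
theorem extend (hψ : IsQuadratic p ψ) (h : conn.IsDevelopmentAt p ψ F e A y)
    {φ : E d → ℝ} (hφ : IsQuadratic p φ) (hV : IsOpen V) (hVe : V ⊆ e.target)
    (hφ0 : ∀ z ∈ V, φ z ≠ 0) (hφV : ∀ z ∈ V, conn.symbol e z = potentialSymbol φ z)
    (hy : A y ∈ V) :
    (∃ κ ≠ 0, ∀ x, φ (A x) = κ * ψ x) ∧
      ∀ x ∈ A ⁻¹' V, conn.IsDevelopmentAt p ψ (e.symm ∘ A) e A x := by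
  have hA := h.similarity
  have hφA := hφ.comp hA
  have htr : ∀ x ∈ A ⁻¹' V, TransformsAt A (potentialSymbol (φ ∘ A)) (conn.symbol e) x :=
    fun x hx => (hA.transformsAt_potentialSymbol (hφ.differentiableAt _)).congr_right
      (hφV _ hx).symm
  have hVo : IsOpen (A ⁻¹' V) := hV.preimage hA.continuous
  -- Near `y`, both `φ ∘ A` and `ψ` are potentials of the pulled-back connection, so uniqueness of
  -- quadratic potentials applies. The nonvanishing of `φ` on `V` then passes to `ψ` on all of `A
  -- ⁻¹' V`.
  obtain ⟨κ, hκ, heq⟩ := hφA.exists_eq_mul hψ (hφ0 _ hy) h.ne_zero (by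
    filter_upwards [h.transforms, hVo.mem_nhds hy] with z h1 h2
    exact hA.eq_of_transformsAt (htr z h2) h1)
  refine ⟨⟨κ, hκ, heq⟩, fun x hx => ⟨h.mem_atlas, hA, hVe hx, EventuallyEq.rfl, ?_, ?_⟩⟩
  · filter_upwards [hVo.mem_nhds hx] with z hz
    exact (htr z hz).congr_left (potentialSymbol_const_mul hκ heq z)
  · intro h0
    have := heq x
    rw [h0, mul_zero] at this
    exact hφ0 _ hx this

end IsDevelopmentAt

namespace IsDevelopmentOn

theorem continuousAt (h : conn.IsDevelopmentOn p ψ F U) (hy : y ∈ U) : ContinuousAt F y := by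
  obtain ⟨e, A, h⟩ := h y hy
  exact h.continuousAt

theorem exists_similarity [HasGroupoid M (similarityGroupoid p d)]
    (h : conn.IsDevelopmentOn p ψ F U) (hy : y ∈ U) (he : e ∈ atlas (E d) M)
    (hye : F y ∈ e.source) : ∃ A, conn.IsDevelopmentAt p ψ F e A y := by
  obtain ⟨e', A', h⟩ := h y hy
  exact h.change_chart he hye

theorem mono (h : conn.IsDevelopmentOn p ψ F U) (hVU : V ⊆ U) : conn.IsDevelopmentOn p ψ F V :=
  fun y hy => h y (hVU hy)

theorem congr (h : conn.IsDevelopmentOn p ψ F U) (hU : IsOpen U) (hFG : EqOn G F U) :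
    conn.IsDevelopmentOn p ψ G U := fun y hy => by
  obtain ⟨e, A, h⟩ := h y hy
  exact ⟨e, A, h.congr (by filter_upwards [hU.mem_nhds hy] with z hz using hFG hz)⟩

/-- Two developments that coincide near a point of a connected domain coincide there. -/
theorem eventuallyEq [HasGroupoid M (similarityGroupoid p d)] [T2Space M] (hψ : Continuous ψ)
    (hF : conn.IsDevelopmentOn p ψ F U)
    (hG : conn.IsDevelopmentOn p ψ G U) (hU : IsPreconnected U) {x : E d} (hx : x ∈ U)
    (hxFG : F =ᶠ[𝓝 x] G) (hy : y ∈ U) : F =ᶠ[𝓝 y] G := by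
  refine hU.induction₂' (fun x y => F =ᶠ[𝓝 x] G → F =ᶠ[𝓝 y] G) (fun x hx => ?_)
    (fun x y z _ _ _ h1 h2 h => h2 (h1 h)) hx hy hxFG
  refine nhdsWithin_le_nhds ?_
  by_cases hxFG : F x = G x
  · obtain ⟨e, A, hA⟩ := hF x hx
    obtain ⟨A', hA'⟩ := hG.exists_similarity hx hA.mem_atlas (hxFG ▸ hA.mem_source)
    filter_upwards [hA.eventually hψ, hA'.eventually hψ] with z h1 h2
    -- In one chart, agreement of the germs is the condition `A = A'`, which does not depend on the
    -- point; hence agreement is locally constant.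
    have key : ∀ w, conn.IsDevelopmentAt p ψ F e A w → conn.IsDevelopmentAt p ψ G e A' w →
        (F =ᶠ[𝓝 w] G ↔ A = A') := fun w k1 k2 => by
      constructor
      · intro hw
        exact (k1.congr hw.symm).similarity_unique k2
      · rintro rfl
        exact k1.eventuallyEq.trans k2.eventuallyEq.symm
    rw [key x hA hA', key z h1 h2]
    exact ⟨id, id⟩
  · have h1 : ∀ᶠ z in 𝓝 x, F z ≠ G z :=
      (hF.continuousAt hx).ne_iff_eventually_ne (hG.continuousAt hx) |>.1 hxFG
    filter_upwards [h1] with z hz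
    exact ⟨fun h => absurd h.eq_of_nhds hxFG, fun h => absurd h.eq_of_nhds hz⟩

/-- In a given chart, a development over a connected set is a single similarity. -/
theorem exists_similarity_forall [HasGroupoid M (similarityGroupoid p d)] (hψ : Continuous ψ)
    (hF : conn.IsDevelopmentOn p ψ F U) (hU : IsPreconnected U) (hne : U.Nonempty)
    (he : e ∈ atlas (E d) M) (hUe : MapsTo F U e.source) :
    ∃ A, ∀ y ∈ U, conn.IsDevelopmentAt p ψ F e A y := by
  obtain ⟨x, hx⟩ := hne
  obtain ⟨A, hA⟩ := hF.exists_similarity hx he (hUe hx)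
  refine ⟨A, fun y hy => ?_⟩
  refine hU.induction₂' (fun x y => conn.IsDevelopmentAt p ψ F e A x →
    conn.IsDevelopmentAt p ψ F e A y) (fun x hx => ?_) (fun x y z _ _ _ h1 h2 h => h2 (h1 h))
    hx hy hA
  refine nhdsWithin_le_nhds ?_
  obtain ⟨B, hB⟩ := hF.exists_similarity hx he (hUe hx)
  filter_upwards [hB.eventually hψ] with z hz
  constructor
  · intro h
    rwa [h.similarity_unique hB]
  · intro h
    rwa [h.similarity_unique hz]

end IsDevelopmentOn

/-- Every point of `M` is in a chart on a neighbourhood of which the connection has a quadratic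
potential. -/
theorem IsStiff.exists_chart (hd : 2 ≤ d) (hstiff : conn.IsStiff p) (m : M) :
    ∃ e ∈ atlas (E d) M, ∃ φ, ∃ V : Set (E d), IsQuadratic p φ ∧ IsOpen V ∧ Convex ℝ V ∧
      m ∈ e.source ∧ e m ∈ V ∧ V ⊆ e.target ∧ (∀ z ∈ V, φ z ≠ 0) ∧
      ∀ z ∈ V, conn.symbol e z = potentialSymbol φ z := by
  have he := chart_mem_atlas (E d) m
  have hm := mem_chart_source (E d) m
  have hm' := (chartAt (E d) m).map_source hm
  obtain ⟨c, l, k, h0, h⟩ := hstiff.exists_potential hd he hm'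
  have hev := (((continuous_quadraticFunction p d c l k).continuousAt.eventually_ne h0).and h).and
    ((chartAt (E d) m).open_target.mem_nhds hm')
  obtain ⟨ε, hε, hball⟩ := Metric.eventually_nhds_iff_ball.1 hev
  exact ⟨_, he, _, _, ⟨c, l, k, rfl⟩, Metric.isOpen_ball, convex_ball _ ε, hm,
    Metric.mem_ball_self hε, fun z hz => (hball z hz).2, fun z hz => (hball z hz).1.1,
    fun z hz => (hball z hz).1.2⟩

end AffineConnection

/-! ### Geodesics under similarities and developments -/

theorem IsSimilarity.geodesic_comp {p d : ℕ} {A : E d → E d} (hA : IsSimilarity p d A)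
    {Γ Γ' : Symbol d} {c γ : ℝ → E d} {t : ℝ} (hc : ∀ᶠ s in 𝓝 t, DifferentiableAt ℝ c s)
    (hc' : HasDerivAt (deriv c) (-(Γ (c t) (deriv c t) (deriv c t))) t)
    (htr : TransformsAt A Γ Γ' (c t)) (hγ : γ =ᶠ[𝓝 t] A ∘ c) :
    DifferentiableAt ℝ γ t ∧ HasDerivAt (deriv γ) (-(Γ' (γ t) (deriv γ t) (deriv γ t))) t := by
  obtain ⟨-, L, b, -, -, -, hA⟩ := hA.exists_linear
  rw [IsSimilarity.transformsAt_iff hA] at htr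
  have hd : ∀ᶠ s in 𝓝 t, HasDerivAt γ (L (deriv c s)) s := by
    filter_upwards [hc, hγ.eventually_nhds] with s hs hs'
    refine HasDerivAt.congr_of_eventuallyEq ?_ hs'
    have h1 : HasDerivAt (fun s => L (c s) + b) (L (deriv c s)) s :=
      (L.hasFDerivAt.comp_hasDerivAt s hs.hasDerivAt).add_const b
    exact h1.congr_of_eventuallyEq (Eventually.of_forall fun s => hA (c s))
  have hd' : deriv γ =ᶠ[𝓝 t] fun s => L (deriv c s) := hd.mono fun s hs => hs.deriv
  refine ⟨hd.self_of_nhds.differentiableAt, ?_⟩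
  rw [hd'.eq_of_nhds, hγ.eq_of_nhds, Function.comp_apply, htr, ← map_neg]
  exact (L.hasFDerivAt.comp_hasDerivAt t hc').congr_of_eventuallyEq hd'

/-- Since `Γ(c', c') = -2 (dψ(c')/ψ) c'`, the speed along a line must be proportional to `ψ²`; the
affine parameter is a primitive of `ψ⁻²`. -/
theorem solvesGeodesicEq_line {d : ℕ} {ψ : E d → ℝ} (hψ : Differentiable ℝ ψ) {x v : E d}
    {σ : ℝ → ℝ} {J : Set ℝ} (hJ : IsOpen J) (h0 : ∀ t ∈ J, ψ (x + σ t • v) ≠ 0)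
    (hσ : ∀ t ∈ J, HasDerivAt σ (ψ (x + σ t • v) ^ 2) t) :
    SolvesGeodesicEq (potentialSymbol ψ) (fun t => x + σ t • v) J := by
  have hc : ∀ t ∈ J, HasDerivAt (fun t => x + σ t • v) (ψ (x + σ t • v) ^ 2 • v) t :=
    fun t ht => ((hσ t ht).smul_const v).const_add x
  intro t ht
  have hev : deriv (fun t => x + σ t • v) =ᶠ[𝓝 t] fun t => ψ (x + σ t • v) ^ 2 • v := by
    filter_upwards [hJ.mem_nhds ht] with s hs using (hc s hs).deriv
  refine ⟨(hc t ht).differentiableAt, ?_⟩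
  rw [hev.eq_of_nhds]
  refine HasDerivAt.congr_of_eventuallyEq ?_ hev
  have h1 : HasDerivAt (fun t => ψ (x + σ t • v)) _ t :=
    (hψ (x + σ t • v)).hasFDerivAt.comp_hasDerivAt t (hc t ht)
  refine ((h1.pow 2).smul_const v).congr_deriv ?_
  rw [potentialSymbol, projectiveSymbol_apply]
  simp only [neg_apply, smul_apply, map_smul, smul_eq_mul]
  have := h0 t ht
  match_scalars
  field_simp
  simp
  ring

/-- The inverse function theorem for a primitive of a positive continuous function. -/
theorem exists_inverse_of_hasDerivAt_pos {T h : ℝ → ℝ} {J : Set ℝ} (hJ : IsOpen J)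
    (hJ' : J.OrdConnected) (hT : ∀ s ∈ J, HasDerivAt T (h s) s) (hh : ContinuousOn h J)
    (hpos : ∀ s ∈ J, 0 < h s) : IsOpen (T '' J) ∧ (T '' J).OrdConnected ∧
      ∃ σ : ℝ → ℝ, ∀ s ∈ J, σ (T s) = s ∧ HasDerivAt σ (h s)⁻¹ (T s) := by
  have hcont : ContinuousOn T J := fun s hs => (hT s hs).continuousAt.continuousWithinAt
  have hmono : StrictMonoOn T J := strictMonoOn_of_deriv_pos hJ'.convex hcont fun s hs => by
    rw [hJ.interior_eq] at hs
    rw [(hT s hs).deriv]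
    exact hpos s hs
  have hstrict : ∀ s ∈ J, HasStrictDerivAt T (h s) s := fun s hs =>
    hasStrictDerivAt_of_hasDerivAt_of_continuousAt
      (by filter_upwards [hJ.mem_nhds hs] with z hz using hT z hz)
      (hh.continuousAt (hJ.mem_nhds hs))
  have hmap : ∀ s ∈ J, map T (𝓝 s) = 𝓝 (T s) := fun s hs =>
    (hstrict s hs).map_nhds_eq (hpos s hs).ne'
  have hopen : IsOpen (T '' J) := isOpen_iff_mem_nhds.2 <| by
    rintro _ ⟨s, hs, rfl⟩
    rw [← hmap s hs]
    exact image_mem_map (hJ.mem_nhds hs)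
  refine ⟨hopen, (hJ'.isPreconnected.image T hcont).ordConnected, Function.invFunOn T J,
    fun s hs => ?_⟩
  have hinv : ∀ s ∈ J, Function.invFunOn T J (T s) = s := hmono.injOn.leftInvOn_invFunOn
  refine ⟨hinv s hs, ?_⟩
  refine HasDerivAt.of_local_left_inverse (f := T) ?_ (by rw [hinv s hs]; exact hT s hs)
    (hpos s hs).ne' ?_
  · rw [ContinuousAt, hinv s hs, ← hmap s hs, tendsto_map'_iff]
    refine tendsto_id.congr' ?_
    filter_upwards [hJ.mem_nhds hs] with z hz using (hinv z hz).symm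
  · filter_upwards [hopen.mem_nhds (mem_image_of_mem T hs)] with z hz
    exact Function.invFunOn_eq hz

namespace AffineConnection

variable {p d : ℕ} {M : Type*} [TopologicalSpace M] [ChartedSpace (E d) M]
  {conn : AffineConnection d M} {ψ : E d → ℝ} {F : E d → M} {U : Set (E d)}

theorem IsDevelopmentOn.isGeodesicOn [HasGroupoid M (similarityGroupoid p d)]
    (hF : conn.IsDevelopmentOn p ψ F U) {c : ℝ → E d} {J : Set ℝ} (hJ : IsOpen J)
    (hc : SolvesGeodesicEq (potentialSymbol ψ) c J) (hcU : MapsTo c J U) :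
    conn.IsGeodesicOn (F ∘ c) J := by
  refine ⟨fun t ht => ?_, fun e he t ⟨ht, hte⟩ => ?_⟩
  · exact ((hF.continuousAt (hcU ht)).comp (hc t ht).1.continuousAt).continuousWithinAt
  · obtain ⟨A, hA⟩ := hF.exists_similarity (hcU ht) he hte
    refine hA.similarity.geodesic_comp ?_ (hc t ht).2 hA.transforms.self_of_nhds ?_
    · filter_upwards [hJ.mem_nhds ht] with s hs using (hc s hs).1
    · exact (hc t ht).1.continuousAt.eventually hA.chart_eventuallyEq

theorem IsDevelopmentOn.solvesGeodesicEq
    (hF : conn.IsDevelopmentOn p ψ F U) {c : ℝ → E d} {J : Set ℝ} (hJ : IsOpen J)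
    (hcont : ContinuousOn c J) (hcU : MapsTo c J U) (hγ : conn.IsGeodesicOn (F ∘ c) J) :
    SolvesGeodesicEq (potentialSymbol ψ) c J := by
  intro t ht
  obtain ⟨e, A, hA⟩ := hF _ (hcU ht)
  obtain ⟨B, hB, hBA, -⟩ := hA.similarity.exists_inverse
  have hct := hcont.continuousAt (hJ.mem_nhds ht)
  have hev := hct.eventually hA.chart_eventuallyEq
  have hsrc : ∀ᶠ s in 𝓝 t, s ∈ J ∩ (F ∘ c) ⁻¹' e.source := by
    filter_upwards [hJ.mem_nhds ht, ((hF.continuousAt (hcU ht)).comp hct).eventually_mem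
      (e.open_source.mem_nhds hA.mem_source)] with s h1 h2 using ⟨h1, h2⟩
  have hγe := hγ.2 e hA.mem_atlas
  refine hB.geodesic_comp (Γ := conn.symbol e) (c := e ∘ F ∘ c)
    (hsrc.mono fun s hs => (hγe s hs).1) (hγe t hsrc.self_of_nhds).2 ?_ ?_
  · rw [show (e ∘ F ∘ c) t = A (c t) from hA.chart_apply]
    exact hA.similarity.transformsAt_symm hB hBA hA.transforms.self_of_nhds
  · filter_upwards [hev] with s hs
    have : e (F (c s)) = A (c s) := hs
    simp only [Function.comp_apply, this, hBA]

/-- If the connection is geodesically complete, a developed straight line has a limit in `M` when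
the affine parameter has a finite limit. -/
theorem GeodesicallyComplete.exists_tendsto [HasGroupoid M (similarityGroupoid p d)]
    (hcomp : conn.GeodesicallyComplete) (hψ : Differentiable ℝ ψ)
    (hF : conn.IsDevelopmentOn p ψ F U) {x v : E d} {J : Set ℝ} (hJ : IsOpen J)
    (hJ' : J.OrdConnected) (hJU : ∀ s ∈ J, x + s • v ∈ U) {T : ℝ → ℝ}
    (hT : ∀ s ∈ J, HasDerivAt T (ψ (x + s • v) ^ 2)⁻¹ s) {l : Filter ℝ} (hl : ∀ᶠ s in l, s ∈ J)
    {t₁ : ℝ} (hlim : Tendsto T l (𝓝 t₁)) :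
    ∃ m, Tendsto (fun s : ℝ => F (x + s • v)) l (𝓝 m) := by
  have h0 : ∀ s ∈ J, ψ (x + s • v) ≠ 0 := fun s hs => by
    obtain ⟨e, A, hA⟩ := hF _ (hJU s hs)
    exact hA.ne_zero
  have hcont : Continuous fun s : ℝ => ψ (x + s • v) := hψ.continuous.comp (by fun_prop)
  obtain ⟨hopen, hord, σ, hσ⟩ := exists_inverse_of_hasDerivAt_pos hJ hJ' hT
    ((hcont.pow 2).continuousOn.inv₀ fun s hs => pow_ne_zero 2 (h0 s hs))
    (fun s hs => by have := h0 s hs; positivity)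
  have hgeo : SolvesGeodesicEq (potentialSymbol ψ) (fun t => x + σ t • v) (T '' J) := by
    refine solvesGeodesicEq_line hψ hopen ?_ ?_
    · rintro _ ⟨s, hs, rfl⟩
      rw [(hσ s hs).1]
      exact h0 s hs
    · rintro _ ⟨s, hs, rfl⟩
      rw [(hσ s hs).1]
      simpa using (hσ s hs).2
  have hmaps : MapsTo (fun t => x + σ t • v) (T '' J) U := by
    rintro _ ⟨s, hs, rfl⟩
    simp only [(hσ s hs).1]
    exact hJU s hs
  obtain ⟨γ, hγ, heq⟩ := hcomp _ _ hopen hord (hF.isGeodesicOn hopen hgeo hmaps)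
  have hγc : Continuous γ := continuousOn_univ.1 hγ.1
  -- The complete geodesic is continuous at the limiting time `t₁`, which may be an endpoint of the
  -- original interval.
  refine ⟨γ t₁, ((hγc.tendsto t₁).comp hlim).congr' ?_⟩
  filter_upwards [hl] with s hs
  rw [Function.comp_apply, heq (mem_image_of_mem T hs), Function.comp_apply, (hσ s hs).1]

end AffineConnection

/-- The affine parameter along a line on which the potential does not vanish. -/
theorem exists_affine_parameter {d : ℕ} {ψ : E d → ℝ} (hψ : Continuous ψ) (x v : E d) :
    ∃ T : ℝ → ℝ, ∀ s ≥ (0 : ℝ), (∀ r ∈ Icc 0 s, ψ (x + r • v) ≠ 0) →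
      HasDerivAt T (ψ (x + s • v) ^ 2)⁻¹ s := by
  have hcont : Continuous fun s : ℝ => ψ (x + s • v) := hψ.comp (by fun_prop)
  refine ⟨fun s => ∫ r in (0 : ℝ)..s, (ψ (x + r • v) ^ 2)⁻¹, fun s hs h0 => ?_⟩
  refine intervalIntegral.integral_hasDerivAt_right (ContinuousOn.intervalIntegrable ?_) ?_ ?_
  · rw [uIcc_of_le hs]
    exact (hcont.pow 2).continuousOn.inv₀ fun r hr => pow_ne_zero 2 (h0 r hr)
  · exact (hcont.measurable.pow_const 2).inv.stronglyMeasurable.stronglyMeasurableAtFilter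
  · exact (hcont.pow 2).continuousAt.inv₀ (pow_ne_zero 2 (h0 s ⟨hs, le_rfl⟩))

/-! ### Global developments of complete connections -/

namespace AffineConnection

variable {p d : ℕ} {M : Type*} [TopologicalSpace M] [ChartedSpace (E d) M]
  {conn : AffineConnection d M} {ψ : E d → ℝ} {F : E d → M} {U : Set (E d)}

/-- A development on a convex neighbourhood of `x`, with a prescribed germ at `x`. -/
structure IsConvexDevelopment (conn : AffineConnection d M) (p : ℕ) (ψ : E d → ℝ) (F₀ : E d → M)
    (x : E d) (F : E d → M) (N : Set (E d)) : Prop where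
  isOpen : IsOpen N
  convex : Convex ℝ N
  mem : x ∈ N
  development : conn.IsDevelopmentOn p ψ F N
  germ : F =ᶠ[𝓝 x] F₀

/-- Convexity is required of the domains so that their intersections are connected and unique
continuation from `x` applies. -/
theorem IsConvexDevelopment.eqOn [HasGroupoid M (similarityGroupoid p d)] [T2Space M]
    (hψ : Continuous ψ) {F₀ G : E d → M} {x : E d}
    {N N' : Set (E d)} (hF : conn.IsConvexDevelopment p ψ F₀ x F N)
    (hG : conn.IsConvexDevelopment p ψ F₀ x G N') : EqOn F G (N ∩ N') := fun _ hy =>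
  ((hF.development.mono inter_subset_left).eventuallyEq hψ (hG.development.mono inter_subset_right)
    (hF.convex.inter hG.convex).isPreconnected ⟨hF.mem, hG.mem⟩
    (hF.germ.trans hG.germ.symm) hy).eq_of_nhds

/-- The union of all the convex developments with a given germ. -/
theorem exists_union_convexDevelopment [HasGroupoid M (similarityGroupoid p d)] [T2Space M]
    (hψ : Continuous ψ) (conn : AffineConnection d M) (F₀ : E d → M) (x : E d) :
    ∃ (F : E d → M) (W : Set (E d)), IsOpen W ∧ conn.IsDevelopmentOn p ψ F W ∧
      (∀ y ∈ W, ∃ N, y ∈ N ∧ conn.IsConvexDevelopment p ψ F₀ x F N) ∧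
      ∀ G N, conn.IsConvexDevelopment p ψ F₀ x G N → N ⊆ W := by
  classical
  let W : Set (E d) := {y | ∃ G N, conn.IsConvexDevelopment p ψ F₀ x G N ∧ y ∈ N}
  let F : E d → M := fun y => if h : y ∈ W then h.choose y else F₀ y
  have key : ∀ G N, conn.IsConvexDevelopment p ψ F₀ x G N → EqOn F G N := fun G N hG y hy => by
    have hyW : y ∈ W := ⟨G, N, hG, hy⟩
    obtain ⟨N', hN', hy'⟩ := hyW.choose_spec
    have : F y = hyW.choose y := dif_pos hyW
    rw [this]
    exact hN'.eqOn hψ hG ⟨hy', hy⟩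
  have key' : ∀ G N, conn.IsConvexDevelopment p ψ F₀ x G N →
      conn.IsConvexDevelopment p ψ F₀ x F N := fun G N hG =>
    ⟨hG.isOpen, hG.convex, hG.mem, hG.development.congr hG.isOpen (key G N hG), by
      filter_upwards [hG.germ, hG.isOpen.mem_nhds hG.mem] with z h1 h2
      rw [key G N hG h2, h1]⟩
  refine ⟨F, W, ?_, ?_, ?_, fun G N hG y hy => ⟨G, N, hG, hy⟩⟩
  · refine isOpen_iff_mem_nhds.2 ?_
    rintro y ⟨G, N, hG, hy⟩
    filter_upwards [hG.isOpen.mem_nhds hy] with z hz using ⟨G, N, hG, hz⟩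
  · rintro y ⟨G, N, hG, hy⟩
    exact (key' G N hG).development y hy
  · rintro y ⟨G, N, hG, hy⟩
    exact ⟨N, hy, key' G N hG⟩

/-- Extension of a convex development by a development on a convex set that meets its domain. -/
theorem IsConvexDevelopment.glue [HasGroupoid M (similarityGroupoid p d)] [T2Space M]
    (hψ : Continuous ψ) {F₀ G : E d → M} {x y z : E d}
    {N N' : Set (E d)} (hF : conn.IsConvexDevelopment p ψ F₀ x F N)
    (hN' : IsOpen N') (hN'c : Convex ℝ N') (hG : conn.IsDevelopmentOn p ψ G N')
    (hy : y ∈ N ∩ N') (hyFG : F =ᶠ[𝓝 y] G) (hz : z ∈ N') (hyz : y ∈ segment ℝ x z) :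
    ∃ G' N'', conn.IsConvexDevelopment p ψ F₀ x G' N'' ∧ z ∈ N'' := by
  classical
  have heq : EqOn F G (N ∩ N') := fun w hw =>
    ((hF.development.mono inter_subset_left).eventuallyEq hψ (hG.mono inter_subset_right)
      (hF.convex.inter hN'c).isPreconnected hy hyFG hw).eq_of_nhds
  let G' : E d → M := N.piecewise F G
  have h1 : EqOn G' F N := fun w hw => piecewise_eq_of_mem N F G hw
  have h2 : EqOn G' G N' := fun w hw => by
    by_cases hwN : w ∈ N
    · rw [h1 hwN, heq ⟨hwN, hw⟩]
    · exact piecewise_eq_of_notMem N F G hwN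
  have hseg : segment ℝ x z ⊆ N ∪ N' := by
    intro w hw
    obtain ⟨s, hs, rfl⟩ := segment_eq_image_lineMap ℝ x z ▸ hyz
    obtain ⟨t, ht, rfl⟩ := segment_eq_image_lineMap ℝ x z ▸ hw
    have hmapx : (AffineMap.lineMap x z : ℝ →ᵃ[ℝ] E d) 0 = x := AffineMap.lineMap_apply_zero _ _
    have hmapz : (AffineMap.lineMap x z : ℝ →ᵃ[ℝ] E d) 1 = z := AffineMap.lineMap_apply_one _ _
    rcases le_total t s with h | h
    · left
      have := (hF.convex.affine_preimage (AffineMap.lineMap x z : ℝ →ᵃ[ℝ] E d)).ordConnected.out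
        (show (0 : ℝ) ∈ _ by rw [mem_preimage, hmapx]; exact hF.mem) hy.1
      exact this ⟨ht.1, h⟩
    · right
      have := (hN'c.affine_preimage (AffineMap.lineMap x z : ℝ →ᵃ[ℝ] E d)).ordConnected.out
        hy.2 (show (1 : ℝ) ∈ _ by rw [mem_preimage, hmapz]; exact hz)
      exact this ⟨h, ht.2⟩
  have hcompact : IsCompact (segment ℝ x z) := by
    rw [segment_eq_image_lineMap]
    exact isCompact_Icc.image (AffineMap.lineMap_continuous)
  -- `N ∪ N'` need not be convex, but a thin tube around the compact segment is convex and stays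
  -- inside it.
  obtain ⟨δ, hδ, hsub⟩ := hcompact.exists_thickening_subset_open (hF.isOpen.union hN') hseg
  have hself := Metric.self_subset_thickening hδ (segment ℝ x z)
  refine ⟨G', Metric.thickening δ (segment ℝ x z), ⟨Metric.isOpen_thickening,
    (convex_segment x z).thickening δ, hself (left_mem_segment ℝ x z), fun w hw => ?_, ?_⟩,
    hself (right_mem_segment ℝ x z)⟩
  · rcases hsub hw with h | h
    · exact hF.development.congr hF.isOpen h1 w h
    · exact hG.congr hN' h2 w h
  · filter_upwards [hF.germ, hF.isOpen.mem_nhds hF.mem] with w k1 k2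
    rw [h1 k2, k1]

/-- Extension of the development along a segment on which the potential does not vanish. -/
theorem GeodesicallyComplete.exists_convexDevelopment [HasGroupoid M (similarityGroupoid p d)]
    [T2Space M] (hd : 2 ≤ d) (hstiff : conn.IsStiff p) (hcomp : conn.GeodesicallyComplete)
    (hψ : IsQuadratic p ψ) {F₀ : E d → M} {x v : E d} {W : Set (E d)}
    (hW : conn.IsDevelopmentOn p ψ F W)
    (hWN : ∀ y ∈ W, ∃ N, y ∈ N ∧ conn.IsConvexDevelopment p ψ F₀ x F N) {s₁ : ℝ} (hs₁ : 0 < s₁)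
    (hv : ∀ s ∈ Ico 0 s₁, x + s • v ∈ W) (h0 : ∀ s ∈ Icc 0 s₁, ψ (x + s • v) ≠ 0) :
    ∃ G N, conn.IsConvexDevelopment p ψ F₀ x G N ∧ x + s₁ • v ∈ N := by
  obtain ⟨T, hT⟩ := exists_affine_parameter hψ.continuous x v
  have hlt : ∀ᶠ s in 𝓝[<] s₁, s ∈ Ioo 0 s₁ := Ioo_mem_nhdsLT hs₁
  -- As `ψ` does not vanish on the closed segment, the affine parameter is finite at `s₁` and the
  -- developed path converges in `M`.
  obtain ⟨m, hm⟩ := hcomp.exists_tendsto (l := 𝓝[<] s₁) hψ.differentiableAt hW isOpen_Ioo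
    ordConnected_Ioo (fun s hs => hv s ⟨hs.1.le, hs.2⟩)
    (fun s hs => hT s hs.1.le fun r hr => h0 r ⟨hr.1, hr.2.trans hs.2.le⟩) hlt
    ((hT s₁ hs₁.le h0).continuousAt.tendsto.mono_left nhdsWithin_le_nhds)
  obtain ⟨e, he, φ, V, hφ, hVo, hVc, hme, hmV, hVe, hφ0, hφV⟩ := hstiff.exists_chart hd m
  have hnear : ∀ᶠ s in 𝓝[<] s₁, F (x + s • v) ∈ e.source ∧ e (F (x + s • v)) ∈ V :=
    hm.eventually ((e.open_source.eventually_mem hme).and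
      ((e.continuousAt hme).eventually (hVo.eventually_mem hmV)))
  obtain ⟨s₂, hs₂, hs₂'⟩ := (mem_nhdsLT_iff_exists_Ioo_subset' hs₁).1 (hlt.and hnear)
  have hs₂ : s₂ < s₁ := hs₂
  set S : Set (E d) := (fun s : ℝ => x + s • v) '' Ioo s₂ s₁
  have hlc : Continuous fun s : ℝ => x + s • v := by fun_prop
  have hSW : S ⊆ W := by
    rintro _ ⟨s, hs, rfl⟩
    exact hv s ⟨(hs₂' hs).1.1.le, hs.2⟩
  have hSe : MapsTo F S e.source := by
    rintro _ ⟨s, hs, rfl⟩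
    exact (hs₂' hs).2.1
  obtain ⟨A, hA⟩ := (hW.mono hSW).exists_similarity_forall hψ.continuous
    (isPreconnected_Ioo.image _ hlc.continuousOn) ((nonempty_Ioo.2 hs₂).image _) he hSe
  obtain ⟨s₃, hs₃⟩ := nonempty_Ioo.2 hs₂
  have hA₃ := hA _ (mem_image_of_mem _ hs₃)
  -- A single similarity `A` represents `F` near the end of the segment, so the limit point
  -- corresponds to `x + s₁ v` and the chart at `m` extends the development past it.
  have hlimA : A (x + s₁ • v) = e m := by
    have h1 : Tendsto (fun s : ℝ => A (x + s • v)) (𝓝[<] s₁) (𝓝 (A (x + s₁ • v))) :=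
      ((hA₃.similarity.continuous.comp hlc).tendsto s₁).mono_left nhdsWithin_le_nhds
    have h2 := (e.continuousAt hme).tendsto.comp hm
    refine tendsto_nhds_unique h1 (h2.congr' ?_)
    filter_upwards [Ioo_mem_nhdsLT hs₂] with s hs
    exact (hA _ (mem_image_of_mem _ hs)).chart_apply
  have hyV : A (x + s₃ • v) ∈ V := by
    rw [← hA₃.chart_apply]
    exact (hs₂' hs₃).2.2
  obtain ⟨-, hG⟩ := hA₃.extend hψ hφ hVo hVe hφ0 hφV hyV
  obtain ⟨N, hyN, hN⟩ := hWN _ (hSW (mem_image_of_mem _ hs₃))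
  refine hN.glue hψ.continuous (hVo.preimage hA₃.similarity.continuous)
    (hA₃.similarity.convex_preimage hVc) (fun w hw => ⟨e, A, hG w hw⟩) ⟨hyN, hyV⟩
    hA₃.eventuallyEq (by rw [mem_preimage, hlimA]; exact hmV) ?_
  rw [segment_eq_image']
  refine ⟨s₃ / s₁, ⟨?_, ?_⟩, ?_⟩
  · have := (hs₂' hs₃).1.1
    positivity
  · rw [div_le_one hs₁]
    exact hs₃.2.le
  · simp only [add_sub_cancel_left, smul_smul]
    rw [div_mul_cancel₀ _ hs₁.ne']

/-- A complete stiff connection is developed on the set of the points that can be joined to the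
base point by a segment on which the potential does not vanish. -/
theorem GeodesicallyComplete.exists_development [HasGroupoid M (similarityGroupoid p d)]
    [T2Space M] (hd : 2 ≤ d) (hstiff : conn.IsStiff p) (hcomp : conn.GeodesicallyComplete)
    (hψ : IsQuadratic p ψ) {e : OpenPartialHomeomorph M (E d)} (he : e ∈ atlas (E d) M) {x : E d}
    (hx : x ∈ e.target) (hx0 : ψ x ≠ 0)
    (hxe : ∀ᶠ y in 𝓝 x, conn.symbol e y = potentialSymbol ψ y) :
    ∃ (F : E d → M) (W : Set (E d)), IsOpen W ∧ conn.IsDevelopmentOn p ψ F W ∧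
      ∀ y, (∀ s ∈ Icc (0 : ℝ) 1, ψ (x + s • (y - x)) ≠ 0) → y ∈ W := by
  obtain ⟨F, W, hWo, hW, hWN, hWmax⟩ := exists_union_convexDevelopment (p := p) hψ.continuous
    conn e.symm x
  refine ⟨F, W, hWo, hW, fun y hy => ?_⟩
  have hxW : x ∈ W := by
    have h1 : conn.IsDevelopmentAt p ψ e.symm e id x := by
      refine ⟨he, .refl p d, hx, EventuallyEq.rfl, ?_, hx0⟩
      filter_upwards [hxe] with z hz
      rw [IsSimilarity.transformsAt_iff (L := ContinuousLinearMap.id ℝ (E d)) (c := 0)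
        fun z => by simp]
      intro u v
      simp [hz]
    obtain ⟨ε, hε, hball⟩ := Metric.eventually_nhds_iff_ball.1 (h1.eventually hψ.continuous)
    exact hWmax e.symm (Metric.ball x ε) ⟨Metric.isOpen_ball, convex_ball x ε,
      Metric.mem_ball_self hε, fun z hz => ⟨e, id, hball z hz⟩, EventuallyEq.rfl⟩
      (Metric.mem_ball_self hε)
  set v := y - x
  have hlc : Continuous fun s : ℝ => x + s • v := by fun_prop
  set S : Set ℝ := {s | s ∈ Icc (0 : ℝ) 1 ∧ x + s • v ∈ W}
  have h0S : (0 : ℝ) ∈ S := ⟨⟨le_rfl, zero_le_one⟩, by simpa using hxW⟩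
  have hbdd : BddAbove S := ⟨1, fun s hs => hs.1.2⟩
  -- `W` is star-shaped about `x`, being a union of convex sets containing `x`. It remains to show
  -- that the supremum of `S` belongs to `S` and equals `1`.
  have hdown : ∀ s ∈ S, ∀ r ∈ Icc 0 s, r ∈ S := fun s hs r hr => by
    refine ⟨⟨hr.1, hr.2.trans hs.1.2⟩, ?_⟩
    obtain ⟨N, hsN, hN⟩ := hWN _ hs.2
    refine hWmax F N hN ?_
    rcases eq_or_lt_of_le hr.1 with h | h
    · rw [← h, zero_smul, add_zero]
      exact hN.mem
    have hs0 : 0 < s := h.trans_le hr.2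
    refine hN.convex.segment_subset hN.mem hsN ?_
    rw [segment_eq_image']
    refine ⟨r / s, ⟨by positivity, (div_le_one hs0).2 hr.2⟩, ?_⟩
    simp only [add_sub_cancel_left, smul_smul]
    rw [div_mul_cancel₀ _ hs0.ne']
  set s₁ := sSup S
  have hs₁1 : s₁ ≤ 1 := csSup_le ⟨0, h0S⟩ fun s hs => hs.1.2
  have hs₁0 : 0 ≤ s₁ := le_csSup hbdd h0S
  have hlt : ∀ s ∈ Ico 0 s₁, s ∈ S := fun s hs => by
    obtain ⟨r, hr, hsr⟩ := exists_lt_of_lt_csSup ⟨0, h0S⟩ hs.2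
    exact hdown r hr s ⟨hs.1, hsr.le⟩
  have hs₁W : x + s₁ • v ∈ W := by
    rcases eq_or_lt_of_le hs₁0 with h | h
    · rw [← h]
      exact h0S.2
    obtain ⟨G, N, hN, hmem⟩ := hcomp.exists_convexDevelopment hd hstiff hψ hW hWN h
      (fun s hs => (hlt s hs).2) fun s hs => hy s ⟨hs.1, hs.2.trans hs₁1⟩
    exact hWmax G N hN hmem
  rcases eq_or_lt_of_le hs₁1 with h | h
  · rw [h, one_smul, add_sub_cancel] at hs₁W
    exact hs₁W
  · exfalso
    have h1 : ∀ᶠ s in 𝓝[>] s₁, s ∈ Ioo s₁ 1 ∧ x + s • v ∈ W :=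
      (show ∀ᶠ s in 𝓝[>] s₁, s ∈ Ioo s₁ 1 from Ioo_mem_nhdsGT h).and
        (nhdsWithin_le_nhds (hlc.continuousAt.eventually_mem (hWo.mem_nhds hs₁W)))
    obtain ⟨s, hs, hsW⟩ := h1.exists
    exact absurd (le_csSup hbdd ⟨⟨hs₁0.trans hs.1.le, hs.2.le⟩, hsW⟩) (not_le.2 hs.1)

end AffineConnection

/-! ### The signature -/

/-- Eventually `f² ≥ s²`, so `T` increases while `T + 1/s` decreases; thus `T` is monotone and
bounded. -/
theorem exists_tendsto_affine_parameter {T f : ℝ → ℝ} {a b c : ℝ} (ha : a ≠ 0)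
    (hf : ∀ s, f s = c + b * s + a * s ^ 2) (hT : ∀ s ≥ (0 : ℝ), HasDerivAt T (f s ^ 2)⁻¹ s) :
    ∃ t, Tendsto T atTop (𝓝 t) := by
  have ha' : 0 < |a| := abs_pos.2 ha
  -- Beyond this point `|a| s²` exceeds `|b| s + |c|` by at least `s`, whence `|f s| ≥ s`.
  set s₀ : ℝ := max 1 ((1 + |b| + |c|) / |a|)
  have hs₀1 : 1 ≤ s₀ := le_max_left _ _
  have hbound : ∀ s ≥ s₀, s ^ 2 ≤ f s ^ 2 := fun s hs => by
    have hs1 : 1 ≤ s := hs₀1.trans hs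
    have h1 : 1 + |b| + |c| ≤ |a| * s := by
      rw [mul_comm, ← div_le_iff₀ ha']
      exact (le_max_right _ _).trans hs
    have h2 : |a * s ^ 2| ≤ |f s| + |c| + |b| * s := by
      have : a * s ^ 2 = f s + -c + -(b * s) := by rw [hf]; ring
      rw [this]
      refine (abs_add_three _ _ _).trans (le_of_eq ?_)
      rw [abs_neg, abs_neg, abs_mul, abs_of_pos (by linarith : (0 : ℝ) < s)]
    rw [abs_mul, abs_of_nonneg (sq_nonneg s)] at h2
    have h3 : s ≤ |f s| := by nlinarith [abs_nonneg b, abs_nonneg c]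
    rw [← sq_abs (f s)]
    gcongr
  have hmono : MonotoneOn T (Ici s₀) := by
    refine monotoneOn_of_deriv_nonneg (convex_Ici s₀)
      (fun s hs => (hT s (zero_le_one.trans (hs₀1.trans hs))).continuousAt.continuousWithinAt)
      (fun s hs => ?_) fun s hs => ?_
    all_goals
      rw [interior_Ici] at hs
      have h := hT s (zero_le_one.trans (hs₀1.trans (le_of_lt hs)))
    · exact h.differentiableAt.differentiableWithinAt
    · rw [h.deriv]
      positivity
  have hanti : AntitoneOn (fun s => T s + s⁻¹) (Ici s₀) := by
    have hd : ∀ s ≥ s₀, HasDerivAt (fun s => T s + s⁻¹) ((f s ^ 2)⁻¹ + -(s ^ 2)⁻¹) s :=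
      fun s hs => by
      have hs1 : 1 ≤ s := hs₀1.trans hs
      exact (hT s (by linarith)).add (hasDerivAt_inv (by linarith))
    refine antitoneOn_of_deriv_nonpos (convex_Ici s₀)
      (fun s hs => (hd s hs).continuousAt.continuousWithinAt) (fun s hs => ?_) fun s hs => ?_
    all_goals
      rw [interior_Ici] at hs
      have h := hd s (le_of_lt hs)
    · exact h.differentiableAt.differentiableWithinAt
    · rw [h.deriv]
      have hs1 : 0 < s := by linarith [mem_Ioi.1 hs]
      have := inv_anti₀ (by positivity) (hbound s (le_of_lt hs))
      linarith
  have hmono' : Monotone fun s => T (max s s₀) := fun s t hst =>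
    hmono (mem_Ici.2 (le_max_right s s₀)) (mem_Ici.2 (le_max_right t s₀)) (max_le_max hst le_rfl)
  have hbdd : BddAbove (range fun s => T (max s s₀)) := by
    refine ⟨T s₀ + s₀⁻¹, ?_⟩
    rintro _ ⟨s, rfl⟩
    have h1 := hanti (mem_Ici.2 le_rfl) (mem_Ici.2 (le_max_right s s₀)) (le_max_right s s₀)
    have h2 : 0 < (max s s₀)⁻¹ := by
      have : 0 < max s s₀ := (zero_lt_one.trans_le hs₀1).trans_le (le_max_right _ _)
      positivity
    simp only at h1 ⊢
    linarith
  refine ⟨_, (tendsto_atTop_ciSup hmono' hbdd).congr' ?_⟩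
  filter_upwards [eventually_ge_atTop s₀] with s hs
  rw [max_eq_left hs]

namespace AffineConnection

variable {p d : ℕ} {M : Type*} [TopologicalSpace M] [ChartedSpace (E d) M]
  {conn : AffineConnection d M} {ψ : E d → ℝ} {F : E d → M} {U : Set (E d)}

/-- A developed ray of finite affine length leaves the domain. -/
theorem GeodesicallyComplete.not_tendsto_affine_parameter [HasGroupoid M (similarityGroupoid p d)]
    (hcomp : conn.GeodesicallyComplete) (hψ : Differentiable ℝ ψ)
    (hF : conn.IsDevelopmentOn p ψ F U) {x v : E d} (hv : v ≠ 0)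
    (hU : ∀ s > (0 : ℝ), x + s • v ∈ U) {T : ℝ → ℝ}
    (hT : ∀ s > 0, HasDerivAt T (ψ (x + s • v) ^ 2)⁻¹ s) (t : ℝ) : ¬ Tendsto T atTop (𝓝 t) := by
  intro ht
  have hlc : Continuous fun s : ℝ => x + s • v := by fun_prop
  obtain ⟨m, hm⟩ := hcomp.exists_tendsto hψ hF isOpen_Ioi ordConnected_Ioi hU hT
    (eventually_gt_atTop 0) ht
  set e := chartAt (E d) m
  have hme := mem_chart_source (E d) m
  have hev := (eventually_gt_atTop (0 : ℝ)).and (hm.eventually (e.open_source.eventually_mem hme))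
  obtain ⟨s₂, hs₂⟩ := eventually_atTop.1 hev
  set S : Set (E d) := (fun s : ℝ => x + s • v) '' Ici s₂
  obtain ⟨A, hA⟩ := (hF.mono (V := S) (by
    rintro _ ⟨s, hs, rfl⟩
    exact hU s (hs₂ s hs).1)).exists_similarity_forall hψ.continuous
    (isPreconnected_Ici.image _ hlc.continuousOn) (nonempty_Ici.image _)
    (chart_mem_atlas (E d) m) (by
    rintro _ ⟨s, hs, rfl⟩
    exact (hs₂ s hs).2)
  obtain ⟨w, hw, hAw⟩ := (hA _ (mem_image_of_mem _ self_mem_Ici)).similarity.map_add_smul v hv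
  -- In a chart at the supposed limit the ray is `A x + s w` with `w ≠ 0`, which is unbounded and
  -- cannot converge.
  have h1 : Tendsto (fun s : ℝ => s • w) atTop (𝓝 (e m - A x)) := by
    refine (((e.continuousAt hme).tendsto.comp hm).sub_const (A x)).congr' ?_
    filter_upwards [eventually_ge_atTop s₂] with s hs
    have h := (hA _ (mem_image_of_mem _ hs)).chart_apply
    simp only [Function.comp_apply]
    rw [h, hAw, add_sub_cancel_left]
  refine not_tendsto_nhds_of_tendsto_atTop ?_ _ h1.norm
  have h2 : Tendsto (fun s : ℝ => s * ‖w‖) atTop atTop :=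
    tendsto_id.atTop_mul_const (norm_pos_iff.2 hw)
  refine h2.congr' ?_
  filter_upwards [eventually_ge_atTop 0] with s hs
  rw [norm_smul, Real.norm_of_nonneg hs]

/-- Otherwise the whole ray is developed, and `ψ` has degree exactly two on it, so its affine length
is finite; completeness excludes this. -/
theorem GeodesicallyComplete.exists_zero [HasGroupoid M (similarityGroupoid p d)]
    (hcomp : conn.GeodesicallyComplete) {c : ℝ} (hc : c ≠ 0) {l : E d →L[ℝ] ℝ} {k : ℝ}
    (hF : conn.IsDevelopmentOn p (quadraticFunction p d c l k) F U) {x : E d}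
    (hx : quadraticFunction p d c l k x ≠ 0)
    (hU : ∀ y, (∀ s ∈ Icc (0 : ℝ) 1, quadraticFunction p d c l k (x + s • (y - x)) ≠ 0) → y ∈ U)
    {v : E d} (hv : quad p d v ≠ 0) :
    ∃ s > (0 : ℝ), quadraticFunction p d c l k (x + s • v) = 0 := by
  by_contra! hcon
  have h0 : ∀ s ≥ (0 : ℝ), quadraticFunction p d c l k (x + s • v) ≠ 0 := fun s hs => by
    rcases eq_or_lt_of_le hs with h | h
    · rwa [← h, zero_smul, add_zero]
    · exact hcon s h
  have hv0 : v ≠ 0 := by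
    rintro rfl
    exact hv (by simp [quad])
  obtain ⟨T, hT⟩ := exists_affine_parameter (continuous_quadraticFunction p d c l k) x v
  have hT' : ∀ s ≥ (0 : ℝ), HasDerivAt T (quadraticFunction p d c l k (x + s • v) ^ 2)⁻¹ s :=
    fun s hs => hT s hs fun r hr => h0 r hr.1
  obtain ⟨t, ht⟩ := exists_tendsto_affine_parameter (mul_ne_zero hc hv)
    (fun s => quadraticFunction_add_smul p d c l k x v s) hT'
  refine hcomp.not_tendsto_affine_parameter (IsQuadratic.differentiableAt ⟨c, l, k, rfl⟩) hF hv0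
    (fun s hs => hU _ fun r hr => ?_) (fun s hs => hT' s (le_of_lt hs)) t ht
  rw [add_sub_cancel_left, smul_smul]
  exact h0 _ (mul_nonneg hr.1 (le_of_lt hs))

theorem GeodesicallyComplete.mul_quad_neg [HasGroupoid M (similarityGroupoid p d)]
    (hcomp : conn.GeodesicallyComplete) {c : ℝ} (hc : c ≠ 0) {l : E d →L[ℝ] ℝ} {k : ℝ}
    (hF : conn.IsDevelopmentOn p (quadraticFunction p d c l k) F U) {x : E d}
    (hx : quadraticFunction p d c l k x ≠ 0)
    (hU : ∀ y, (∀ s ∈ Icc (0 : ℝ) 1, quadraticFunction p d c l k (x + s • (y - x)) ≠ 0) → y ∈ U)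
    {v : E d} (hv : quad p d v ≠ 0) : quadraticFunction p d c l k x * (c * quad p d v) < 0 := by
  have hq : quad p d (-v) = quad p d v := by simp [quad]
  obtain ⟨s, hs, h1⟩ := hcomp.exists_zero hc hF hx hU hv
  obtain ⟨t, ht, h2⟩ := hcomp.exists_zero hc hF hx hU (hq ▸ hv)
  rw [quadraticFunction_add_smul] at h1 h2
  rw [hq, map_neg, map_neg] at h2
  set γ := quadraticFunction p d c l k x
  set a := c * quad p d v
  -- The zeros `s` and `-t` have opposite signs; this combination eliminates the linear coefficient
  -- and recovers the product of the roots.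
  have h3 : (s + t) * (a * (s * t) + γ) = 0 := by linear_combination t * h1 + s * h2
  have h4 : γ = -(a * (s * t)) := by
    have := (mul_eq_zero.1 h3).resolve_left (by positivity)
    linarith
  have ha : a ≠ 0 := mul_ne_zero hc hv
  rw [h4]
  have : 0 < a ^ 2 * (s * t) := by positivity
  linarith

end AffineConnection

theorem eps_definite {p d : ℕ} (hp : p ≤ d) (hd : 2 ≤ d) {b : ℝ}
    (h : ∀ i : Fin d, b * eps p i < 0) : (p = d ∧ b < 0) ∨ (p = 0 ∧ 0 < b) := by
  have h0 := h ⟨0, by omega⟩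
  rcases Nat.eq_zero_or_pos p with hp0 | hp0
  · right
    simp only [eps, hp0, lt_irrefl, if_false] at h0
    exact ⟨hp0, by linarith⟩
  · left
    simp only [eps, hp0, if_true] at h0
    refine ⟨le_antisymm hp (not_lt.1 fun hlt => ?_), by linarith⟩
    have h1 := h ⟨p, hlt⟩
    simp only [eps, lt_irrefl, if_false] at h1
    linarith

/-! ### Normalization of the potential in a definite signature -/

/-- The potential `|x|² - 1` of the unit ball. -/
def ballPotential (d : ℕ) (x : E d) : ℝ := quad d d x - 1

theorem quad_self_eq_sum (d : ℕ) (x : E d) : quad d d x = ∑ i, x i ^ 2 := by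
  rw [quad, form_apply]
  refine Finset.sum_congr rfl fun i _ => ?_
  simp [eps, sq]

theorem quad_self_nonneg (d : ℕ) (x : E d) : 0 ≤ quad d d x := by
  rw [quad_self_eq_sum]
  positivity

theorem quad_self_pos {d : ℕ} {x : E d} (hx : x ≠ 0) : 0 < quad d d x := by
  refine (quad_self_nonneg d x).lt_of_ne' fun h => hx ?_
  rw [quad_self_eq_sum, Finset.sum_eq_zero_iff_of_nonneg fun i _ => sq_nonneg _] at h
  ext i
  simpa using h i (Finset.mem_univ i)

theorem quad_eq_mul_quad_self {p d : ℕ} {ν : ℝ} (h : (p = d ∧ ν = 1) ∨ (p = 0 ∧ ν = -1)) (x : E d) :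
    quad p d x = ν * quad d d x := by
  rcases h with ⟨rfl, rfl⟩ | ⟨rfl, rfl⟩
  · rw [one_mul]
  · simp [quad, form_apply, eps]

theorem isQuadratic_ballPotential {p d : ℕ} {ν : ℝ}
    (h : (p = d ∧ ν = 1) ∨ (p = 0 ∧ ν = -1)) : IsQuadratic p (ballPotential d) := by
  refine ⟨ν, 0, -1, ?_⟩
  have hν : ν * ν = 1 := by rcases h with ⟨-, rfl⟩ | ⟨-, rfl⟩ <;> norm_num
  ext x
  rw [quadraticFunction, quad_eq_mul_quad_self h, ballPotential, ← mul_assoc, hν]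
  simp [sub_eq_add_neg]

theorem convex_ballPotential_neg (d : ℕ) : Convex ℝ {x : E d | ballPotential d x < 0} := by
  intro x hx y hy a b ha hb hab
  have hx' : quad d d x - 1 < 0 := hx
  have hy' : quad d d y - 1 < 0 := hy
  have h1 : quad d d (a • x + b • y) ≤ a * quad d d x + b * quad d d y := by
    simp only [quad_self_eq_sum, Finset.mul_sum, ← Finset.sum_add_distrib]
    refine Finset.sum_le_sum fun i _ => ?_
    simp only [Pi.add_apply, Pi.smul_apply, smul_eq_mul]
    obtain rfl : b = 1 - a := by linarith
    nlinarith [mul_nonneg (mul_nonneg ha hb) (sq_nonneg (x i - y i))]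
  change quad d d (a • x + b • y) - 1 < 0
  have h2 : a * quad d d x + b * quad d d y < 1 := by
    rcases eq_or_lt_of_le ha with rfl | ha
    · have : b = 1 := by linarith
      subst this
      linarith
    · have := mul_lt_mul_of_pos_left (sub_neg.1 hx') ha
      have := mul_le_mul_of_nonneg_left (sub_neg.1 hy').le hb
      linarith
  linarith

theorem exists_form_self_eq {d : ℕ} (l : E d →L[ℝ] ℝ) : ∃ b : E d, ∀ x, l x = form d d b x := by
  refine ⟨fun i => l (Pi.single i 1), fun x => ?_⟩
  refine DFunLike.congr_fun (clm_ext_single (B := form d d fun i => l (Pi.single i 1))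
    fun i => ?_) x
  rw [form_single_right]
  simp [eps]

/-- A potential of definite signature, whose zero set surrounds a point, is similar to that of the
unit ball. -/
theorem exists_similarity_ballPotential {p d : ℕ} {ν : ℝ}
    (h : (p = d ∧ ν = 1) ∨ (p = 0 ∧ ν = -1)) {c : ℝ} {l : E d →L[ℝ] ℝ} {k : ℝ} {x : E d}
    (hx : quadraticFunction p d c l k x * (c * ν) < 0) :
    ∃ S : E d → E d, IsSimilarity p d S ∧ (∃ x', S x' = x ∧ ballPotential d x' < 0) ∧
      ∃ κ ≠ 0, ∀ z, quadraticFunction p d c l k (S z) = κ * ballPotential d z := by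
  obtain ⟨b, hb⟩ := exists_form_self_eq l
  set C := c * ν
  have hC : C ≠ 0 := by
    rintro h0
    rw [h0, mul_zero] at hx
    exact lt_irrefl 0 hx
  -- Completing the square: `ψ = C (|z + b'|² - R2)`, and the sign hypothesis says that `x` lies in
  -- the ball, so that `R2 > 0`.
  set b' := (2 * C)⁻¹ • b with hb'
  set R2 := quad d d b' - k / C with hR2
  have hψ : ∀ z, quadraticFunction p d c l k z = C * (quad d d (z + b') - R2) := fun z => by
    rw [quadraticFunction, quad_eq_mul_quad_self h, hb, quad_add, hR2, hb', map_smul, smul_eq_mul,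
      form_comm d d b z, ← mul_assoc c ν]
    field_simp
    ring
  have hxR : quad d d (x + b') < R2 := by
    rw [hψ] at hx
    have h1 : C ^ 2 * (quad d d (x + b') - R2) < 0 := by linarith
    have h2 : 0 < C ^ 2 := by positivity
    by_contra! h3
    have := mul_nonneg h2.le (sub_nonneg.2 h3)
    linarith
  have hR2 : 0 < R2 := (quad_self_nonneg d _).trans_lt hxR
  set R := √R2
  have hR : 0 < R := Real.sqrt_pos.2 hR2
  have hRR : R ^ 2 = R2 := Real.sq_sqrt hR2.le
  refine ⟨fun z => R • z + -b', ⟨R, ContinuousLinearMap.id ℝ _, -b', hR, fun z => rfl,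
    fun z => rfl⟩, ⟨R⁻¹ • (x + b'), ?_, ?_⟩, C * R2, mul_ne_zero hC hR2.ne', fun z => ?_⟩
  · simp [smul_smul, hR.ne']
  · rw [ballPotential, quad_smul, inv_pow, hRR, sub_neg, inv_mul_lt_iff₀ hR2, mul_one]
    exact hxR
  · rw [hψ, neg_add_cancel_right, quad_smul, hRR, ballPotential]
    ring

namespace AffineConnection

variable {p d : ℕ} {M : Type*} [TopologicalSpace M] [ChartedSpace (E d) M]
  {conn : AffineConnection d M} {φ ψ : E d → ℝ} {F : E d → M} {U : Set (E d)}

theorem IsDevelopmentAt.comp {e : OpenPartialHomeomorph M (E d)} {A S : E d → E d} {y : E d}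
    (hψ : Differentiable ℝ ψ) (hS : IsSimilarity p d S)
    (h : conn.IsDevelopmentAt p ψ F e A (S y)) :
    conn.IsDevelopmentAt p (ψ ∘ S) (F ∘ S) e (A ∘ S) y := by
  have hc := hS.continuous.continuousAt (x := y)
  refine ⟨h.mem_atlas, h.similarity.comp hS, h.mem_target, hc.eventually h.eventuallyEq, ?_,
    h.ne_zero⟩
  filter_upwards [hc.eventually h.transforms] with z hz
  exact hS.transformsAt_comp h.similarity (hS.transformsAt_potentialSymbol (hψ _)) hz

theorem IsDevelopmentAt.congr_potential {e : OpenPartialHomeomorph M (E d)} {A : E d → E d}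
    {y : E d} (h : conn.IsDevelopmentAt p φ F e A y) {κ : ℝ} (hκ : κ ≠ 0)
    (hφ : ∀ x, φ x = κ * ψ x) : conn.IsDevelopmentAt p ψ F e A y :=
  ⟨h.mem_atlas, h.similarity, h.mem_target, h.eventuallyEq,
    h.transforms.mono fun z hz => hz.congr_left (potentialSymbol_const_mul hκ hφ z), fun h0 =>
      h.ne_zero (by rw [hφ, h0, mul_zero])⟩

/-- A complete stiff connection that is not flat has a definite signature, and it is developed on
the unit ball. -/
theorem GeodesicallyComplete.exists_ball_development [HasGroupoid M (similarityGroupoid p d)]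
    [T2Space M] (hp : p ≤ d) (hd : 2 ≤ d) (hstiff : conn.IsStiff p)
    (hcomp : conn.GeodesicallyComplete) (hflat : ¬ conn.IsFlat) :
    ∃ ν : ℝ, ((p = d ∧ ν = 1) ∨ (p = 0 ∧ ν = -1)) ∧
      ∃ F, conn.IsDevelopmentOn p (ballPotential d) F {x | ballPotential d x < 0} := by
  obtain ⟨e, he, x, hx, c, l, k, hc, hx0, hxe⟩ := hstiff.exists_potential_of_not_isFlat hd hflat
  have hψ : IsQuadratic p (quadraticFunction p d c l k) := ⟨c, l, k, rfl⟩
  obtain ⟨F, W, hWo, hW, hWmem⟩ := hcomp.exists_development hd hstiff hψ he hx hx0 hxe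
  have hsign : ∀ i : Fin d, quadraticFunction p d c l k x * c * eps p i < 0 := fun i => by
    have hq : quad p d (Pi.single i 1) = eps p i := by
      rw [quad, form_single_left, Pi.single_eq_same, mul_one]
    have := hcomp.mul_quad_neg hc hW hx0 hWmem (hq ▸ eps_ne_zero p i)
    rwa [hq, ← mul_assoc] at this
  obtain ⟨ν, hν, hneg⟩ : ∃ ν : ℝ, ((p = d ∧ ν = 1) ∨ (p = 0 ∧ ν = -1)) ∧
      quadraticFunction p d c l k x * (c * ν) < 0 := by
    rcases eps_definite hp hd hsign with ⟨h1, h2⟩ | ⟨h1, h2⟩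
    · exact ⟨1, Or.inl ⟨h1, rfl⟩, by linarith⟩
    · exact ⟨-1, Or.inr ⟨h1, rfl⟩, by linarith⟩
  refine ⟨ν, hν, ?_⟩
  obtain ⟨S, hS, ⟨x', rfl, hx'⟩, κ, hκ, hSψ⟩ := exists_similarity_ballPotential hν hneg
  refine ⟨F ∘ S, fun z hz => ?_⟩
  have hSz : S z ∈ W := by
    refine hWmem _ fun s hs => ?_
    obtain ⟨-, L, b, -, -, -, hL⟩ := hS.exists_linear
    -- The segment from the base point corresponds under `S` to a segment of the unit ball, which is
    -- convex, so the potential does not vanish on it.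
    have h1 : S x' + s • (S z - S x') = S ((1 - s) • x' + s • z) := by
      simp only [hL, map_add, map_smul]
      module
    rw [h1, hSψ]
    refine mul_ne_zero hκ (ne_of_lt ?_)
    exact convex_ballPotential_neg d hx' hz (by linarith [hs.2]) hs.1 (by ring)
  obtain ⟨e', A, hA⟩ := hW _ hSz
  exact ⟨e', A ∘ S, (hA.comp hψ.differentiableAt hS).congr_potential hκ hSψ⟩

end AffineConnection

/-! ### Developments of the unit ball are bijective -/

theorem IsSimilarity.map_nhds_eq {p d : ℕ} {A : E d → E d} (hA : IsSimilarity p d A) (x : E d) :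
    map A (𝓝 x) = 𝓝 (A x) := by
  obtain ⟨B, hB, hBA, hAB⟩ := hA.exists_inverse
  exact (Homeomorph.mk ⟨A, B, hBA, hAB⟩ hA.continuous hB.continuous).map_nhds_eq x

/-- A similarity that preserves the potential of the ball up to a factor is linear and preserves
this potential. -/
theorem IsSimilarity.ballPotential_invariant {p d : ℕ} {ν : ℝ}
    (h : (p = d ∧ ν = 1) ∨ (p = 0 ∧ ν = -1)) {C : E d → E d} (hC : IsSimilarity p d C) {κ : ℝ}
    (hκ : ∀ x, ballPotential d (C x) = κ * ballPotential d x) :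
    C 0 = 0 ∧ ∀ x, ballPotential d (C x) = ballPotential d x := by
  obtain ⟨r, L, b, -, hL, hinj, hC⟩ := hC.exists_linear
  have hν : ν ≠ 0 := by rcases h with ⟨-, rfl⟩ | ⟨-, rfl⟩ <;> norm_num
  have hL' : ∀ x, quad d d (L x) = r * quad d d x := fun x => by
    have := hL x
    rw [quad_eq_mul_quad_self h, quad_eq_mul_quad_self h, mul_left_comm] at this
    exact mul_left_cancel₀ hν this
  have h1 : ∀ x, r * quad d d x + 2 * form d d (L x) b + quad d d b - 1 =
      κ * (quad d d x - 1) := fun x => by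
    have := hκ x
    rwa [ballPotential, ballPotential, hC, quad_add, hL'] at this
  have hneg : ∀ x : E d, quad d d (-x) = quad d d x := fun x => by simp [quad]
  -- Comparison of `x` with `-x` isolates the odd part. As `L` is surjective, `b` is orthogonal to
  -- itself, hence zero; the value at `0` then gives `κ = 1`.
  have h2 : ∀ x, form d d (L x) b = 0 := fun x => by
    have e1 := h1 x
    have e2 := h1 (-x)
    rw [hneg, map_neg, map_neg, neg_apply] at e2
    linarith
  obtain ⟨y, hy⟩ := (LinearMap.injective_iff_surjective (f := (L : E d →ₗ[ℝ] E d))).1 hinj b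
  have hb : b = 0 := by
    by_contra hb
    have := h2 y
    rw [show L y = b from hy] at this
    exact (quad_self_pos hb).ne' this
  have hκ1 : κ = 1 := by
    have := h1 0
    rw [hb] at this
    simp [quad] at this
    linarith
  refine ⟨by rw [hC, hb, map_zero, add_zero], fun x => ?_⟩
  rw [hκ, hκ1, one_mul]

namespace AffineConnection

variable {p d : ℕ} {M : Type*} [TopologicalSpace M] [ChartedSpace (E d) M]
  {conn : AffineConnection d M} {ψ : E d → ℝ} {F : E d → M} {U : Set (E d)}

theorem IsDevelopmentAt.map_nhds_eq {e : OpenPartialHomeomorph M (E d)} {A : E d → E d} {y : E d}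
    (h : conn.IsDevelopmentAt p ψ F e A y) : map F (𝓝 y) = 𝓝 (F y) := by
  rw [map_congr h.eventuallyEq, ← map_map, h.similarity.map_nhds_eq,
    e.symm.map_nhds_eq h.mem_target, h.apply_eq]

/-- Points with the same image are exchanged by a similarity `C` with `F ∘ C = F` locally. It
preserves the potential up to a factor, hence fixes the centre and preserves the ball, so that `F ∘
C = F` propagates to the centre and forces `C = id`. -/
theorem IsDevelopmentOn.injOn_ball [HasGroupoid M (similarityGroupoid p d)] [T2Space M]
    {ν : ℝ} (hν : (p = d ∧ ν = 1) ∨ (p = 0 ∧ ν = -1))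
    (hF : conn.IsDevelopmentOn p (ballPotential d) F {x | ballPotential d x < 0}) :
    InjOn F {x | ballPotential d x < 0} := by
  have hψ := isQuadratic_ballPotential hν
  intro y₁ hy₁ y₂ hy₂ heq
  obtain ⟨e, A₁, h₁⟩ := hF y₁ hy₁
  obtain ⟨A₂, h₂⟩ := hF.exists_similarity hy₂ h₁.mem_atlas (heq ▸ h₁.mem_source)
  obtain ⟨B, hB, hBA, hAB⟩ := h₂.similarity.exists_inverse
  have hC : IsSimilarity p d (B ∘ A₁) := hB.comp h₁.similarity
  set C := B ∘ A₁ with hCdef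
  have hC₁ : C y₁ = y₂ := by
    rw [hCdef, Function.comp_apply, ← h₁.chart_apply, heq, h₂.chart_apply, hBA]
  have hAC : A₂ ∘ C = A₁ := by
    ext1 z
    simp only [hCdef, Function.comp_apply, hAB]
  have hFC : conn.IsDevelopmentAt p (ballPotential d ∘ C) (F ∘ C) e A₁ y₁ := by
    rw [← hAC]
    exact IsDevelopmentAt.comp hψ.differentiableAt hC (hC₁ ▸ h₂)
  obtain ⟨κ, hκ, hκC⟩ := (hψ.comp hC).exists_eq_mul hψ hFC.ne_zero h₁.ne_zero (by
    filter_upwards [hFC.transforms, h₁.transforms] with z k1 k2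
    exact h₁.similarity.eq_of_transformsAt k1 k2)
  obtain ⟨hC0, hCψ⟩ := hC.ballPotential_invariant hν hκC
  have hFCon : conn.IsDevelopmentOn p (ballPotential d) (F ∘ C) {x | ballPotential d x < 0} := by
    intro z hz
    have hz : ballPotential d z < 0 := hz
    obtain ⟨e', A, hA⟩ := hF (C z) (by change ballPotential d (C z) < 0; rwa [hCψ])
    exact ⟨e', A ∘ C, (hA.comp hψ.differentiableAt hC).congr_potential hκ hκC⟩
  have h0 : (0 : E d) ∈ {x | ballPotential d x < 0} := by simp [ballPotential, quad]
  have hgerm := hFCon.eventuallyEq hψ.continuous hF (convex_ballPotential_neg d).isPreconnected hy₁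
    (hFC.eventuallyEq.trans h₁.eventuallyEq.symm) h0
  obtain ⟨e', A, hA⟩ := hF 0 h0
  have hA' := (hC0.symm ▸ hA : conn.IsDevelopmentAt p (ballPotential d) F e' A (C 0)).comp
    hψ.differentiableAt hC |>.congr_potential hκ hκC
  -- Since `C 0 = 0`, both germs at the centre are read in the same chart, by `A ∘ C` and by `A`;
  -- injectivity of `A` gives `C y₁ = y₁`.
  have hAA : A ∘ C = A := (hA'.congr hgerm.symm).similarity_unique hA
  rw [← hC₁]
  exact (hA.similarity.injective (congrFun hAA y₁)).symm

/-- The image is open because `F` is locally a similarity in charts. It is closed because, around a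
limit point, the connection has a nonvanishing potential, so a chart domain cannot correspond to a
region crossing the unit sphere. -/
theorem IsDevelopmentOn.image_ball [HasGroupoid M (similarityGroupoid p d)] [T2Space M]
    [PreconnectedSpace M] (hd : 2 ≤ d) (hstiff : conn.IsStiff p) {ν : ℝ}
    (hν : (p = d ∧ ν = 1) ∨ (p = 0 ∧ ν = -1))
    (hF : conn.IsDevelopmentOn p (ballPotential d) F {x | ballPotential d x < 0}) :
    F '' {x | ballPotential d x < 0} = univ := by
  have hψ := isQuadratic_ballPotential hν
  have hB : IsOpen {x | ballPotential d x < 0} := isOpen_lt hψ.continuous continuous_const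
  have h0 : (0 : E d) ∈ {x | ballPotential d x < 0} := by simp [ballPotential, quad]
  refine IsClopen.eq_univ ⟨?_, ?_⟩ ⟨_, mem_image_of_mem F h0⟩
  · refine isClosed_of_closure_subset fun m hm => ?_
    obtain ⟨e, he, φ, V, hφ, hVo, hVc, hme, hmV, hVe, hφ0, hφV⟩ := hstiff.exists_chart hd m
    have hnear : e.source ∩ e ⁻¹' V ∈ 𝓝 m :=
      inter_mem (e.open_source.mem_nhds hme)
        ((e.continuousAt hme).preimage_mem_nhds (hVo.mem_nhds hmV))
    obtain ⟨_, ⟨hye, hyV⟩, y, hy, rfl⟩ := mem_closure_iff_nhds.1 hm _ hnear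
    obtain ⟨A, hA⟩ := hF.exists_similarity hy he hye
    have hyV : A y ∈ V := by
      rw [← hA.chart_apply]
      exact hyV
    obtain ⟨-, hG⟩ := hA.extend hψ hφ hVo hVe hφ0 hφV hyV
    have hVp := (hA.similarity.convex_preimage hVc).isPreconnected
    -- On this connected set the potential has no zero, so it keeps the negative sign it has at `y`.
    have hsub : A ⁻¹' V ⊆ {x | ballPotential d x < 0} := fun z hz => by
      by_contra hzB
      obtain ⟨w, hw, hw0⟩ := hVp.intermediate_value hyV hz hψ.continuous.continuousOn
        ⟨le_of_lt hy, not_lt.1 hzB⟩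
      exact (hG w hw).ne_zero hw0
    obtain ⟨B, -, -, hAB⟩ := hA.similarity.exists_inverse
    have hz : B (e m) ∈ A ⁻¹' V := by
      rw [mem_preimage, hAB]
      exact hmV
    have heq := ((hF.mono hsub).eventuallyEq hψ.continuous (fun w hw => ⟨e, A, hG w hw⟩) hVp hyV
      hA.eventuallyEq hz).eq_of_nhds
    refine ⟨B (e m), hsub hz, ?_⟩
    rw [heq, Function.comp_apply, hAB, e.left_inv hme]
  · refine isOpen_iff_mem_nhds.2 ?_
    rintro _ ⟨y, hy, rfl⟩
    obtain ⟨e, A, hA⟩ := hF y hy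
    rw [← hA.map_nhds_eq]
    exact image_mem_map (hB.mem_nhds hy)

/-! ### Developments and isomorphisms -/

theorem IsDevelopmentOn.isomorphic [HasGroupoid M (similarityGroupoid p d)]
    {U : TopologicalSpace.Opens (E d)} {conn' : AffineConnection d U}
    (hconn' : ∀ e ∈ atlas (E d) U, ∀ x, conn'.symbol e x = potentialSymbol ψ x)
    (hF : conn.IsDevelopmentOn p ψ F U) (hinj : InjOn F U)
    (hsurj : F '' U = univ) : conn.Isomorphic p conn' := by
  let g : U → M := fun u => F u
  have hgbij : Function.Bijective g := by
    refine ⟨fun u v huv => Subtype.ext (hinj u.2 v.2 huv), fun m => ?_⟩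
    obtain ⟨y, hy, rfl⟩ := hsurj.symm ▸ mem_univ m
    exact ⟨⟨y, hy⟩, rfl⟩
  have hgc : Continuous g := continuous_iff_continuousAt.2 fun u =>
    (hF.continuousAt u.2).comp continuous_subtype_val.continuousAt
  have hgo : IsOpenMap g := IsOpenMap.of_nhds_le fun u => by
    obtain ⟨e, A, hA⟩ := hF u u.2
    have h1 : map g (𝓝 u) = map F (map Subtype.val (𝓝 u)) := (map_map).symm
    have h2 : map Subtype.val (𝓝 u) = 𝓝 (u : E d) :=
      U.isOpen.isOpenEmbedding_subtypeVal.map_nhds_eq u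
    rw [h1, h2, hA.map_nhds_eq]
  let f : U ≃ₜ M := (Equiv.ofBijective g hgbij).toHomeomorphOfContinuousOpen hgc hgo
  have hf : ∀ u : U, f u = F u := fun u => rfl
  refine ⟨f.symm, fun e he e' he' => ?_⟩
  have key : ∀ x ∈ e.target ∩ (f.symm ∘ e.symm) ⁻¹' e'.source, ∃ B, IsSimilarity p d B ∧
      e' ∘ f.symm ∘ e.symm =ᶠ[𝓝 x] B ∧
        TransformsAt B (conn.symbol e) (potentialSymbol ψ) x := by
    rintro x ⟨hx, -⟩
    set y : U := f.symm (e.symm x)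
    have hy : F y = e.symm x := by rw [← hf, f.apply_symm_apply]
    obtain ⟨A, hA⟩ := hF.exists_similarity y.2 he (hy ▸ e.map_target hx)
    have hAy : A y = x := by rw [← hA.chart_apply, hy, e.right_inv hx]
    obtain ⟨B, hB, hBA, hAB⟩ := hA.similarity.exists_inverse
    have hBx : B x = y := by rw [← hAy, hBA]
    refine ⟨B, hB, ?_, hAy ▸ hA.similarity.transformsAt_symm hB hBA hA.transforms.self_of_nhds⟩
    have hBc : Tendsto B (𝓝 x) (𝓝 y) := hBx ▸ hB.continuous.tendsto x
    filter_upwards [hBc.eventually hA.eventuallyEq,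
      hBc.eventually (U.isOpen.eventually_mem y.2)] with z h1 h2
    rw [Function.comp_apply, hAB] at h1
    have h3 : f.symm (e.symm z) = ⟨B z, h2⟩ := by rw [f.symm_apply_eq, hf, h1]
    rw [Function.comp_apply, Function.comp_apply, h3, Opens.atlas_apply he']
  constructor
  · intro x hx
    obtain ⟨B, hB, hBe, -⟩ := key x hx
    exact ⟨B, hB, hBe⟩
  · intro x hx
    obtain ⟨B, -, hBe, hBt⟩ := key x hx
    exact (hBt.congr_right (hconn' e' he' _).symm).congr hBe.symm

theorem Isomorphic.exists_development [Nonempty M] {U : TopologicalSpace.Opens (E d)}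
    {conn' : AffineConnection d U}
    (hconn' : ∀ e ∈ atlas (E d) U, ∀ x, conn'.symbol e x = potentialSymbol ψ x)
    (hψ0 : ∀ x ∈ U, ψ x ≠ 0) (h : conn.Isomorphic p conn') :
    ∃ (F : E d → M) (f : M → E d), Continuous f ∧ (∀ m, f m ∈ U) ∧ (∀ m, F (f m) = m) ∧
      conn.IsDevelopmentOn p ψ F U := by
  classical
  obtain ⟨f, hf⟩ := h
  obtain ⟨m₀⟩ := ‹Nonempty M›
  -- The value `m₀` is arbitrary: only germs of `F` at points of the open set `U` matter.
  let F : E d → M := fun y => if hy : y ∈ U then f.symm ⟨y, hy⟩ else m₀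
  have hFU : ∀ y (hy : y ∈ U), F y = f.symm ⟨y, hy⟩ := fun y hy => dif_pos hy
  refine ⟨F, fun m => f m, continuous_subtype_val.comp f.continuous, fun m => (f m).2,
    fun m => ?_, fun y hy => ?_⟩
  · rw [hFU _ (f m).2]
    exact f.symm_apply_apply m
  set m := f.symm ⟨y, hy⟩
  have hfm : f m = ⟨y, hy⟩ := f.apply_symm_apply _
  set e := chartAt (E d) m
  have he : e ∈ atlas (E d) M := chart_mem_atlas _ m
  have hme : m ∈ e.source := mem_chart_source _ m
  set e' := chartAt (E d) (f m)
  have he' : e' ∈ atlas (E d) U := chart_mem_atlas _ (f m)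
  have hme' : f m ∈ e'.source := mem_chart_source _ (f m)
  obtain ⟨h1, h2⟩ := hf e he e' he'
  have hO : e.target ∩ (f ∘ e.symm) ⁻¹' e'.source ∈ 𝓝 (e m) := by
    refine inter_mem (e.open_target.mem_nhds (e.map_source hme)) ?_
    refine (f.continuous.continuousAt.comp (e.continuousAt_symm (e.map_source hme))).preimage_mem_nhds
      (e'.open_source.mem_nhds ?_)
    rwa [Function.comp_apply, e.left_inv hme]
  obtain ⟨B, hB, hBe⟩ := h1 _ (mem_of_mem_nhds hO)
  obtain ⟨A, hA, hAB, hBA⟩ := hB.exists_inverse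
  have hBm : B (e m) = y := by
    rw [← hBe.eq_of_nhds, Function.comp_apply, Function.comp_apply, e.left_inv hme,
      Opens.atlas_apply he', hfm]
  have hAy : A y = e m := by rw [← hBm, hAB]
  have hAc : Tendsto A (𝓝 y) (𝓝 (e m)) := hAy ▸ hA.continuous.tendsto y
  refine ⟨e, A, he, hA, hAy ▸ e.map_source hme, ?_, ?_, hψ0 y hy⟩
  · filter_upwards [hAc.eventually hBe, U.isOpen.eventually_mem hy] with w k1 k2
    rw [hBA, Function.comp_apply, Function.comp_apply, Opens.atlas_apply he'] at k1
    rw [hFU w k2, f.symm_apply_eq]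
    exact Subtype.ext k1.symm
  · filter_upwards [hAc.eventually hBe.eventually_nhds, hAc.eventually hO] with w k1 k2
    have k3 := ((h2 _ k2).congr k1).congr_right (hconn' e' he' _)
    have k4 := hB.transformsAt_symm hA hAB k3
    rwa [hBA] at k4

end AffineConnection

/-! ### Completeness of the unit ball -/

/-- The affine parameter on a bounded chord. -/
theorem exists_affine_parameter_chord {a α β : ℝ} (ha : a ≠ 0) (hαβ : α < β) :
    ∃ T : ℝ → ℝ, (∀ s ∈ Ioo α β, HasDerivAt T ((a * ((s - α) * (s - β))) ^ 2)⁻¹ s) ∧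
      T '' Ioo α β = univ := by
  set D := β - α with hD
  have hD0 : 0 < D := sub_pos.2 hαβ
  set K := (a ^ 2 * D ^ 2)⁻¹ with hK
  have hK0 : 0 < K := by positivity
  -- Partial fractions: if `x + y = D`, then `1/(xy)² = D⁻² (1/x² + 1/y² + (2/D)(1/x + 1/y))`. Here
  -- `-g'(r) = 1/r² + 2/(D r)`, applied to the distances to the two endpoints; the blow-up of `g` at
  -- `0` makes `T` onto.
  let g : ℝ → ℝ := fun r => r⁻¹ + 2 / D * -Real.log r
  have hg : ∀ r > 0, HasDerivAt g (-(r ^ 2)⁻¹ + 2 / D * -r⁻¹) r := fun r hr =>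
    (hasDerivAt_inv hr.ne').add ((Real.hasDerivAt_log hr.ne').neg.const_mul _)
  have hg0 : Tendsto g (𝓝[>] 0) atTop := by
    refine tendsto_inv_nhdsGT_zero.atTop_add_atTop ?_
    exact (tendsto_neg_atBot_atTop.comp Real.tendsto_log_nhdsGT_zero).const_mul_atTop (by positivity)
  let T : ℝ → ℝ := fun s => K * g (β - s) + -(K * g (s - α))
  have hT : ∀ s ∈ Ioo α β, HasDerivAt T ((a * ((s - α) * (s - β))) ^ 2)⁻¹ s := fun s hs => by
    have h1 : 0 < β - s := sub_pos.2 hs.2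
    have h2 : 0 < s - α := sub_pos.2 hs.1
    have e1 : HasDerivAt (fun s => g (β - s)) ((-((β - s) ^ 2)⁻¹ + 2 / D * -(β - s)⁻¹) * -1) s :=
      (hg _ h1).comp s ((hasDerivAt_id s).const_sub β)
    have e2 : HasDerivAt (fun s => g (s - α)) ((-((s - α) ^ 2)⁻¹ + 2 / D * -(s - α)⁻¹) * 1) s :=
      ((hg _ h2).comp_sub_const s α).congr_deriv (mul_one _).symm
    refine ((e1.const_mul K).add (e2.const_mul K).neg).congr_deriv ?_
    have h3 : s - β = -(β - s) := by ring
    have h4 : D = (β - s) + (s - α) := by rw [hD]; ring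
    rw [h3, hK, h4]
    have h5 : 0 < (β - s) + (s - α) := by linarith
    generalize β - s = x at *
    generalize s - α = y at *
    field_simp
    ring
  have hcont : ContinuousOn T (Ioo α β) := fun s hs => (hT s hs).continuousAt.continuousWithinAt
  have htop : Tendsto T (𝓝[<] β) atTop := by
    have h1 : Tendsto (fun s => β - s) (𝓝[<] β) (𝓝[>] 0) := by
      refine tendsto_nhdsWithin_iff.2 ⟨?_, ?_⟩
      · have : Continuous fun s : ℝ => β - s := by fun_prop
        simpa using (this.tendsto β).mono_left nhdsWithin_le_nhds
      · filter_upwards [self_mem_nhdsWithin] with s hs using sub_pos.2 (mem_Iio.1 hs)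
    have h2 : Tendsto (fun s => -(K * g (s - α))) (𝓝[<] β) (𝓝 (-(K * g (β - α)))) := by
      have : ContinuousAt (fun s => g (s - α)) β :=
        ContinuousAt.comp_of_eq (hg _ hD0).continuousAt (by fun_prop) rfl
      exact ((this.const_mul K).neg).tendsto.mono_left nhdsWithin_le_nhds
    exact ((hg0.comp h1).const_mul_atTop hK0).atTop_add h2
  have hbot : Tendsto T (𝓝[>] α) atBot := by
    have h1 : Tendsto (fun s => s - α) (𝓝[>] α) (𝓝[>] 0) := by
      refine tendsto_nhdsWithin_iff.2 ⟨?_, ?_⟩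
      · have : Continuous fun s : ℝ => s - α := by fun_prop
        simpa using (this.tendsto α).mono_left nhdsWithin_le_nhds
      · filter_upwards [self_mem_nhdsWithin] with s hs using sub_pos.2 (mem_Ioi.1 hs)
    have h2 : Tendsto (fun s => K * g (β - s)) (𝓝[>] α) (𝓝 (K * g (β - α))) := by
      have : ContinuousAt (fun s => g (β - s)) α :=
        ContinuousAt.comp_of_eq (hg _ hD0).continuousAt (by fun_prop) rfl
      exact (this.const_mul K).tendsto.mono_left nhdsWithin_le_nhds
    exact h2.add_atBot (tendsto_neg_atTop_atBot.comp ((hg0.comp h1).const_mul_atTop hK0))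
  refine ⟨T, hT, eq_univ_of_univ_subset ?_⟩
  exact hcont.surjOn_of_tendsto (nonempty_Ioo.2 hαβ) ((tendsto_comp_coe_Ioo_atBot hαβ).2 hbot)
    ((tendsto_comp_coe_Ioo_atTop hαβ).2 htop)

theorem exists_roots {a b c : ℝ} (ha : 0 < a) (hc : c < 0) : ∃ α β : ℝ, α < β ∧
    ∀ s, c + b * s + a * s ^ 2 = a * ((s - α) * (s - β)) := by
  have hac : 0 < a * -c := mul_pos ha (neg_pos.2 hc)
  have hΔ : 0 < b ^ 2 - 4 * a * c := by nlinarith [sq_nonneg b]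
  have hsq := Real.sq_sqrt hΔ.le
  have hpos := Real.sqrt_pos.2 hΔ
  set δ := √(b ^ 2 - 4 * a * c)
  refine ⟨(-b - δ) / (2 * a), (-b + δ) / (2 * a), ?_, fun s => ?_⟩
  · gcongr
    linarith
  · field_simp
    linear_combination hsq

theorem hasFDerivAt_ballPotential (d : ℕ) (x : E d) :
    HasFDerivAt (ballPotential d) ((2 : ℝ) • form d d x) x :=
  (hasFDerivAt_quad d d x).sub_const 1

/-- Geodesics of the connection of potential `ψ` satisfy a first-order equation. -/
theorem SolvesGeodesicEq.exists_hasDerivAt {d : ℕ} {ψ : E d → ℝ} (hψ : Differentiable ℝ ψ)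
    {c : ℝ → E d} {I : Set ℝ} (hI : IsOpen I) (hI' : I.OrdConnected)
    (hc : SolvesGeodesicEq (potentialSymbol ψ) c I) (h0 : ∀ t ∈ I, ψ (c t) ≠ 0) :
    ∃ w : E d, ∀ t ∈ I, HasDerivAt c (ψ (c t) ^ 2 • w) t := by
  -- The geodesic equation says exactly that `ψ⁻² c'` is conserved; its constant value is the
  -- direction `w`.
  have hd : ∀ t ∈ I, HasDerivAt (fun t => (ψ (c t) ^ 2)⁻¹ • deriv c t) 0 t := fun t ht => by
    have h1 : HasDerivAt (fun t => ψ (c t)) (fderiv ℝ ψ (c t) (deriv c t)) t :=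
      (hψ (c t)).hasFDerivAt.comp_hasDerivAt t (hc t ht).1.hasDerivAt
    refine (((h1.pow 2).inv (pow_ne_zero 2 (h0 t ht))).smul (hc t ht).2).congr_deriv ?_
    rw [potentialSymbol, projectiveSymbol_apply]
    simp only [neg_apply, smul_apply, smul_eq_mul, Pi.inv_apply, Pi.pow_apply]
    have := h0 t ht
    match_scalars
    field_simp
    norm_num
    exact Or.inr (by ring)
  obtain ⟨w, hw⟩ := hI.exists_is_const_of_deriv_eq_zero hI'.isPreconnected
    (fun t ht => (hd t ht).differentiableAt.differentiableWithinAt) fun t ht => (hd t ht).deriv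
  refine ⟨w, fun t ht => ?_⟩
  rw [← hw t ht, smul_smul, mul_inv_cancel₀ (pow_ne_zero 2 (h0 t ht)), one_smul]
  exact (hc t ht).1.hasDerivAt

theorem solvesGeodesicEq_const {d : ℕ} (Γ : Symbol d) (x : E d) (J : Set ℝ) :
    SolvesGeodesicEq Γ (fun _ => x) J := fun t _ => by
  have : deriv (fun _ : ℝ => x) = fun _ => 0 := by
    ext1 t
    exact deriv_const t x
  refine ⟨differentiableAt_const x, ?_⟩
  rw [this]
  simpa using hasDerivAt_const t (0 : E d)

/-- The geodesics of the unit ball extend. -/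
theorem exists_geodesic_ball {d : ℕ} {c : ℝ → E d} {I : Set ℝ} (hI : IsOpen I)
    (hI' : I.OrdConnected) (hc : SolvesGeodesicEq (potentialSymbol (ballPotential d)) c I)
    (hcB : ∀ t ∈ I, ballPotential d (c t) < 0) :
    ∃ c' : ℝ → E d, SolvesGeodesicEq (potentialSymbol (ballPotential d)) c' univ ∧
      (∀ t, ballPotential d (c' t) < 0) ∧ EqOn c' c I := by
  rcases I.eq_empty_or_nonempty with rfl | ⟨t₀, ht₀⟩
  · exact ⟨fun _ => 0, solvesGeodesicEq_const _ _ _, fun t => by simp [ballPotential, quad],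
      fun t ht => ht.elim⟩
  have hψ : Differentiable ℝ (ballPotential d) := fun x =>
    (hasFDerivAt_ballPotential d x).differentiableAt
  obtain ⟨w, hw⟩ := hc.exists_hasDerivAt hψ hI hI' fun t ht => (hcB t ht).ne
  have hconst : ∀ {f : ℝ → E d}, (∀ t ∈ I, HasDerivAt f 0 t) → ∀ t ∈ I, f t = f t₀ :=
    fun hf t ht => hI.is_const_of_deriv_eq_zero hI'.isPreconnected
      (fun t ht => (hf t ht).differentiableAt.differentiableWithinAt)
      (fun t ht => (hf t ht).deriv) ht ht₀
  rcases eq_or_ne w 0 with rfl | hw0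
  · refine ⟨fun _ => c t₀, solvesGeodesicEq_const _ _ _, fun _ => hcB t₀ ht₀, fun t ht => ?_⟩
    exact (hconst (fun t ht => by simpa using hw t ht) t ht).symm
  set x := c t₀
  -- The line through `x` in the direction `w` crosses the sphere at the parameters `α` and `β`, on
  -- either side of the interior point `x`.
  obtain ⟨α, β, hαβ, hroots⟩ := exists_roots (b := 2 * form d d x w) (quad_self_pos hw0)
    (hcB t₀ ht₀)
  have hline : ∀ s : ℝ, ballPotential d (x + s • w) = quad d d w * ((s - α) * (s - β)) :=
    fun s => by
    rw [← hroots, ballPotential, ballPotential, quad_add, quad_smul, map_smul, smul_eq_mul]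
    ring
  have hmem : ∀ s : ℝ, ballPotential d (x + s • w) < 0 ↔ s ∈ Ioo α β := fun s => by
    have hq := quad_self_pos hw0
    rw [hline, mul_neg_iff, and_iff_right hq, or_iff_left fun h => h.1.not_gt hq, mul_neg_iff,
      mem_Ioo]
    constructor
    · rintro (⟨h1, h2⟩ | ⟨h1, h2⟩)
      · exact ⟨by linarith, by linarith⟩
      · linarith
    · rintro ⟨h1, h2⟩
      exact Or.inl ⟨by linarith, by linarith⟩
  obtain ⟨T, hT, hTsurj⟩ := exists_affine_parameter_chord (quad_self_pos hw0).ne' hαβ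
  have hT' : ∀ s ∈ Ioo α β, HasDerivAt T (ballPotential d (x + s • w) ^ 2)⁻¹ s := fun s hs => by
    rw [hline]
    exact hT s hs
  have hlc : Continuous fun s : ℝ => ballPotential d (x + s • w) :=
    hψ.continuous.comp (by fun_prop)
  have hne : ∀ s ∈ Ioo α β, ballPotential d (x + s • w) ≠ 0 := fun s hs => ((hmem s).2 hs).ne
  obtain ⟨-, -, σ, hσ⟩ := exists_inverse_of_hasDerivAt_pos isOpen_Ioo ordConnected_Ioo hT'
    ((hlc.pow 2).continuousOn.inv₀ fun s hs => pow_ne_zero 2 (hne s hs))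
    (fun s hs => by have := hne s hs; positivity)
  have hσmem : ∀ τ, σ τ ∈ Ioo α β ∧ HasDerivAt σ (ballPotential d (x + σ τ • w) ^ 2) τ :=
    fun τ => by
    obtain ⟨s, hs, rfl⟩ := hTsurj.symm ▸ mem_univ τ
    rw [(hσ s hs).1]
    exact ⟨hs, by simpa using (hσ s hs).2⟩
  obtain ⟨i, hi⟩ := Function.ne_iff.1 hw0
  have hi : w i ≠ 0 := hi
  -- A linear form with `lam w = 1` extracts the position parameter along the line.
  let lam : E d →L[ℝ] ℝ := (w i)⁻¹ • ContinuousLinearMap.proj i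
  have hlam : lam w = 1 := by simp [lam, hi]
  have hs' : ∀ t ∈ I, HasDerivAt (fun t => lam (c t - x)) (ballPotential d (c t) ^ 2) t :=
    fun t ht => by
    refine (lam.hasFDerivAt.comp_hasDerivAt t ((hw t ht).sub_const x)).congr_deriv ?_
    rw [map_smul, hlam, smul_eq_mul, mul_one]
  have hcs : ∀ t ∈ I, c t = x + lam (c t - x) • w := fun t ht => by
    have h1 := hconst (f := fun t => c t - lam (c t - x) • w) (fun t ht => by
      refine ((hw t ht).sub ((hs' t ht).smul_const w)).congr_deriv ?_
      rw [sub_self]) t ht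
    have h2 : c t₀ - x = 0 := sub_self _
    simp only [h2, map_zero, zero_smul, sub_zero] at h1
    exact sub_eq_iff_eq_add.1 h1
  have hsmem : ∀ t ∈ I, lam (c t - x) ∈ Ioo α β := fun t ht => by
    rw [← hmem, ← hcs t ht]
    exact hcB t ht
  -- Time and the affine parameter of the chord differ by a constant `τ₀`. Since `T` is onto `ℝ`,
  -- its shifted inverse extends the geodesic to all times.
  have hTs : ∀ t ∈ I, T (lam (c t - x)) - t = T (lam (c t₀ - x)) - t₀ := fun t ht => by
    have hd : ∀ t ∈ I, HasDerivAt (fun t => T (lam (c t - x)) - t) 0 t := fun t ht => by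
      have h1 := (hT' _ (hsmem t ht)).comp t (hs' t ht)
      rw [← hcs t ht, inv_mul_cancel₀ (pow_ne_zero 2 (hcB t ht).ne)] at h1
      refine (h1.sub (hasDerivAt_id t)).congr_deriv (sub_self _)
    exact hI.is_const_of_deriv_eq_zero hI'.isPreconnected
      (fun t ht => (hd t ht).differentiableAt.differentiableWithinAt)
      (fun t ht => (hd t ht).deriv) ht ht₀
  set τ₀ := T (lam (c t₀ - x)) - t₀
  refine ⟨fun t => x + σ (t + τ₀) • w, ?_, fun t => (hmem _).2 (hσmem _).1, fun t ht => ?_⟩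
  · exact solvesGeodesicEq_line hψ isOpen_univ (fun t _ => hne _ (hσmem _).1)
      fun t _ => (hσmem (t + τ₀)).2.comp_add_const t τ₀
  · have h1 : t + τ₀ = T (lam (c t - x)) := by rw [← hTs t ht]; ring
    simp only [h1, (hσ _ (hsmem t ht)).1]
    exact (hcs t ht).symm

/-! ### The main theorem -/

namespace AffineConnection

variable {p d : ℕ} {M : Type*} [TopologicalSpace M] [ChartedSpace (E d) M]
  {conn : AffineConnection d M} {F : E d → M}

/-- A geodesic of `M` is lifted to the ball by the continuous section `f`, extended there, and
pushed back by `F`. -/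
theorem IsDevelopmentOn.geodesicallyComplete [HasGroupoid M (similarityGroupoid p d)]
    (hF : conn.IsDevelopmentOn p (ballPotential d) F {x | ballPotential d x < 0}) {f : M → E d}
    (hf : Continuous f) (hfB : ∀ m, ballPotential d (f m) < 0) (hFf : ∀ m, F (f m) = m) :
    conn.GeodesicallyComplete := by
  intro I γ hI hI' hγ
  have hFγ : F ∘ f ∘ γ = γ := funext fun t => hFf (γ t)
  have hc := hF.solvesGeodesicEq hI (c := f ∘ γ) (hf.comp_continuousOn hγ.1)
    (fun t _ => hfB (γ t)) (by rwa [hFγ])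
  obtain ⟨c', hc', hc'B, heq⟩ := exists_geodesic_ball hI hI' hc fun t _ => hfB (γ t)
  refine ⟨F ∘ c', hF.isGeodesicOn isOpen_univ hc' fun t _ => hc'B t, fun t ht => ?_⟩
  rw [Function.comp_apply, heq ht, Function.comp_apply, hFf]

end AffineConnection

theorem modelPotential_neg_one_self (d : ℕ) : modelPotential (-1) d d = ballPotential d := by
  ext x
  rw [modelPotential, ballPotential, sub_eq_add_neg]

theorem modelPotential_one_zero (d : ℕ) (x : E d) :
    modelPotential 1 0 d x = -1 * ballPotential d x := by
  rw [modelPotential, ballPotential, quad_eq_mul_quad_self (Or.inr ⟨rfl, rfl⟩)]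
  ring

/-- The half-space condition in `modelDomain` is vacuous for these parameters, since it would need
`d = d + 1`. -/
theorem mem_modelDomain_neg_one {d : ℕ} (x : E d) :
    x ∈ modelDomain (-1) (-1) d d ↔ ballPotential d x < 0 := by
  change (_ ∧ _) ↔ _
  simp [modelPotential_neg_one_self]

theorem mem_modelDomain_one {d : ℕ} (x : E d) :
    x ∈ modelDomain 1 1 0 d ↔ ballPotential d x < 0 := by
  change (_ ∧ _) ↔ _
  simp [modelPotential_one_zero]

/-- A connection isomorphic to a connection on the unit ball of potential `|x|² - 1` is geodesically
complete. -/
theorem AffineConnection.geodesicallyComplete_of_isomorphic {p d : ℕ} {M : Type*}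
    [TopologicalSpace M] [ChartedSpace (E d) M] [HasGroupoid M (similarityGroupoid p d)]
    [Nonempty M] {conn : AffineConnection d M} {U : TopologicalSpace.Opens (E d)}
    (hU : ∀ x, x ∈ U ↔ ballPotential d x < 0) {conn' : AffineConnection d U}
    (hconn' : ∀ e ∈ atlas (E d) U, ∀ x, conn'.symbol e x = potentialSymbol (ballPotential d) x)
    (h : conn.Isomorphic p conn') : conn.GeodesicallyComplete := by
  obtain ⟨F, f, hf, hfU, hFf, hF⟩ := h.exists_development hconn' fun x hx => ((hU x).1 hx).ne
  exact IsDevelopmentOn.geodesicallyComplete (hF.mono fun x hx => (hU x).2 hx) hf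
    (fun m => (hU _).1 (hfU m)) hFf

theorem AffineConnection.IsDevelopmentOn.isomorphic_ball {p d : ℕ} {M : Type*}
    [TopologicalSpace M] [ChartedSpace (E d) M] [HasGroupoid M (similarityGroupoid p d)]
    [T2Space M] [PreconnectedSpace M] (hd : 2 ≤ d)
    {conn : AffineConnection d M} (hstiff : conn.IsStiff p) {ν : ℝ}
    (hν : (p = d ∧ ν = 1) ∨ (p = 0 ∧ ν = -1)) {F : E d → M}
    (hF : conn.IsDevelopmentOn p (ballPotential d) F {x | ballPotential d x < 0})
    {U : TopologicalSpace.Opens (E d)}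
    (hU : ∀ x, x ∈ U ↔ ballPotential d x < 0) {conn' : AffineConnection d U}
    (hconn' : ∀ e ∈ atlas (E d) U, ∀ x, conn'.symbol e x = potentialSymbol (ballPotential d) x) :
    conn.Isomorphic p conn' := by
  have hUB : (U : Set (E d)) = {x | ballPotential d x < 0} := Set.ext hU
  refine IsDevelopmentOn.isomorphic (ψ := ballPotential d) hconn' (F := F) (hUB ▸ hF)
    (hUB ▸ hF.injOn_ball hν) ?_
  rw [hUB]
  exact hF.image_ball hd hstiff hν

theorem canonicalModel_symbol_neg_one {d : ℕ}
    (e : OpenPartialHomeomorph (modelDomain (-1) (-1) d d) (E d)) (x : E d) :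
    (canonicalModel (-1) (-1) d d).symbol e x = potentialSymbol (ballPotential d) x := by
  rw [← modelPotential_neg_one_self]
  rfl

/-- In signature `(0, d)` the potential `q + 1` is `-(|x|² - 1)`, and a nonzero factor does not
change the connection. -/
theorem canonicalModel_symbol_one {d : ℕ}
    (e : OpenPartialHomeomorph (modelDomain 1 1 0 d) (E d)) (x : E d) :
    (canonicalModel 1 1 0 d).symbol e x = potentialSymbol (ballPotential d) x :=
  potentialSymbol_const_mul (neg_ne_zero.2 one_ne_zero) (modelPotential_one_zero d) x

end StiffConnections

end

theorem mainTheorem9 (p d : ℕ) (hp : p ≤ d) (hd : 2 ≤ d)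
    (M : Type*) [TopologicalSpace M] [T2Space M] [ConnectedSpace M]
    [ChartedSpace (E d) M] [HasGroupoid M (similarityGroupoid p d)]
    (conn : AffineConnection d M) (hstiff : conn.IsStiff p) (hflat : ¬ conn.IsFlat) :
    conn.GeodesicallyComplete ↔
      (p = d ∧ conn.Isomorphic p (canonicalModel (-1) (-1) d d)) ∨
      (p = 0 ∧ conn.Isomorphic p (canonicalModel 1 1 0 d)) := by
  constructor
  · intro hcomp
    obtain ⟨ν, hν, F, hF⟩ := hcomp.exists_ball_development hp hd hstiff hflat
    rcases hν with ⟨h, -⟩ | ⟨h, -⟩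
    · exact Or.inl ⟨h, hF.isomorphic_ball hd hstiff (Or.inl ⟨h, rfl⟩) mem_modelDomain_neg_one
        fun e _ => canonicalModel_symbol_neg_one e⟩
    · exact Or.inr ⟨h, hF.isomorphic_ball hd hstiff (Or.inr ⟨h, rfl⟩) mem_modelDomain_one
        fun e _ => canonicalModel_symbol_one e⟩
  · rintro (⟨-, h⟩ | ⟨-, h⟩)
    · exact AffineConnection.geodesicallyComplete_of_isomorphic mem_modelDomain_neg_one
        (fun e _ => canonicalModel_symbol_neg_one e) h
    · exact AffineConnection.geodesicallyComplete_of_isomorphic mem_modelDomain_one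
        (fun e _ => canonicalModel_symbol_one e) h
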